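/- Let $M$ be a smooth manifold of dimension $m$ with a smooth pseudo-Riemannian metric $g_0$ (of any signature) of constant sectional curvature, let $H(x,p)=\tfrac12 g_0^{ij}(x)p_ip_j$ be the Hamiltonian of its geodesic flow on $T^*M$, and let $U\subseteq M$ be a simply connected (in particular connected) open set. A Killing $d$-tensor on $U$ is a function $K(x,p)=K^{i_1\dots i_d}(x)p_{i_1}\cdots p_{i_d}$ on $T^*U$, homogeneous polynomial of degree $d$ in the momenta $p$ with coefficients smooth in $x$, such that $\{H,K\}=0$. Let $\mathcal K_{m,d}(g_0)$ be the space of these. Let $P$ and $Q$ be homogeneous polynomials in $p$ of degrees $r$ and $s$ with coefficients smooth in $x\in U$. They are called generically relatively prime if for a dense set of $x\in U$ the polynomials $P(x,\cdot)$, $Q(x,\cdot)$ have no nonconstant common factor and $Q(x,\cdot)\neq0$. A rational integral of bidegree $(r,s)$ on $U$ is a fraction $F=P/Q$ of generically relatively prime $P,Q$ of degrees $r$ and $s$ such that the set of those $x$ with $P(x,\cdot)=Q(x,\cdot)=0$ does not separate any connected open subset of $U$, and $\{H,F\}=0$ wherever $Q\ne0$. Two fractions $P/Q$ and $A/B$ are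 identified if $PB=AQ$. Let $\mathcal R_{m,r,s}(g_0)$ be the set of rational integrals of bidegree $(r,s)$ on $U$. Theorem. For all $r,s\geq 0$, $$\mathcal R_{m,r,s}(g_0)=\{P/Q:\ P\in\mathcal K_{m,r}(g_0),\ Q\in\mathcal K_{m,s}(g_0),\ P,Q\text{ generically relatively prime}\}.$$ That is, every rational integral of bidegree $(r,s)$ on $U$ equals $A/B$ for some generically relatively prime Killing tensors $A,B$ on $U$ of degrees $r$ and $s$; and conversely every such ratio $A/B$ is a rational integral of bidegree $(r,s)$ on $U$. -/

import Mathlib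

open Set Topology
open scoped Manifold ContDiff

noncomputable section

namespace RationalIntegrals

/-- The model space `ℝ^m`. -/
abbrev E (m : ℕ) : Type := EuclideanSpace ℝ (Fin m)

/-- The `i`-th standard basis vector of `ℝ^m`. -/
def stdVec {m : ℕ} (i : Fin m) : E m := EuclideanSpace.single i (1 : ℝ)

/-- The partial derivative `∂f/∂u_i` at `u`. -/
def pd {m : ℕ} (i : Fin m) (f : E m → ℝ) (u : E m) : ℝ := fderiv ℝ f u (stdVec i)

section Manifold

variable {m : ℕ} {M : Type*} [TopologicalSpace M] [ChartedSpace (E m) M]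

/-- The smooth coordinate charts of `M`. -/
def IsChart (φ : OpenPartialHomeomorph M (E m)) : Prop :=
  φ ∈ IsManifold.maximalAtlas (𝓡 m) ∞ M

/-- The coordinate vector `∂/∂u_i` of the chart `φ`, at the point with coordinates `u`. -/
def coordVector (φ : OpenPartialHomeomorph M (E m)) (u : E m) (i : Fin m) :
    TangentSpace (𝓡 m) (φ.symm u) :=
  mfderiv (𝓡 m) (𝓡 m) φ.symm u (stdVec i)

/-- The covector `∑ a_i du_i` of the chart `φ`, at the point with coordinates `u`. Thus `(u, a)` are
the canonical coordinates on `T^*M` (position, momentum) that belong to `φ`. -/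
def coordCovector (φ : OpenPartialHomeomorph M (E m)) (u a : E m) :
    TangentSpace (𝓡 m) (φ.symm u) →L[ℝ] ℝ :=
  (innerSL ℝ a).comp (mfderiv (𝓡 m) (𝓡 m) φ (φ.symm u) :
    TangentSpace (𝓡 m) (φ.symm u) →L[ℝ] E m)

/-- The components `g_ij` in the chart `φ` of a field of bilinear forms. -/
def coordMatrix
    (g : ∀ x : M, TangentSpace (𝓡 m) x →L[ℝ] TangentSpace (𝓡 m) x →L[ℝ] ℝ)
    (φ : OpenPartialHomeomorph M (E m)) (u : E m) : Matrix (Fin m) (Fin m) ℝ :=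
  Matrix.of fun i j => g (φ.symm u) (coordVector φ u i) (coordVector φ u j)

variable (m M) in
/-- A smooth pseudo-Riemannian metric (of any signature) on `M`. -/
structure PseudoMetric where
  /-- the bilinear form on each tangent space -/
  form : ∀ x : M, TangentSpace (𝓡 m) x →L[ℝ] TangentSpace (𝓡 m) x →L[ℝ] ℝ
  symm : ∀ x v w, form x v w = form x w v
  nondegenerate : ∀ x v, (∀ w, form x v w = 0) → v = 0
  smooth : ∀ φ : OpenPartialHomeomorph M (E m), IsChart φ →
    ∀ i j, ContDiffOn ℝ ∞ (fun u => coordMatrix form φ u i j) φ.target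

/-- The components `g_ij` of the metric in the chart `φ`. -/
def PseudoMetric.lower (g : PseudoMetric m M) (φ : OpenPartialHomeomorph M (E m)) (u : E m) :
    Matrix (Fin m) (Fin m) ℝ := coordMatrix g.form φ u

/-- The components `g^ij` of the inverse metric in the chart `φ`. -/
def PseudoMetric.upper (g : PseudoMetric m M) (φ : OpenPartialHomeomorph M (E m)) (u : E m) :
    Matrix (Fin m) (Fin m) ℝ := (g.lower φ u)⁻¹

/-- The Christoffel symbols `Γ^k_ij` of the Levi-Civita connection in the chart `φ`. -/
def PseudoMetric.christoffel (g : PseudoMetric m M) (φ : OpenPartialHomeomorph M (E m))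
    (k i j : Fin m) (u : E m) : ℝ :=
  1 / 2 * ∑ l, g.upper φ u k l *
    (pd i (fun y => g.lower φ y j l) u + pd j (fun y => g.lower φ y i l) u
      - pd l (fun y => g.lower φ y i j) u)

/-- The component `R^l_kij` of the curvature tensor: `R(∂_i, ∂_j) ∂_k = ∑_l R^l_kij ∂_l`, where
`R(X, Y) = [∇_X, ∇_Y] - ∇_[X, Y]`. -/
def PseudoMetric.curvature (g : PseudoMetric m M) (φ : OpenPartialHomeomorph M (E m))
    (l k i j : Fin m) (u : E m) : ℝ :=
  pd i (g.christoffel φ l j k) u - pd j (g.christoffel φ l i k) u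
    + ∑ n, (g.christoffel φ l i n u * g.christoffel φ n j k u
      - g.christoffel φ l j n u * g.christoffel φ n i k u)

/-- Constant (sectional) curvature: for some constant `κ`,
`R(X, Y) Z = κ (g(Y, Z) X - g(X, Z) Y)` for all `X`, `Y`, `Z`. -/
def PseudoMetric.HasConstantCurvature (g : PseudoMetric m M) : Prop :=
  ∃ κ : ℝ, ∀ φ : OpenPartialHomeomorph M (E m), IsChart φ → ∀ u ∈ φ.target, ∀ l k i j : Fin m,
    g.curvature φ l k i j u =
      κ * (g.lower φ u j k * (if l = i then 1 else 0) - g.lower φ u i k * (if l = j then 1 else 0))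

/-- The Hamiltonian `H = 1/2 ∑ g^ij p_i p_j` of the geodesic flow, in the canonical coordinates
`(u, a)` of the chart `φ`. -/
def PseudoMetric.hamiltonian (g : PseudoMetric m M) (φ : OpenPartialHomeomorph M (E m))
    (u a : E m) : ℝ :=
  1 / 2 * ∑ i, ∑ j, g.upper φ u i j * a i * a j

/-- The canonical Poisson bracket `{H, F} = X_H(F)`, in canonical coordinates
(position `u`, momentum `a`). -/
def poisson (H F : E m → E m → ℝ) (u a : E m) : ℝ :=
  ∑ i, (pd i (fun b => H u b) a * pd i (fun y => F y a) u
    - pd i (fun y => H y a) u * pd i (fun b => F u b) a)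

/-- The value at the covector `p ∈ T_x^*M` of a function on `T^*M` that is a polynomial on every
fibre. Such a function `P` is given by polynomials `P x` in the components of covectors with
respect to the standard basis of `T_xM` (as a type, `TangentSpace (𝓡 m) x` is `ℝ^m`). -/
def value (P : M → MvPolynomial (Fin m) ℝ) (x : M) (p : TangentSpace (𝓡 m) x →L[ℝ] ℝ) : ℝ :=
  MvPolynomial.eval (fun i => p (stdVec i : E m)) (P x)

/-- The function `P` on `T^*M` in the canonical coordinates `(u, a)` of the chart `φ`. -/
def inChart (P : M → MvPolynomial (Fin m) ℝ) (φ : OpenPartialHomeomorph M (E m)) (u a : E m) : ℝ :=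
  value P (φ.symm u) (coordCovector φ u a)

/-- On the open set `U ⊆ M`, the function `P = P^{i_1 … i_d}(x) p_{i_1} ⋯ p_{i_d}` is a homogeneous
polynomial of degree `d` in momenta with smooth coefficients. -/
structure IsMomentumPolynomial (U : Set M) (d : ℕ) (P : M → MvPolynomial (Fin m) ℝ) : Prop where
  homogeneous : ∀ x ∈ U, (P x).IsHomogeneous d
  smooth : ∀ φ : OpenPartialHomeomorph M (E m), IsChart φ →
    ContDiffOn ℝ ∞ (fun z : E m × E m => inChart P φ z.1 z.2)
      ((φ.target ∩ φ.symm ⁻¹' U) ×ˢ univ)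

/-- `K` is a Killing `d`-tensor on `U`: a homogeneous polynomial of degree `d` in momenta, with
smooth coefficients, that is an integral of the geodesic flow, `{H, K} = 0`. -/
structure IsKillingTensor (g : PseudoMetric m M) (U : Set M) (d : ℕ)
    (K : M → MvPolynomial (Fin m) ℝ) : Prop where
  polynomial : IsMomentumPolynomial U d K
  integral : ∀ φ : OpenPartialHomeomorph M (E m), IsChart φ →
    ∀ u ∈ φ.target, φ.symm u ∈ U → ∀ a : E m,
      poisson (g.hamiltonian φ) (inChart K φ) u a = 0

/-- `P` and `Q` are relatively prime as polynomials in momenta over generic points of `U`: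
for a dense set of `x`, `Q x ≠ 0` and `P x`, `Q x` have no nonconstant common factor. -/
def GenericallyRelPrime (U : Set M) (P Q : M → MvPolynomial (Fin m) ℝ) : Prop :=
  U ⊆ closure {x ∈ U | Q x ≠ 0 ∧ IsRelPrime (P x) (Q x)}

/-- The set of points over which `P / Q` reads `0 / 0` does not separate any connected open subset
of `U`. (This takes the place of: `P` and `Q` have no common factor that depends on `x` alone.) -/
def CommonZerosDoNotSeparate (U : Set M) (P Q : M → MvPolynomial (Fin m) ℝ) : Prop :=
  ∀ V : Set M, V ⊆ U → IsOpen V → IsPreconnected V →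
    IsPreconnected (V \ {x | P x = 0 ∧ Q x = 0})

/-- The fraction `F = P / Q` is a rational integral of bidegree `(r, s)` on `U`: `P` and `Q` are
relatively prime homogeneous polynomials in momenta of degrees `r` and `s`, with smooth
coefficients, and `{H, F} = 0` wherever `Q ≠ 0`. -/
structure IsRationalIntegral (g : PseudoMetric m M) (U : Set M) (r s : ℕ)
    (P Q : M → MvPolynomial (Fin m) ℝ) : Prop where
  numerator : IsMomentumPolynomial U r P
  denominator : IsMomentumPolynomial U s Q
  relPrime : GenericallyRelPrime U P Q
  commonZeros : CommonZerosDoNotSeparate U P Q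
  integral : ∀ φ : OpenPartialHomeomorph M (E m), IsChart φ →
    ∀ u ∈ φ.target, φ.symm u ∈ U → ∀ a : E m, inChart Q φ u a ≠ 0 →
      poisson (g.hamiltonian φ) (fun y b => inChart P φ y b / inChart Q φ y b) u a = 0

/-- `P / Q = A / B` over `U`, as fractions. -/
def SameFraction (U : Set M) (P Q A B : M → MvPolynomial (Fin m) ℝ) : Prop :=
  ∀ x ∈ U, P x * B x = A x * Q x

end Manifold

end RationalIntegrals

end

/-! Constant curvature makes the geodesic flow locally a flow along straight lines (Beltrami). The
overdetermined equation Hess y = -κ y g can be solved locally with any initial value and gradient,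
because constant curvature is what makes its prolonged linear system for (y, dy) flat
(`hessConnection_flat`, `exists_parallel_sections`). Along a geodesic every solution satisfies y'' =
-2κHy with the same factor, so the Wronskian of two solutions is conserved. Take y₀ with value 1 and
gradient 0 at a point, and yᵢ with value 0 and gradient eᵢ. The quotients ξᵢ = yᵢ/y₀ are coordinates
there, the Wronskians qᵢ = y₀² ξᵢ' are constant along the flow, and in the coordinates (ξ, q) the
Hamiltonian field is y₀⁻² q ∂/∂ξ (`isStraightening_of_conformal`, `exists_isStraightening`).

In these coordinates the ratio P/Q of a rational integral is constant along each segment from x to z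
at momentum z - x, so P(x, z-x) Q(z, z-x) = P(z, z-x) Q(x, z-x). For fixed z this is a linear
equation for the coefficients of P(x, ·) and Q(x, ·), and its coefficients are polynomials in x.
Linear algebra over the field of rational functions therefore replaces P/Q by V/U with V and U
polynomial in x and q (`IsFlatPair.exists_rational`). Let A/B be V/U in lowest terms and D = ∑ qᵢ
∂/∂xᵢ. Invariance says B·DA = A·DB, so A divides DA. But D lowers the degree in x, hence DA = 0, and
likewise DB = 0 (`lineDerivation_eq_zero_of_isRelPrime`): A and B are Killing tensors. This works
near any point where P and Q are not both zero; since the remaining points do not separate a ball,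
one pair serves the whole ball (`IsFlatPair.exists_pair`).

Two coprime Killing pairs with the same ratio differ locally by a nonzero constant
(`exists_const_of_same_ratio`). These constants form a locally constant cocycle with values in ℝˣ,
which is a coboundary on a simply connected set (`exists_locallyConstant_of_cocycle`). Rescaling the
local pairs accordingly glues them.

In the converse, only the condition on common zeros is not immediate. If they separated an open set,
then near some point the denominator B would vanish somewhere on every short segment from one side
to the other. As B is conserved along lines, B(x, q) would vanish for an open set of q, so B = 0 on
one side, against generic coprimality (`IsKillingPair.commonZerosDoNotSeparate`). -/

noncomputable section

namespace RationalIntegrals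

/-! ### Frobenius' theorem for flat linear systems, by integration along rays. -/

section Frobenius

variable {E W : Type*} [NormedAddCommGroup E] [NormedSpace ℝ E] [NormedAddCommGroup W]
  [NormedSpace ℝ W]

/-- Picard–Lindelöf reaches time 1 in one step: on the ball of radius ‖w₀‖ about w₀ vectors have
norm at most 2‖w₀‖, so the bound 1/2 keeps the speed below ‖w₀‖ and the solution inside that ball.
-/
lemma exists_linear_ode_solution [CompleteSpace W] (α : ℝ → W →L[ℝ] W)
    (hα : ContinuousOn α (Icc 0 1)) (hb : ∀ t ∈ Icc (0 : ℝ) 1, ‖α t‖ ≤ 1 / 2) (w₀ : W) :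
    ∃ φ : ℝ → W, φ 0 = w₀ ∧
      ∀ t ∈ Icc (0 : ℝ) 1, HasDerivWithinAt φ (α t (φ t)) (Icc 0 1) t := by
  have hPL : IsPicardLindelof (fun t w => α t w) (⟨0, by simp⟩ : Icc (0 : ℝ) 1) w₀
      ‖w₀‖₊ 0 ‖w₀‖₊ (1 / 2) := by
    refine ⟨fun t ht => ?_, fun x _ => ?_, fun t ht x hx => ?_, ?_⟩
    · refine LipschitzWith.lipschitzOnWith ?_
      refine (α t).lipschitz.weaken ?_
      rw [← NNReal.coe_le_coe]
      simpa using hb t ht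
    · exact hα.clm_apply continuousOn_const
    · have h1 : ‖x‖ ≤ 2 * ‖w₀‖ := by
        have := norm_sub_norm_le x w₀
        have h2 : ‖x - w₀‖ ≤ ‖w₀‖ := by simpa [dist_eq_norm] using hx
        linarith
      calc ‖α t x‖ ≤ ‖α t‖ * ‖x‖ := (α t).le_opNorm x
        _ ≤ 1 / 2 * (2 * ‖w₀‖) := by
          gcongr
          exact hb t ht
        _ = _ := by simp
    · simp
  obtain ⟨φ, h0, hφ⟩ := hPL.exists_eq_forall_mem_Icc_hasDerivWithinAt₀
  exact ⟨φ, h0, hφ⟩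

/-- Grönwall with zero initial value, in a form linear in ε and uniform in t. A derivative error of
order ‖k‖ or ‖k‖² thus becomes an error of the same order in the solution. -/
lemma norm_le_of_norm_deriv_le {φ φ' : ℝ → W} {C ε : ℝ} (hC : 0 < C)
    (hφ : ∀ t ∈ Icc (0 : ℝ) 1, HasDerivWithinAt φ (φ' t) (Icc 0 1) t) (h0 : φ 0 = 0)
    (hb : ∀ t ∈ Icc (0 : ℝ) 1, ‖φ' t‖ ≤ C * ‖φ t‖ + ε) (hε : 0 ≤ ε) :
    ∀ t ∈ Icc (0 : ℝ) 1, ‖φ t‖ ≤ Real.exp C / C * ε := by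
  intro t ht
  have h := norm_le_gronwallBound_of_norm_deriv_right_le (f := φ) (f' := φ') (δ := 0) (K := C)
    (ε := ε) (a := 0) (b := 1) (fun t ht => (hφ t ht).continuousWithinAt)
    (fun t ht => ((hφ t ⟨ht.1, ht.2.le⟩).mono_of_mem_nhdsWithin
      (Icc_mem_nhdsGE_of_mem ht))) (by simp [h0])
    (fun t ht => hb t ⟨ht.1, ht.2.le⟩) t ht
  rw [gronwallBound_of_K_ne_0 hC.ne'] at h
  refine h.trans ?_
  have h1 : Real.exp (C * (t - 0)) - 1 ≤ Real.exp C := by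
    have : Real.exp (C * (t - 0)) ≤ Real.exp C := by
      apply Real.exp_le_exp.2
      nlinarith [ht.2]
    linarith
  calc 0 * Real.exp (C * (t - 0)) + ε / C * (Real.exp (C * (t - 0)) - 1)
      ≤ ε / C * Real.exp C := by
        rw [zero_mul, zero_add]
        gcongr
    _ = _ := by ring

set_option maxSynthPendingDepth 10 in
/-- Frobenius' theorem for linear total differential systems `dF = 𝒜 F`. -/
theorem exists_parallel_sections [CompleteSpace W] (𝒜 : E → E →L[ℝ] W →L[ℝ] W) {Ω : Set E}
    (hΩ : IsOpen Ω) {u₀ : E} (hu₀ : u₀ ∈ Ω) (h𝒜 : ContDiffOn ℝ ∞ 𝒜 Ω)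
    (hflat : ∀ u ∈ Ω, ∀ v w : E, fderiv ℝ 𝒜 u v w + (𝒜 u w).comp (𝒜 u v)
      = fderiv ℝ 𝒜 u w v + (𝒜 u v).comp (𝒜 u w)) :
    ∃ δ > 0, Metric.ball u₀ δ ⊆ Ω ∧ ∀ w₀ : W, ∃ F : E → W, F u₀ = w₀ ∧
      ∀ u ∈ Metric.ball u₀ δ, HasFDerivAt F ((𝒜 u).flip (F u)) u := by
  have hat : ∀ u ∈ Ω, ContDiffAt ℝ ∞ 𝒜 u := fun u hu => h𝒜.contDiffAt (hΩ.mem_nhds hu)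
  have hderiv : ∀ u ∈ Ω, HasFDerivAt 𝒜 (fderiv ℝ 𝒜 u) u := fun u hu =>
    ((hat u hu).differentiableAt (by simp)).hasFDerivAt
  -- A Lipschitz derivative is needed for a quadratic Taylor remainder.
  have hd1 : ContDiffAt ℝ 1 (fderiv ℝ 𝒜) u₀ := (hat u₀ hu₀).fderiv_right (by decide)
  obtain ⟨K, t, ht, hK⟩ := hd1.exists_lipschitzOnWith
  have e1 : ∀ᶠ u in 𝓝 u₀, u ∈ Ω ∧ u ∈ t ∧ ‖𝒜 u‖ < ‖𝒜 u₀‖ + 1 ∧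
      ‖fderiv ℝ 𝒜 u‖ < ‖fderiv ℝ 𝒜 u₀‖ + 1 := by
    refine Filter.Eventually.and (hΩ.mem_nhds hu₀) (Filter.Eventually.and ht (Filter.Eventually.and ?_ ?_))
    · exact (hat u₀ hu₀).continuousAt.norm.eventually_lt continuousAt_const (by simp)
    · exact hd1.continuousAt.norm.eventually_lt continuousAt_const (by simp)
  obtain ⟨R, hR, hball⟩ := Metric.eventually_nhds_iff_ball.1 e1
  obtain ⟨C, hC, hCA, hCD, hCK⟩ : ∃ C : ℝ, 0 < C ∧ ‖𝒜 u₀‖ + 1 ≤ C ∧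
      ‖fderiv ℝ 𝒜 u₀‖ + 1 ≤ C ∧ (K : ℝ) ≤ C := by
    refine ⟨‖𝒜 u₀‖ + 1 + (‖fderiv ℝ 𝒜 u₀‖ + 1) + K, by positivity, ?_, ?_, ?_⟩ <;>
      nlinarith [norm_nonneg (𝒜 u₀), norm_nonneg (fderiv ℝ 𝒜 u₀), K.coe_nonneg]
  have bA : ∀ u ∈ Metric.ball u₀ R, ‖𝒜 u‖ ≤ C := fun u hu => (hball u hu).2.2.1.le.trans hCA
  have bD : ∀ u ∈ Metric.ball u₀ R, ‖fderiv ℝ 𝒜 u‖ ≤ C :=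
    fun u hu => (hball u hu).2.2.2.le.trans hCD
  have bL : ∀ u ∈ Metric.ball u₀ R, ∀ v ∈ Metric.ball u₀ R,
      ‖fderiv ℝ 𝒜 u - fderiv ℝ 𝒜 v‖ ≤ C * ‖u - v‖ := fun u hu v hv =>
    (hK.norm_sub_le (hball u hu).2.1 (hball v hv).2.1).trans (by gcongr)
  have bA1 : ∀ u ∈ Metric.ball u₀ R, ∀ v ∈ Metric.ball u₀ R, ‖𝒜 v - 𝒜 u‖ ≤ C * ‖v - u‖ :=
    fun u hu v hv => (convex_ball u₀ R).norm_image_sub_le_of_norm_hasFDerivWithin_le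
      (fun x hx => (hderiv x (hball x hx).1).hasFDerivWithinAt) bD hu hv
  have bA2 : ∀ u ∈ Metric.ball u₀ R, ∀ v ∈ Metric.ball u₀ R,
      ‖𝒜 v - 𝒜 u - fderiv ℝ 𝒜 u (v - u)‖ ≤ C * ‖v - u‖ * ‖v - u‖ := by
    intro u hu v hv
    have hseg : segment ℝ u v ⊆ Metric.ball u₀ R := (convex_ball u₀ R).segment_subset hu hv
    refine (convex_segment u v).norm_image_sub_le_of_norm_hasFDerivWithin_le'
      (fun x hx => (hderiv x (hball x (hseg hx)).1).hasFDerivWithinAt) (fun x hx => ?_)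
      (left_mem_segment ℝ u v) (right_mem_segment ℝ u v)
    refine (bL x (hseg hx) u hu).trans ?_
    gcongr
    obtain ⟨θ, hθ, rfl⟩ := (segment_eq_image' ℝ u v ▸ hx :
      x ∈ (fun θ : ℝ => u + θ • (v - u)) '' Icc 0 1)
    rw [add_sub_cancel_left, norm_smul, Real.norm_of_nonneg hθ.1]
    exact mul_le_of_le_one_left (norm_nonneg _) hθ.2
  -- The last bound gives norm at most 1/2 to the coefficient of the ray equation, as
  -- `exists_linear_ode_solution` requires.
  obtain ⟨δ, hδ, hδR, hδ1, hδC⟩ : ∃ δ : ℝ, 0 < δ ∧ δ ≤ R ∧ δ ≤ 1 ∧ C * δ ≤ 1 / 2 := by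
    refine ⟨min (min R 1) (1 / (2 * C)), by positivity, (min_le_left _ _).trans (min_le_left _ _),
      (min_le_left _ _).trans (min_le_right _ _), ?_⟩
    calc C * min (min R 1) (1 / (2 * C)) ≤ C * (1 / (2 * C)) := by
          gcongr
          exact min_le_right _ _
      _ = 1 / 2 := by field_simp
  have hmem : ∀ h : E, ‖h‖ < δ → ∀ t ∈ Icc (0 : ℝ) 1, u₀ + t • h ∈ Metric.ball u₀ R := by
    intro h hh t ht
    rw [Metric.mem_ball, dist_eq_norm, add_sub_cancel_left, norm_smul, Real.norm_of_nonneg ht.1]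
    nlinarith [ht.2, norm_nonneg h]
  refine ⟨δ, hδ, fun u hu => (hball u (Metric.ball_subset_ball hδR hu)).1, fun w₀ => ?_⟩
  -- Parallel transport along the ray t ↦ u₀ + t h; the section will be F(u₀ + h) = φ h 1.
  have hex : ∀ h : E, ∃ φ : ℝ → W, ‖h‖ < δ → (φ 0 = w₀ ∧ ∀ t ∈ Icc (0 : ℝ) 1,
      HasDerivWithinAt φ (𝒜 (u₀ + t • h) h (φ t)) (Icc 0 1) t) := by
    intro h
    by_cases hh : ‖h‖ < δ
    · obtain ⟨φ, hφ⟩ := exists_linear_ode_solution (fun t => 𝒜 (u₀ + t • h) h) (by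
        refine ContinuousOn.clm_apply ?_ continuousOn_const
        refine h𝒜.continuousOn.comp (by fun_prop) fun t ht => (hball _ (hmem h hh t ht)).1)
        (fun t ht => by
          refine ((𝒜 _).le_opNorm h).trans ?_
          refine le_trans ?_ hδC
          have := bA _ (hmem h hh t ht)
          gcongr) w₀
      exact ⟨φ, fun _ => hφ⟩
    · exact ⟨fun _ => 0, fun h => absurd h hh⟩
  choose φ hφ using hex
  have hφ0 : ∀ h, ‖h‖ < δ → φ h 0 = w₀ := fun h hh => (hφ h hh).1
  have hφd : ∀ h, ‖h‖ < δ → ∀ t ∈ Icc (0 : ℝ) 1,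
      HasDerivWithinAt (φ h) (𝒜 (u₀ + t • h) h (φ h t)) (Icc 0 1) t := fun h hh => (hφ h hh).2
  have bα : ∀ h, ‖h‖ < δ → ∀ t ∈ Icc (0 : ℝ) 1, ‖𝒜 (u₀ + t • h) h‖ ≤ C := by
    intro h hh t ht
    refine ((𝒜 _).le_opNorm h).trans ?_
    calc ‖𝒜 (u₀ + t • h)‖ * ‖h‖ ≤ C * 1 := by
          gcongr
          · exact bA _ (hmem h hh t ht)
          · linarith
      _ = C := mul_one C
  set g : ℝ := Real.exp C / C with hg
  have hg0 : 0 < g := by positivity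
  obtain ⟨B, hB0, hB⟩ : ∃ B : ℝ, 0 ≤ B ∧ ∀ h, ‖h‖ < δ → ∀ t ∈ Icc (0 : ℝ) 1, ‖φ h t‖ ≤ B := by
    refine ⟨g * (C * ‖w₀‖) + ‖w₀‖, by positivity, fun h hh t ht => ?_⟩
    have := norm_le_of_norm_deriv_le (φ := fun t => φ h t - w₀) hC
      (fun t ht => (hφd h hh t ht).sub_const w₀) (by simp [hφ0 h hh]) (ε := C * ‖w₀‖)
      (fun t ht => by
        refine ((𝒜 _ _).le_opNorm _).trans ?_
        rw [← mul_add]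
        gcongr
        · exact bα h hh t ht
        · simpa using norm_add_le (φ h t - w₀) w₀) (by positivity) t ht
    have h2 := norm_add_le (φ h t - w₀) w₀
    rw [sub_add_cancel] at h2
    linarith
  have bα1 : ∀ h k, ‖h‖ < δ → ‖h + k‖ < δ → ∀ t ∈ Icc (0 : ℝ) 1,
      ‖𝒜 (u₀ + t • (h + k)) - 𝒜 (u₀ + t • h)‖ ≤ C * ‖k‖ ∧
      ‖𝒜 (u₀ + t • (h + k)) - 𝒜 (u₀ + t • h) - fderiv ℝ 𝒜 (u₀ + t • h) (t • k)‖
        ≤ C * ‖k‖ * ‖k‖ := by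
    intro h k hh hk t ht
    have e : u₀ + t • (h + k) - (u₀ + t • h) = t • k := by
      rw [smul_add]
      abel
    have e2 : ‖t • k‖ ≤ ‖k‖ := by
      rw [norm_smul, Real.norm_of_nonneg ht.1]
      exact mul_le_of_le_one_left (norm_nonneg _) ht.2
    have i1 := bA1 _ (hmem h hh t ht) _ (hmem _ hk t ht)
    have i2 := bA2 _ (hmem h hh t ht) _ (hmem _ hk t ht)
    rw [e] at i1 i2
    exact ⟨i1.trans (by gcongr), i2.trans (by gcongr)⟩
  have bα2 : ∀ h k, ‖h‖ < δ → ‖h + k‖ < δ → ∀ t ∈ Icc (0 : ℝ) 1,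
      ‖𝒜 (u₀ + t • (h + k)) (h + k) - 𝒜 (u₀ + t • h) h‖ ≤ 2 * C * ‖k‖ := by
    intro h k hh hk t ht
    have e : 𝒜 (u₀ + t • (h + k)) (h + k) - 𝒜 (u₀ + t • h) h
        = (𝒜 (u₀ + t • (h + k)) - 𝒜 (u₀ + t • h)) h + 𝒜 (u₀ + t • (h + k)) k := by
      simp only [map_add, sub_apply]
      abel
    rw [e]
    refine (norm_add_le _ _).trans ?_
    have i1 : ‖(𝒜 (u₀ + t • (h + k)) - 𝒜 (u₀ + t • h)) h‖ ≤ C * ‖k‖ * 1 := by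
      refine (ContinuousLinearMap.le_opNorm _ _).trans ?_
      gcongr
      · exact (bα1 h k hh hk t ht).1
      · linarith
    have i2 : ‖𝒜 (u₀ + t • (h + k)) k‖ ≤ C * ‖k‖ := by
      refine (ContinuousLinearMap.le_opNorm _ _).trans ?_
      gcongr
      exact bA _ (hmem _ hk t ht)
    linarith
  have bΔ : ∀ h k, ‖h‖ < δ → ‖h + k‖ < δ → ∀ t ∈ Icc (0 : ℝ) 1,
      ‖φ (h + k) t - φ h t‖ ≤ g * (2 * C * ‖k‖ * B) := by
    intro h k hh hk
    refine norm_le_of_norm_deriv_le hC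
      (fun t ht => (hφd _ hk t ht).sub (hφd h hh t ht)) (by simp [hφ0 _ hh, hφ0 _ hk])
      (fun t ht => ?_) (by positivity)
    have e : 𝒜 (u₀ + t • (h + k)) (h + k) (φ (h + k) t) - 𝒜 (u₀ + t • h) h (φ h t)
        = 𝒜 (u₀ + t • h) h (φ (h + k) t - φ h t)
          + (𝒜 (u₀ + t • (h + k)) (h + k) - 𝒜 (u₀ + t • h) h) (φ (h + k) t) := by
      simp only [map_sub, sub_apply]
      abel
    rw [e]
    refine (norm_add_le _ _).trans (add_le_add ?_ ?_)
    · refine (ContinuousLinearMap.le_opNorm _ _).trans ?_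
      gcongr
      exact bα h hh t ht
    · refine (ContinuousLinearMap.le_opNorm _ _).trans ?_
      gcongr
      · exact bα2 h k hh hk t ht
      · exact hB _ hk t ht
  -- Differentiability of F at u₀ + h. The defect φ(h+k) - φ(h) - t 𝒜(k) φ(h) starts at 0. Flatness
  -- rewrites the derivative of its last term so that the defect satisfies the linear equation of
  -- the ray up to an error quadratic in k.
  have bT : ∀ h k, ‖h‖ < δ → ‖h + k‖ < δ →
      ‖φ (h + k) 1 - φ h 1 - 𝒜 (u₀ + h) k (φ h 1)‖
        ≤ g * (2 * C * ‖k‖ * (g * (2 * C * ‖k‖ * B)) + 2 * C * ‖k‖ * ‖k‖ * B) := by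
    intro h k hh hk
    have hd : ∀ t ∈ Icc (0 : ℝ) 1, HasDerivWithinAt
        (fun t => φ (h + k) t - φ h t - t • 𝒜 (u₀ + t • h) k (φ h t))
        (𝒜 (u₀ + t • (h + k)) (h + k) (φ (h + k) t) - 𝒜 (u₀ + t • h) h (φ h t)
          - (t • (fderiv ℝ 𝒜 (u₀ + t • h) h k (φ h t) + 𝒜 (u₀ + t • h) k
            (𝒜 (u₀ + t • h) h (φ h t))) + (1 : ℝ) • 𝒜 (u₀ + t • h) k (φ h t))) (Icc 0 1) t := by
      intro t ht
      have hl : HasDerivWithinAt (fun t : ℝ => u₀ + t • h) h (Icc 0 1) t := by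
        simpa using ((hasDerivWithinAt_id t (Icc (0 : ℝ) 1)).smul_const h).const_add u₀
      have h1 := (hderiv _ (hball _ (hmem h hh t ht)).1).comp_hasDerivWithinAt t hl
      have h2 : HasDerivWithinAt (fun t : ℝ => 𝒜 (u₀ + t • h) k)
          (fderiv ℝ 𝒜 (u₀ + t • h) h k) (Icc 0 1) t := by
        simpa using h1.clm_apply (hasDerivWithinAt_const t (Icc (0 : ℝ) 1) k)
      have h3 := h2.clm_apply (hφd h hh t ht)
      exact ((hφd _ hk t ht).sub (hφd h hh t ht)).sub ((hasDerivWithinAt_id t _).smul h3)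
    have key := norm_le_of_norm_deriv_le hC hd (by simp [hφ0 _ hh, hφ0 _ hk])
      (ε := 2 * C * ‖k‖ * (g * (2 * C * ‖k‖ * B)) + 2 * C * ‖k‖ * ‖k‖ * B)
      (fun t ht => ?_) (by positivity) 1 (by simp)
    · simpa using key
    have hf := congrArg (fun L : W →L[ℝ] W => L (φ h t))
      (hflat _ (hball _ (hmem h hh t ht)).1 h k)
    simp only [add_apply, ContinuousLinearMap.comp_apply] at hf
    rw [hf]
    have e : 𝒜 (u₀ + t • (h + k)) (h + k) (φ (h + k) t) - 𝒜 (u₀ + t • h) h (φ h t)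
          - (t • (fderiv ℝ 𝒜 (u₀ + t • h) k h (φ h t) + 𝒜 (u₀ + t • h) h
            (𝒜 (u₀ + t • h) k (φ h t))) + (1 : ℝ) • 𝒜 (u₀ + t • h) k (φ h t))
        = 𝒜 (u₀ + t • h) h (φ (h + k) t - φ h t - t • 𝒜 (u₀ + t • h) k (φ h t))
          + ((𝒜 (u₀ + t • (h + k)) (h + k) - 𝒜 (u₀ + t • h) h) (φ (h + k) t - φ h t)
          + ((𝒜 (u₀ + t • (h + k)) - 𝒜 (u₀ + t • h) - fderiv ℝ 𝒜 (u₀ + t • h) (t • k)) h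
            + (𝒜 (u₀ + t • (h + k)) - 𝒜 (u₀ + t • h)) k) (φ h t)) := by
      simp only [map_sub, sub_apply, add_apply, map_add,
        map_smul, smul_apply, smul_add, one_smul]
      abel
    rw [e]
    refine (norm_add_le _ _).trans (add_le_add ?_ ((norm_add_le _ _).trans (add_le_add ?_ ?_)))
    · refine (ContinuousLinearMap.le_opNorm _ _).trans ?_
      gcongr
      exact bα h hh t ht
    · refine (ContinuousLinearMap.le_opNorm _ _).trans ?_
      gcongr
      · exact bα2 h k hh hk t ht
      · exact bΔ h k hh hk t ht
    · refine (ContinuousLinearMap.le_opNorm _ _).trans ?_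
      gcongr
      · refine (norm_add_le _ _).trans ?_
        have i1 : ‖(𝒜 (u₀ + t • (h + k)) - 𝒜 (u₀ + t • h)
            - fderiv ℝ 𝒜 (u₀ + t • h) (t • k)) h‖ ≤ C * ‖k‖ * ‖k‖ * 1 := by
          refine (ContinuousLinearMap.le_opNorm _ _).trans ?_
          gcongr
          · exact (bα1 h k hh hk t ht).2
          · linarith
        have i2 : ‖(𝒜 (u₀ + t • (h + k)) - 𝒜 (u₀ + t • h)) k‖ ≤ C * ‖k‖ * ‖k‖ := by
          refine (ContinuousLinearMap.le_opNorm _ _).trans ?_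
          gcongr
          exact (bα1 h k hh hk t ht).1
        linarith
      · exact hB _ hh t ht
  refine ⟨fun u => φ (u - u₀) 1, ?_, fun u hu => ?_⟩
  -- For h = 0 the ray equation has zero right-hand side, so its solution stays at w₀.
  · have h00 : ‖(0 : E)‖ < δ := by simpa using hδ
    have := norm_le_of_norm_deriv_le (φ := fun t => φ 0 t - w₀) (ε := 0) hC
      (fun t ht => (hφd 0 h00 t ht).sub_const w₀) (by simp [hφ0 0 h00])
      (fun t ht => by simp; positivity) le_rfl 1 (by simp)
    simpa [sub_eq_zero] using this
  · have hu' : ‖u - u₀‖ < δ := by simpa [dist_eq_norm] using hu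
    rw [hasFDerivAt_iff_isLittleO_nhds_zero]
    set c : ℝ := g * (2 * C * (g * (2 * C * B)) + 2 * C * B) with hc
    have hO : (fun k : E => φ (u + k - u₀) 1 - φ (u - u₀) 1 - ((𝒜 u).flip (φ (u - u₀) 1)) k)
        =O[𝓝 0] fun k => ‖k‖ ^ 2 := by
      refine Asymptotics.IsBigO.of_bound c ?_
      have : ∀ᶠ k : E in 𝓝 0, ‖u - u₀ + k‖ < δ := by
        refine (Continuous.norm (by fun_prop)).continuousAt.eventually_lt continuousAt_const ?_
        simpa using hu'
      filter_upwards [this] with k hk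
      have := bT (u - u₀) k hu' hk
      rw [add_sub_cancel] at this
      rw [ContinuousLinearMap.flip_apply, show u + k - u₀ = u - u₀ + k by abel]
      refine this.trans (le_of_eq ?_)
      rw [hc]
      simp
      ring
    exact hO.trans_isLittleO (by
      simpa using Asymptotics.isLittleO_norm_pow_id (E' := E) (n := 2) (by norm_num))

end Frobenius

/-! ### Polynomials on phase space and the derivation along straight lines. -/

section Polynomials

open MvPolynomial

/-- Polynomials in the coordinates `x`, with coefficients polynomials in the momenta. -/
abbrev PhasePoly (m : ℕ) : Type := MvPolynomial (Fin m) (MvPolynomial (Fin m) ℝ)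

variable {m : ℕ}

/-- The value at a point of the configuration space, a polynomial in the momenta. -/
def evalBase (x : E m) : PhasePoly m →+* MvPolynomial (Fin m) ℝ :=
  MvPolynomial.eval fun i => C (x i)

/-- The derivative along the straight line flow, `∑ q_i ∂/∂x_i`. -/
def lineDerivation : Derivation (MvPolynomial (Fin m) ℝ) (PhasePoly m) (PhasePoly m) :=
  mkDerivation _ fun i => C (X i)

/-- The function on the phase space given by a family of polynomials in the momenta. -/
def phaseEval (P : E m → MvPolynomial (Fin m) ℝ) (z : E m × E m) : ℝ :=
  MvPolynomial.eval (fun i => z.2 i) (P z.1)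

/-- The derivative of a function on the phase space along the straight line flow. -/
def flowDeriv (f : E m × E m → ℝ) (z : E m × E m) : ℝ := fderiv ℝ f z (z.2, 0)

@[simp] lemma evalBase_C (x : E m) (a : MvPolynomial (Fin m) ℝ) : evalBase x (C a) = a := by
  simp [evalBase]

@[simp] lemma evalBase_X (x : E m) (i : Fin m) : evalBase x (X i) = C (x i) := by
  simp [evalBase]

/-- A polynomial vanishing on a product of infinite sets is zero; this supplies such a product
inside any nonempty open set. -/
lemma exists_infinite_box {O : Set (E m)} (hO : IsOpen O) {x₀ : E m} (hx₀ : x₀ ∈ O) :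
    ∃ s : Fin m → Set ℝ, (∀ i, (s i).Infinite) ∧
      ∀ x : Fin m → ℝ, x ∈ Set.univ.pi s → WithLp.toLp 2 x ∈ O := by
  have h1 : IsOpen ((fun x : Fin m → ℝ => (WithLp.toLp 2 x : E m)) ⁻¹' O) :=
    hO.preimage (PiLp.continuous_toLp 2 _)
  obtain ⟨δ, hδ, h⟩ := Metric.isOpen_iff.1 h1 (x₀ : Fin m → ℝ) (by simpa using hx₀)
  refine ⟨fun i => Metric.ball (x₀ i) δ, fun i => ?_, fun x hx => h ?_⟩
  · simp only [Real.ball_eq_Ioo]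
    exact Ioo_infinite (by linarith)
  · rw [ball_pi _ hδ]
    exact hx

lemma eq_zero_of_eval_eq_zero {O : Set (E m)} (hO : IsOpen O) (hne : O.Nonempty)
    {p : MvPolynomial (Fin m) ℝ} (h : ∀ x ∈ O, MvPolynomial.eval (fun i => x i) p = 0) :
    p = 0 := by
  obtain ⟨x₀, hx₀⟩ := hne
  obtain ⟨s, hs, hsO⟩ := exists_infinite_box hO hx₀
  exact MvPolynomial.funext_set s hs fun x hx => by simpa using h _ (hsO x hx)

lemma eq_of_eval_eq {O : Set (E m)} (hO : IsOpen O) (hne : O.Nonempty)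
    {p p' : MvPolynomial (Fin m) ℝ}
    (h : ∀ x ∈ O, MvPolynomial.eval (fun i => x i) p = MvPolynomial.eval (fun i => x i) p') :
    p = p' :=
  sub_eq_zero.1 (eq_zero_of_eval_eq_zero hO hne fun x hx => by simp [h x hx])

lemma eq_of_eval_eq_all {p p' : MvPolynomial (Fin m) ℝ}
    (h : ∀ x : E m, MvPolynomial.eval (fun i => x i) p = MvPolynomial.eval (fun i => x i) p') :
    p = p' := eq_of_eval_eq isOpen_univ univ_nonempty fun x _ => h x

lemma eq_zero_of_evalBase_eq_zero {O : Set (E m)} (hO : IsOpen O) (hne : O.Nonempty)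
    {A : PhasePoly m} (h : ∀ x ∈ O, evalBase x A = 0) : A = 0 := by
  obtain ⟨x₀, hx₀⟩ := hne
  obtain ⟨s, hs, hsO⟩ := exists_infinite_box hO hx₀
  -- The coefficients lie in the domain of momentum polynomials, so the infinite sets are the images
  -- of real intervals under the constants.
  refine MvPolynomial.funext_set (fun i => C '' s i)
    (fun i => (hs i).image (C_injective _ _).injOn) fun x hx => ?_
  choose y hy hyx using fun i => hx i (mem_univ i)
  have := h _ (hsO y fun i _ => hy i)
  simp only [evalBase, hyx] at this
  simpa using this

lemma exists_eval_ne_zero {O : Set (E m)} (hO : IsOpen O) (hne : O.Nonempty)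
    {p : MvPolynomial (Fin m) ℝ} (hp : p ≠ 0) :
    ∃ x ∈ O, MvPolynomial.eval (fun i => x i) p ≠ 0 := by
  by_contra! h
  exact hp (eq_zero_of_eval_eq_zero hO hne h)

lemma dense_evalBase_ne_zero {A : PhasePoly m} (hA : A ≠ 0) :
    Dense {x : E m | evalBase x A ≠ 0} := by
  intro x
  rw [mem_closure_iff]
  intro O hO hx
  by_contra! h
  refine hA (eq_zero_of_evalBase_eq_zero hO ⟨x, hx⟩ fun y hy => ?_)
  by_contra hne
  exact (h ▸ (⟨hy, hne⟩ : y ∈ O ∩ {x : E m | evalBase x A ≠ 0}) : y ∈ (∅ : Set (E m)))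

lemma contDiff_phaseEval_evalBase (A : PhasePoly m) :
    ContDiff ℝ ∞ (phaseEval fun x => evalBase x A) := by
  have hc : ∀ i : Fin m, ContDiff ℝ ∞ fun x : E m => x i := fun i =>
    (EuclideanSpace.proj i : E m →L[ℝ] ℝ).contDiff
  change ContDiff ℝ ∞ fun z : E m × E m => MvPolynomial.eval (fun i => z.2 i) (evalBase z.1 A)
  induction A using MvPolynomial.induction_on with
  | C a =>
    simp only [evalBase_C]
    induction a using MvPolynomial.induction_on with
    | C a => simpa using contDiff_const
    | add p q hp hq => simpa using hp.add hq
    | mul_X p i hp => simpa using hp.mul ((hc i).comp contDiff_snd)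
  | add p q hp hq => simpa using hp.add hq
  | mul_X p i hp => simpa using hp.mul ((hc i).comp contDiff_fst)

lemma flowDeriv_mul {f g : E m × E m → ℝ} {z : E m × E m} (hf : DifferentiableAt ℝ f z)
    (hg : DifferentiableAt ℝ g z) :
    flowDeriv (fun z => f z * g z) z = flowDeriv f z * g z + f z * flowDeriv g z := by
  simp only [flowDeriv, fderiv_fun_mul hf hg]
  simp
  ring

lemma flowDeriv_phaseEval_evalBase (A : PhasePoly m) (z : E m × E m) :
    flowDeriv (phaseEval fun x => evalBase x A) z
      = phaseEval (fun x => evalBase x (lineDerivation A)) z := by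
  have hd : ∀ A : PhasePoly m, DifferentiableAt ℝ (phaseEval fun x => evalBase x A) z := fun A =>
    (contDiff_phaseEval_evalBase A).differentiable (by simp) z
  induction A using MvPolynomial.induction_on with
  | C a =>
    have : HasFDerivAt (phaseEval fun x : E m => evalBase x (C a))
        ((fderiv ℝ (phaseEval fun x : E m => evalBase x (C a)) z)) z := (hd _).hasFDerivAt
    have h2 : HasDerivAt (fun t : ℝ => z + t • ((z.2, 0) : E m × E m)) (z.2, 0) 0 := by
      simpa using ((hasDerivAt_id (0 : ℝ)).smul_const ((z.2, 0) : E m × E m)).const_add z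
    have h3 := HasFDerivAt.comp_hasDerivAt (x := (0 : ℝ)) (l := phaseEval fun x : E m => evalBase x (C a))
      (l' := fderiv ℝ (phaseEval fun x : E m => evalBase x (C a)) z) (by simpa using this) h2
    have h4 : (phaseEval fun x : E m => evalBase x (C a)) ∘
        (fun t : ℝ => z + t • ((z.2, 0) : E m × E m)) = fun _ => MvPolynomial.eval (fun i => z.2 i) a := by
      funext t
      simp [phaseEval]
    rw [h4] at h3
    have h5 := h3.unique (hasDerivAt_const _ _)
    rw [flowDeriv, h5]
    simp [phaseEval]
  | add p q hp hq =>
    have : (phaseEval fun x => evalBase x (p + q))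
        = fun z => phaseEval (fun x => evalBase x p) z + phaseEval (fun x => evalBase x q) z := by
      funext z
      simp [phaseEval]
    rw [this, flowDeriv, fderiv_fun_add (hd p) (hd q)]
    simp only [flowDeriv] at hp hq
    simp only [add_apply, hp, hq]
    simp [phaseEval]
  | mul_X p i hp =>
    have : (phaseEval fun x => evalBase x (p * X i))
        = fun z => phaseEval (fun x => evalBase x p) z * phaseEval (fun x => evalBase x (X i)) z := by
      funext z
      simp [phaseEval]
    rw [this, flowDeriv_mul (hd p) (hd _), hp]
    have h2 : flowDeriv (phaseEval fun x => evalBase x (X i : PhasePoly m)) z = z.2 i := by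
      have : (phaseEval fun x => evalBase x (X i : PhasePoly m)) = fun z : E m × E m => z.1 i := by
        funext z
        simp [phaseEval]
      have h3 : HasFDerivAt (fun z : E m × E m => z.1 i)
          ((EuclideanSpace.proj i : E m →L[ℝ] ℝ).comp
            (ContinuousLinearMap.fst ℝ (E m) (E m))) z :=
        ((EuclideanSpace.proj i : E m →L[ℝ] ℝ).comp
          (ContinuousLinearMap.fst ℝ (E m) (E m))).hasFDerivAt
      rw [this, flowDeriv, h3.fderiv]
      simp
    rw [h2]
    simp [phaseEval, lineDerivation, mkDerivation_X]
    ring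

lemma lineDerivation_eq_sum (A : PhasePoly m) :
    lineDerivation A = ∑ i, C (X i) * pderiv i A := by
  induction A using MvPolynomial.induction_on with
  | C a => simp [lineDerivation]
  | add p q hp hq => simp [hp, hq, mul_add, Finset.sum_add_distrib]
  | mul_X p i hp =>
    have h1 : lineDerivation (X i : PhasePoly m) = C (X i) := mkDerivation_X _ _ _
    have h2 : ∀ j : Fin m, C (X j) * pderiv j (p * X i : PhasePoly m)
        = X i * (C (X j) * pderiv j p)
          + if i = j then p * C (X i) else 0 := by
      intro j
      rw [pderiv_mul, pderiv_X, Pi.single_apply]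
      split_ifs with h
      · rw [h]
        ring
      · ring
    rw [Derivation.leibniz, hp, h1, Finset.sum_congr rfl fun j _ => h2 j, Finset.sum_add_distrib,
      ← Finset.mul_sum, Finset.sum_ite_eq, if_pos (Finset.mem_univ i), smul_eq_mul, smul_eq_mul,
      add_comm]

/-- The total degree counts positions only: the derivation trades one factor xᵢ for qᵢ, which is a
coefficient. -/
lemma totalDegree_lineDerivation_lt {A : PhasePoly m} (h : lineDerivation A ≠ 0) :
    (lineDerivation A).totalDegree < A.totalDegree := by
  obtain ⟨s, hs, hsd⟩ := Finset.exists_mem_eq_sup (lineDerivation A).support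
    (support_nonempty.2 h) (fun s => s.sum fun _ e => e)
  have hd : (lineDerivation A).totalDegree = s.sum fun _ e => e := hsd
  rw [hd]
  rw [mem_support_iff, lineDerivation_eq_sum, coeff_sum] at hs
  obtain ⟨i, -, hi⟩ := Finset.exists_ne_zero_of_sum_ne_zero hs
  rw [coeff_C_mul, coeff_pderiv] at hi
  have h2 : coeff (s + Finsupp.single i 1) A ≠ 0 := fun h0 => hi (by simp [h0])
  have h3 := le_totalDegree (mem_support_iff.2 h2)
  rw [Finsupp.sum_add_index' (by simp) (by simp)] at h3
  simp at h3
  omega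

/-- Coprime polynomials whose ratio is invariant under the straight line flow are invariant. -/
lemma lineDerivation_eq_zero_of_isRelPrime {A B : PhasePoly m} (hAB : IsRelPrime A B)
    (h : B * lineDerivation A = A * lineDerivation B) : lineDerivation A = 0 := by
  -- Coprimality turns the relation into a divisibility, which the drop in degree then forbids
  -- unless the derivative is zero.
  have hdvd : A ∣ lineDerivation A := hAB.dvd_of_dvd_mul_left (Dvd.intro _ h.symm)
  by_contra h0
  obtain ⟨c, hc⟩ := hdvd
  have hA : A ≠ 0 := fun hA => h0 (by simp [hA])
  have hc0 : c ≠ 0 := fun hc0 => h0 (by simp [hc, hc0])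
  have h1 := totalDegree_lineDerivation_lt h0
  rw [hc, totalDegree_mul_of_isDomain hA hc0] at h1
  omega

lemma exists_coeff_evalBase (A : PhasePoly m) (α : Fin m →₀ ℕ) :
    ∃ p : MvPolynomial (Fin m) ℝ, ∀ x : E m,
      coeff α (evalBase x A) = MvPolynomial.eval (fun i => x i) p := by
  induction A using MvPolynomial.induction_on with
  | C a => exact ⟨C (coeff α a), fun x => by simp⟩
  | add p q hp hq =>
    obtain ⟨p', hp⟩ := hp
    obtain ⟨q', hq⟩ := hq
    exact ⟨p' + q', fun x => by simp [hp, hq]⟩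
  | mul_X p i hp =>
    obtain ⟨p', hp⟩ := hp
    exact ⟨p' * X i, fun x => by simp [hp, mul_comm _ (C (x i))]; ring⟩

/-- A rank argument over the fraction field. If the vectors span, some square matrix of them has a
nonzero polynomial determinant, which is nonzero at a point of O and excludes a pointwise
annihilator there. Otherwise a nonzero functional kills the span, and clearing its denominators
gives polynomials. -/
lemma exists_polynomial_annihilator_of_isFractionRing (K : Type*) [Field K]
    [Algebra (MvPolynomial (Fin m) ℝ) K] [IsFractionRing (MvPolynomial (Fin m) ℝ) K] {ι Z : Type*} [Fintype ι]
    (H : Z → ι → MvPolynomial (Fin m) ℝ) {O : Set (E m)} (hO : IsOpen O) (hne : O.Nonempty)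
    (h : ∀ x ∈ O, ∃ c : ι → ℝ, c ≠ 0 ∧
      ∀ z, ∑ i, MvPolynomial.eval (fun i => x i) (H z i) * c i = 0) :
    ∃ c : ι → MvPolynomial (Fin m) ℝ, c ≠ 0 ∧ ∀ z, ∑ i, c i * H z i = 0 := by
  classical
  let v : Z → ι → K := fun z i => algebraMap _ K (H z i)
  have hinj : Function.Injective (algebraMap (MvPolynomial (Fin m) ℝ) K) :=
    IsFractionRing.injective _ _
  rcases lt_or_eq_of_le (le_top : Submodule.span K (range v) ≤ ⊤) with hlt | heq
  · obtain ⟨f, hf, hker⟩ := Submodule.exists_le_ker_of_lt_top _ hlt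
    obtain ⟨b, hb⟩ := IsLocalization.exist_integer_multiples_of_finite
      (nonZeroDivisors (MvPolynomial (Fin m) ℝ)) (fun i : ι => f (Pi.single i 1))
    choose c hc using hb
    have hb0 : algebraMap _ K (b : MvPolynomial (Fin m) ℝ) ≠ 0 := by
      rw [Ne, map_eq_zero_iff _ hinj]
      exact nonZeroDivisors.coe_ne_zero b
    refine ⟨c, fun h0 => hf ?_, fun z => hinj ?_⟩
    · refine LinearMap.pi_ext' fun i => LinearMap.ext_ring ?_
      have := hc i
      rw [h0] at this
      simp only [Pi.zero_apply, map_zero, Algebra.smul_def] at this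
      simpa [hb0] using this.symm
    · have h1 : f (v z) = 0 := hker (Submodule.subset_span ⟨z, rfl⟩)
      have h2 : v z = ∑ i, v z i • (Pi.single i 1 : ι → K) := by
        funext j
        simp [Finset.sum_apply, Pi.single_apply]
      rw [h2, map_sum] at h1
      simp only [map_smul, smul_eq_mul] at h1
      rw [map_sum, map_zero]
      calc ∑ i, algebraMap _ K (c i * H z i)
          = algebraMap _ K (b : MvPolynomial (Fin m) ℝ) * ∑ i, v z i * f (Pi.single i 1) := by
            rw [Finset.mul_sum]
            refine Finset.sum_congr rfl fun i _ => ?_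
            rw [map_mul, hc i, Algebra.smul_def]
            simp only [v]
            ring
        _ = 0 := by rw [h1, mul_zero]
  · exfalso
    obtain ⟨b, hbs, hspan, hli⟩ := exists_linearIndependent K (range v)
    have B := Module.Basis.mk hli (by rw [Subtype.range_coe, hspan, heq])
    let e : ι ≃ b := (Pi.basisFun K ι).indexEquiv B
    choose z hz using fun i : ι => hbs (e i).2
    let M : Matrix ι ι (MvPolynomial (Fin m) ℝ) := Matrix.of fun i j => H (z i) j
    have hrows : LinearIndependent K (M.map (algebraMap _ K)).row := by
      have h1 := hli.comp e e.injective
      have h2 : (M.map (algebraMap _ K)).row = Subtype.val ∘ e := by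
        funext i
        exact hz i
      rw [h2]
      exact h1
    have hdet : M.det ≠ 0 := by
      intro h0
      have h1 := (Matrix.isUnit_iff_isUnit_det _).1 (Matrix.linearIndependent_rows_iff_isUnit.1 hrows)
      have h2 : (M.map (algebraMap _ K)).det = algebraMap _ K M.det :=
        (RingHom.map_det _ _).symm
      rw [h2, h0, map_zero] at h1
      exact not_isUnit_zero h1
    obtain ⟨x, hx, hxdet⟩ := exists_eval_ne_zero hO hne hdet
    obtain ⟨c, hc, hcz⟩ := h x hx
    apply hxdet
    rw [RingHom.map_det]
    refine Matrix.exists_mulVec_eq_zero_iff.1 ⟨c, hc, ?_⟩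
    funext i
    simpa [Matrix.mulVec, dotProduct, M] using hcz (z i)

/-- If a family of vectors with polynomial entries is annihilated, at every point of an open set, by
a nonzero covector, then it is annihilated by a nonzero covector with polynomial entries. -/
lemma exists_polynomial_annihilator {ι Z : Type*} [Fintype ι]
    (H : Z → ι → MvPolynomial (Fin m) ℝ) {O : Set (E m)} (hO : IsOpen O) (hne : O.Nonempty)
    (h : ∀ x ∈ O, ∃ c : ι → ℝ, c ≠ 0 ∧
      ∀ z, ∑ i, MvPolynomial.eval (fun i => x i) (H z i) * c i = 0) :
    ∃ c : ι → MvPolynomial (Fin m) ℝ, c ≠ 0 ∧ ∀ z, ∑ i, c i * H z i = 0 :=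
  exists_polynomial_annihilator_of_isFractionRing
    (FractionRing (MvPolynomial (Fin m) ℝ)) H hO hne h

end Polynomials

/-! ### Local rationality of ratios invariant along straight lines. -/

section FlatPairs

open MvPolynomial

variable {m : ℕ}

lemma subset_closure_inter_of_isOpen {X : Type*} [TopologicalSpace X] {O O' S : Set X}
    (hO' : IsOpen O') (hsub : O' ⊆ O) (h : O ⊆ closure S) : O' ⊆ closure (O' ∩ S) :=
  fun _ hx => hO'.inter_closure ⟨hx, h (hsub hx)⟩

lemma subset_closure_inter_of_dense {X : Type*} [TopologicalSpace X] {O S T : Set X}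
    (h : O ⊆ closure S) (hT : IsOpen T) (hd : O ⊆ closure T) (hO : IsOpen O) :
    O ⊆ closure (S ∩ T) := by
  intro x hx
  have h1 : x ∈ closure (O ∩ T) := hO.inter_closure ⟨hx, hd hx⟩
  refine closure_minimal ?_ isClosed_closure h1
  rintro y ⟨hyO, hyT⟩
  have := hT.inter_closure ⟨hyT, h hyO⟩
  rwa [inter_comm] at this

lemma eq_zero_of_subset_closure {X : Type*} [TopologicalSpace X] {O S : Set X} {f : X → ℝ}
    (hf : ContinuousOn f O) (hO : IsOpen O) (hS : O ⊆ closure S)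
    (h : ∀ x ∈ S, x ∈ O → f x = 0) : ∀ x ∈ O, f x = 0 := by
  intro x hx
  by_contra hne
  have h1 : ∀ᶠ y in 𝓝 x, f y ≠ 0 ∧ y ∈ O :=
    ((hf.continuousAt (hO.mem_nhds hx)).eventually_ne hne).and (hO.mem_nhds hx)
  obtain ⟨y, ⟨hy, hyO⟩, hyS⟩ := mem_closure_iff_nhds.1 (hS hx) _ h1
  exact hy (h y hyS hyO)

lemma eval_bind₁' {σ τ : Type*} (f : σ → MvPolynomial τ ℝ) (p : MvPolynomial σ ℝ) (x : τ → ℝ) :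
    MvPolynomial.eval x (bind₁ f p) = MvPolynomial.eval (fun i => MvPolynomial.eval x (f i)) p := by
  induction p using MvPolynomial.induction_on with
  | C a => simp
  | add p q hp hq => simp [hp, hq]
  | mul_X p i hp => simp [hp]

/-- The polynomial, homogeneous of degree `d` in the momenta, with given coefficients. -/
def ofCoeffs (d : ℕ) (c : Finset.finsuppAntidiag (Finset.univ : Finset (Fin m)) d →
    MvPolynomial (Fin m) ℝ) : PhasePoly m :=
  ∑ α, map C (c α) * C (monomial α.1 1)

lemma evalBase_ofCoeffs (d : ℕ) (c : Finset.finsuppAntidiag (Finset.univ : Finset (Fin m)) d →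
    MvPolynomial (Fin m) ℝ) (x : E m) :
    evalBase x (ofCoeffs d c) = ∑ α, monomial α.1 (MvPolynomial.eval (fun i => x i) (c α)) := by
  have h : ∀ p : MvPolynomial (Fin m) ℝ,
      evalBase x (map C p) = C (MvPolynomial.eval (fun i => x i) p) := by
    intro p
    induction p using MvPolynomial.induction_on with
    | C a => simp
    | add p q hp hq => simp [hp, hq]
    | mul_X p i hp => simp [hp]
  simp [ofCoeffs, h, C_mul_monomial]

lemma isHomogeneous_evalBase_ofCoeffs (d : ℕ)
    (c : Finset.finsuppAntidiag (Finset.univ : Finset (Fin m)) d → MvPolynomial (Fin m) ℝ)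
    (x : E m) : (evalBase x (ofCoeffs d c)).IsHomogeneous d := by
  rw [evalBase_ofCoeffs]
  refine IsHomogeneous.sum _ _ _ fun α _ => isHomogeneous_monomial _ ?_
  rw [Finsupp.degree_eq_sum]
  exact (Finset.mem_finsuppAntidiag.1 α.2).1

lemma ofCoeffs_ne_zero {d : ℕ}
    {c : Finset.finsuppAntidiag (Finset.univ : Finset (Fin m)) d → MvPolynomial (Fin m) ℝ}
    (hc : c ≠ 0) : ofCoeffs d c ≠ 0 := by
  obtain ⟨α, hα⟩ := Function.ne_iff.1 hc
  intro h0
  refine hα (eq_zero_of_eval_eq_zero isOpen_univ univ_nonempty fun x _ => ?_)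
  have h1 := congrArg (coeff α.1) (evalBase_ofCoeffs d c x)
  rw [h0, map_zero, coeff_zero, coeff_sum, Finset.sum_eq_single α] at h1
  · simpa using h1.symm
  · intro β _ hβ
    rw [coeff_monomial, if_neg fun h => hβ (Subtype.ext h)]
  · simp

lemma _root_.MvPolynomial.IsHomogeneous.eval_eq_sum {d : ℕ} {p : MvPolynomial (Fin m) ℝ}
    (hp : p.IsHomogeneous d) (y : Fin m → ℝ) :
    MvPolynomial.eval y p = ∑ α : Finset.finsuppAntidiag (Finset.univ : Finset (Fin m)) d,
      coeff α.1 p * MvPolynomial.eval y (monomial α.1 1) := by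
  rw [Finset.sum_coe_sort (Finset.finsuppAntidiag Finset.univ d) fun α =>
    coeff α p * MvPolynomial.eval y (monomial α 1)]
  conv_lhs => rw [p.as_sum, map_sum]
  refine (Finset.sum_subset (fun α hα => ?_) fun α _ hα => ?_).trans
    (Finset.sum_congr rfl fun α _ => ?_)
  · rw [Finset.mem_finsuppAntidiag]
    refine ⟨?_, Finset.subset_univ _⟩
    by_contra hne
    exact mem_support_iff.1 hα (hp.coeff_eq_zero (by rwa [Finsupp.degree_eq_sum]))
  · rw [notMem_support_iff.1 hα]
    simp
  · simp [eval_monomial]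

lemma _root_.MvPolynomial.IsHomogeneous.eval_smul' {d : ℕ} {p : MvPolynomial (Fin m) ℝ}
    (hp : p.IsHomogeneous d) (c : ℝ) (y : Fin m → ℝ) :
    MvPolynomial.eval (fun i => c * y i) p = c ^ d * MvPolynomial.eval y p := by
  rw [hp.eval_eq_sum, hp.eval_eq_sum, Finset.mul_sum]
  refine Finset.sum_congr rfl fun α _ => ?_
  have h1 := (Finset.mem_finsuppAntidiag.1 α.2).1
  rw [eval_monomial, eval_monomial, one_mul, one_mul,
    Finsupp.prod_fintype _ _ (by simp), Finsupp.prod_fintype _ _ (by simp)]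
  simp only [mul_pow, Finset.prod_mul_distrib, Finset.prod_pow_eq_pow_sum]
  rw [h1]
  ring

/-- A pair of families of homogeneous polynomials in the momenta, generically coprime, whose ratio
is invariant under the straight line flow. -/
structure IsFlatPair (O : Set (E m)) (r s : ℕ) (P Q : E m → MvPolynomial (Fin m) ℝ) : Prop where
  isOpen : IsOpen O
  homogeneous_left : ∀ x ∈ O, (P x).IsHomogeneous r
  homogeneous_right : ∀ x ∈ O, (Q x).IsHomogeneous s
  smooth_left : ContDiffOn ℝ ∞ (phaseEval P) (O ×ˢ univ)
  smooth_right : ContDiffOn ℝ ∞ (phaseEval Q) (O ×ˢ univ)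
  flow : ∀ x ∈ O, ∀ q, flowDeriv (phaseEval P) (x, q) * phaseEval Q (x, q)
    = phaseEval P (x, q) * flowDeriv (phaseEval Q) (x, q)
  relPrime : O ⊆ closure {x ∈ O | IsRelPrime (P x) (Q x)}

namespace IsFlatPair

variable {O : Set (E m)} {r s : ℕ} {P Q : E m → MvPolynomial (Fin m) ℝ}

lemma symm (h : IsFlatPair O r s P Q) : IsFlatPair O s r Q P where
  isOpen := h.isOpen
  homogeneous_left := h.homogeneous_right
  homogeneous_right := h.homogeneous_left
  smooth_left := h.smooth_right
  smooth_right := h.smooth_left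
  flow x hx q := by
    have := h.flow x hx q
    linarith
  relPrime := by
    simpa only [isRelPrime_comm] using h.relPrime

end IsFlatPair

lemma contDiffAt_phaseEval {O : Set (E m)} (hO : IsOpen O) {P : E m → MvPolynomial (Fin m) ℝ}
    (h : ContDiffOn ℝ ∞ (phaseEval P) (O ×ˢ univ)) {x : E m} (hx : x ∈ O) (q : E m) :
    ContDiffAt ℝ ∞ (phaseEval P) (x, q) :=
  h.contDiffAt ((hO.prod isOpen_univ).mem_nhds ⟨hx, mem_univ _⟩)

lemma hasDerivAt_along_line {f : E m × E m → ℝ} {x q : E m} {t : ℝ}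
    (hf : DifferentiableAt ℝ f (x + t • q, q)) :
    HasDerivAt (fun t : ℝ => f (x + t • q, q)) (flowDeriv f (x + t • q, q)) t := by
  have h1 : HasDerivAt (fun t : ℝ => ((x + t • q, q) : E m × E m)) (q, 0) t := by
    refine HasDerivAt.prodMk ?_ (hasDerivAt_const _ _)
    simpa using ((hasDerivAt_id t).smul_const q).const_add x
  exact hf.hasFDerivAt.comp_hasDerivAt t h1

/-- The momentum is also the velocity: moving x in the direction q at fixed momentum q is the
straight line flow. -/
lemma eq_of_flowDeriv_eq_zero {O : Set (E m)} (hO : IsOpen O) {P : E m → MvPolynomial (Fin m) ℝ}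
    (h : ContDiffOn ℝ ∞ (phaseEval P) (O ×ˢ univ))
    (hP : ∀ x ∈ O, ∀ q, flowDeriv (phaseEval P) (x, q) = 0) {x q : E m}
    (hseg : ∀ t ∈ Icc (0 : ℝ) 1, x + t • q ∈ O) :
    ∀ t ∈ Icc (0 : ℝ) 1, phaseEval P (x + t • q, q) = phaseEval P (x, q) := by
  have hd : ∀ t ∈ Icc (0 : ℝ) 1, HasDerivAt (fun t : ℝ => phaseEval P (x + t • q, q)) 0 t := by
    intro t ht
    have := hasDerivAt_along_line
      ((contDiffAt_phaseEval hO h (hseg t ht) q).differentiableAt (by simp))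
    rwa [hP _ (hseg t ht)] at this
  have := constant_of_has_deriv_right_zero
    (fun t ht => (hd t ht).continuousAt.continuousWithinAt)
    (fun t ht => (hd t ⟨ht.1, ht.2.le⟩).hasDerivWithinAt)
  simpa using this

/-- By the quotient rule the flow identity says that P/Q is constant along the segment at momentum z
- x; the conclusion compares the two ends after cross-multiplication. -/
lemma IsFlatPair.eq_of_segment {O : Set (E m)} {r s : ℕ} {P Q : E m → MvPolynomial (Fin m) ℝ}
    (h : IsFlatPair O r s P Q) {x z : E m} (hseg : ∀ t ∈ Icc (0 : ℝ) 1, x + t • (z - x) ∈ O)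
    (hne : ∀ t ∈ Icc (0 : ℝ) 1, phaseEval Q (x + t • (z - x), z - x) ≠ 0) :
    phaseEval P (x, z - x) * phaseEval Q (z, z - x)
      = phaseEval P (z, z - x) * phaseEval Q (x, z - x) := by
  have hd : ∀ t ∈ Icc (0 : ℝ) 1, HasDerivAt (fun t : ℝ => phaseEval P (x + t • (z - x), z - x)
      / phaseEval Q (x + t • (z - x), z - x)) 0 t := by
    intro t ht
    have h1 := hasDerivAt_along_line
      ((contDiffAt_phaseEval h.isOpen h.smooth_left (hseg t ht) (z - x)).differentiableAt (by simp))
    have h2 := hasDerivAt_along_line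
      ((contDiffAt_phaseEval h.isOpen h.smooth_right (hseg t ht) (z - x)).differentiableAt
        (by simp))
    have h3 := h1.div h2 (hne t ht)
    rwa [h.flow _ (hseg t ht), sub_self, zero_div] at h3
  have := constant_of_has_deriv_right_zero
    (fun t ht => (hd t ht).continuousAt.continuousWithinAt)
    (fun t ht => (hd t ⟨ht.1, ht.2.le⟩).hasDerivWithinAt) 1 (by simp)
  have h0 := hne 0 (by simp)
  have h1 := hne 1 (by simp)
  simp only [one_smul, zero_smul, add_zero, add_sub_cancel] at this h0 h1
  field_simp at this
  linarith

/-- A pencil of segments from points near `x₁` along which the denominator does not vanish. -/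
lemma IsFlatPair.exists_segments {O : Set (E m)} {r s : ℕ} {P Q : E m → MvPolynomial (Fin m) ℝ}
    (h : IsFlatPair O r s P Q) {x₁ : E m} (hx₁ : x₁ ∈ O) (hQ : Q x₁ ≠ 0) :
    ∃ O₁ O₂ : Set (E m), IsOpen O₁ ∧ IsOpen O₂ ∧ x₁ ∈ O₁ ∧ O₂.Nonempty ∧ O₁ ⊆ O ∧ O₂ ⊆ O ∧
      ∀ x ∈ O₁, ∀ z ∈ O₂, phaseEval Q (x, z - x) ≠ 0 ∧ phaseEval Q (z, z - x) ≠ 0 ∧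
        phaseEval P (x, z - x) * phaseEval Q (z, z - x)
          = phaseEval P (z, z - x) * phaseEval Q (x, z - x) := by
  obtain ⟨q₁, -, hq₁⟩ := exists_eval_ne_zero isOpen_univ univ_nonempty hQ
  set G : Set (E m × E m) := (O ×ˢ univ) ∩ {z | phaseEval Q z ≠ 0} with hG
  have hGo : IsOpen G := h.smooth_right.continuousOn.isOpen_inter_preimage
    (h.isOpen.prod isOpen_univ) isOpen_ne
  have hx₁G : (x₁, q₁) ∈ G := ⟨⟨hx₁, mem_univ _⟩, hq₁⟩
  obtain ⟨ε, hε, hεG⟩ : ∃ ε : ℝ, 0 < ε ∧ ∀ τ ∈ Icc 0 ε, (x₁ + τ • q₁, q₁) ∈ G := by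
    have hc : Continuous fun τ : ℝ => ((x₁ + τ • q₁, q₁) : E m × E m) := by fun_prop
    obtain ⟨ε, hε, hb⟩ := Metric.isOpen_iff.1 (hGo.preimage hc) 0 (by simpa using hx₁G)
    refine ⟨ε / 2, by positivity, fun τ hτ => hb ?_⟩
    rw [Metric.mem_ball, Real.dist_eq, sub_zero, abs_of_nonneg hτ.1]
    linarith [hτ.2]
  set N : Set (ℝ × (E m × E m)) :=
    {w | (w.2.1 + w.1 • (w.2.2 - w.2.1), w.2.2 - w.2.1) ∈ G} with hN
  have hNo : IsOpen N := hGo.preimage (f := fun w : ℝ × (E m × E m) =>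
    ((w.2.1 + w.1 • (w.2.2 - w.2.1), w.2.2 - w.2.1) : E m × E m)) (by fun_prop)
  -- The tube lemma thickens one good segment, from x₁ to x₁ + ε q₁, to all segments between
  -- neighbourhoods of its ends.
  obtain ⟨u, v, -, hv, hu, hxv, huv⟩ := generalized_tube_lemma (isCompact_Icc (a := (0 : ℝ)) (b := 1))
    (isCompact_singleton (x := (x₁, x₁ + ε • q₁))) hNo (by
      rintro ⟨t, w⟩ ⟨ht, rfl⟩
      have h1 := hεG (t * ε) ⟨mul_nonneg ht.1 hε.le, mul_le_of_le_one_left hε.le ht.2⟩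
      change (x₁ + t • (x₁ + ε • q₁ - x₁), x₁ + ε • q₁ - x₁) ∈ G
      rw [add_sub_cancel_left, smul_smul]
      refine ⟨⟨h1.1.1, mem_univ _⟩, ?_⟩
      -- The momentum of this segment is ε q₁, and homogeneity pulls out the nonzero factor εˢ.
      change MvPolynomial.eval (fun i => ε * q₁ i) (Q (x₁ + (t * ε) • q₁)) ≠ 0
      rw [(h.homogeneous_right _ h1.1.1).eval_smul']
      exact mul_ne_zero (pow_ne_zero _ hε.ne') h1.2)
  obtain ⟨O₁, O₂, hO₁, hO₂, hx, hz, hsub⟩ := isOpen_prod_iff.1 hv x₁ (x₁ + ε • q₁)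
    (hxv (mem_singleton _))
  have hkey : ∀ x ∈ O₁, ∀ z ∈ O₂, ∀ t ∈ Icc (0 : ℝ) 1, (x + t • (z - x), z - x) ∈ G :=
    fun x hx z hz t ht => huv (⟨hu ht, hsub ⟨hx, hz⟩⟩ : (t, (x, z)) ∈ u ×ˢ v)
  refine ⟨O₁, O₂, hO₁, hO₂, hx, ⟨_, hz⟩, fun x hx' => ?_, fun z hz' => ?_, fun x hx' z hz' => ?_⟩
  · simpa using (hkey x hx' _ hz 0 (by simp)).1.1
  · simpa using (hkey x₁ hx _ hz' 1 (by simp)).1.1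
  · have hs := hkey x hx' z hz'
    refine ⟨?_, ?_, h.eq_of_segment (fun t ht => (hs t ht).1.1) fun t ht => (hs t ht).2⟩
    · simpa using (hs 0 (by simp)).2
    · simpa using (hs 1 (by simp)).2

/-- The ratio of a flat pair is locally given by polynomials in positions and momenta. -/
lemma IsFlatPair.exists_rational {O : Set (E m)} {r s : ℕ} {P Q : E m → MvPolynomial (Fin m) ℝ}
    (h : IsFlatPair O r s P Q) {x₁ : E m} (hx₁ : x₁ ∈ O) (hQ : Q x₁ ≠ 0) :
    ∃ (O₁ : Set (E m)) (V U : PhasePoly m), IsOpen O₁ ∧ x₁ ∈ O₁ ∧ O₁ ⊆ O ∧ (∀ x ∈ O₁, Q x ≠ 0) ∧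
      (V ≠ 0 ∨ U ≠ 0) ∧ (∀ x, (evalBase x V).IsHomogeneous r) ∧
      (∀ x, (evalBase x U).IsHomogeneous s) ∧ ∀ x ∈ O₁, evalBase x V * Q x = evalBase x U * P x := by
  obtain ⟨O₁, O₂, hO₁, hO₂, hxO₁, hO₂n, hO₁O, hO₂O, hkey⟩ := h.exists_segments hx₁ hQ
  have hQne : ∀ x ∈ O₁, Q x ≠ 0 := by
    intro x hx h0
    obtain ⟨z, hz⟩ := hO₂n
    exact (hkey x hx z hz).1 (by simp [phaseEval, h0])
  let sub : E m → MvPolynomial (Fin m) ℝ →ₐ[ℝ] MvPolynomial (Fin m) ℝ := fun z =>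
    bind₁ fun i => C (z i) - X i
  have hsub : ∀ (z x : E m) (p : MvPolynomial (Fin m) ℝ),
      MvPolynomial.eval (fun i => x i) (sub z p) = MvPolynomial.eval (fun i => (z - x) i) p := by
    intro z x p
    simp [sub, eval_bind₁']
  -- One row for each far endpoint z, one column for each coefficient of P(x, ·) or Q(x, ·). The
  -- entries are polynomials in x because z, and with it P(z) and Q(z), is frozen.
  let H : O₂ → (Finset.finsuppAntidiag (Finset.univ : Finset (Fin m)) r ⊕
      Finset.finsuppAntidiag (Finset.univ : Finset (Fin m)) s) → MvPolynomial (Fin m) ℝ := fun z =>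
    Sum.elim (fun α => sub z (monomial α.1 1) * sub z (Q z))
      fun α => sub z (monomial α.1 1) * sub z (P z)
  obtain ⟨c, hc0, hc⟩ := exists_polynomial_annihilator H hO₁ ⟨x₁, hxO₁⟩ (by
    intro x hx
    -- At each x the coefficients of P(x) and -Q(x) annihilate all rows, by constancy along
    -- segments; they are not all zero because Q(x) ≠ 0.
    refine ⟨Sum.elim (fun α => coeff α.1 (P x)) (fun α => - coeff α.1 (Q x)), fun h0 => ?_,
      fun z => ?_⟩
    · refine hQne x hx (eq_of_eval_eq_all fun y => ?_)
      rw [(h.homogeneous_right x (hO₁O hx)).eval_eq_sum, map_zero]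
      refine Finset.sum_eq_zero fun α _ => ?_
      have := congrFun h0 (Sum.inr α)
      simp only [Sum.elim_inr, Pi.zero_apply, neg_eq_zero] at this
      rw [this, zero_mul]
    · have h1 := (hkey x hx z z.2).2.2
      simp only [phaseEval] at h1
      rw [(h.homogeneous_left x (hO₁O hx)).eval_eq_sum,
        (h.homogeneous_right x (hO₁O hx)).eval_eq_sum] at h1
      rw [Fintype.sum_sum_type]
      simp only [H, Sum.elim_inl, Sum.elim_inr, map_mul, hsub]
      rw [Finset.sum_mul, Finset.mul_sum] at h1
      rw [← sub_eq_zero] at h1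
      rw [← h1]
      refine (congrArg₂ (· + ·) ?_ ?_).trans (sub_eq_add_neg _ _).symm
      · exact Finset.sum_congr rfl fun α _ => by ring
      · rw [← Finset.sum_neg_distrib]
        exact Finset.sum_congr rfl fun α _ => by ring)
  refine ⟨O₁, ofCoeffs r fun α => c (Sum.inl α), ofCoeffs s fun α => - c (Sum.inr α), hO₁, hxO₁,
    hO₁O, hQne, ?_, isHomogeneous_evalBase_ofCoeffs r _, isHomogeneous_evalBase_ofCoeffs s _, ?_⟩
  · obtain ⟨i, hi⟩ := Function.ne_iff.1 hc0
    rcases i with α | α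
    · exact Or.inl (ofCoeffs_ne_zero fun h0 => hi (congrFun h0 α))
    · exact Or.inr (ofCoeffs_ne_zero fun h0 => hi (neg_eq_zero.1 (congrFun h0 α)))
  · intro x hx
    -- A polynomial identity in q need only be tested for q = z - x with z in the open set O₂.
    refine eq_of_eval_eq (O := (fun q => x + q) ⁻¹' O₂) (hO₂.preimage (by fun_prop)) ?_ ?_
    · obtain ⟨z, hz⟩ := hO₂n
      exact ⟨z - x, by simpa using hz⟩
    intro q hq
    have hk := hkey x hx (x + q) hq
    have h1 := congrArg (MvPolynomial.eval fun i => x i) (hc ⟨x + q, hq⟩)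
    rw [Fintype.sum_sum_type] at h1
    simp only [H, Sum.elim_inl, Sum.elim_inr, map_mul, map_sum, map_add, map_zero, hsub] at h1
    simp only [add_sub_cancel_left, phaseEval] at hk h1
    rw [map_mul, map_mul, evalBase_ofCoeffs, evalBase_ofCoeffs, map_sum, map_sum]
    have hmon : ∀ (α : Fin m →₀ ℕ) (a : ℝ), MvPolynomial.eval (fun i => q i) (monomial α a)
        = a * MvPolynomial.eval (fun i => q i) (monomial α 1) := by
      intro α a
      simp [eval_monomial]
    simp only [hmon _ (MvPolynomial.eval _ _), map_neg]
    obtain ⟨hk1, hk2, hk3⟩ := hk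
    simp only [← mul_assoc, ← Finset.sum_mul] at h1
    simp only [neg_mul, Finset.sum_neg_distrib]
    set a := MvPolynomial.eval (fun i => q i) (Q (x + q))
    set b := MvPolynomial.eval (fun i => q i) (P (x + q))
    -- Both the annihilated row and the segment identity relate values at x to values at z = x + q;
    -- eliminating P(z) leaves the claim times Q(z, q), which is nonzero.
    refine mul_right_cancel₀ hk2 ?_
    linear_combination (MvPolynomial.eval (fun i => q i) (Q x)) * h1
      + (∑ i, (MvPolynomial.eval fun i => x i) (c (Sum.inr i)) *
        (MvPolynomial.eval fun i => q i) (monomial i.1 1)) * hk3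

end FlatPairs

/-! ### Reduction to coprime invariants and extension over a ball. -/

section FlatGlobal

open MvPolynomial

variable {m : ℕ}

lemma exists_eq_mul_of_isRelPrime {P Q A B : MvPolynomial (Fin m) ℝ} (hPQ : IsRelPrime P Q)
    (hQ : Q ≠ 0) (h : A * Q = B * P) : ∃ c, A = c * P ∧ B = c * Q := by
  have hd : Q ∣ B := hPQ.symm.dvd_of_dvd_mul_right (Dvd.intro_left _ h)
  obtain ⟨c, hc⟩ := hd
  refine ⟨c, mul_right_cancel₀ hQ ?_, by rw [hc, mul_comm]⟩
  rw [h, hc]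
  ring

lemma exists_eq_C_of_isHomogeneous_mul {P c : MvPolynomial (Fin m) ℝ} {d : ℕ}
    (hP : P.IsHomogeneous d) (hcP : (c * P).IsHomogeneous d) (h0 : c * P ≠ 0) :
    ∃ a : ℝ, a ≠ 0 ∧ c = C a := by
  have hc0 := left_ne_zero_of_mul h0
  have hP0 := right_ne_zero_of_mul h0
  have h1 := totalDegree_mul_of_isDomain hc0 hP0
  rw [hP.totalDegree hP0, hcP.totalDegree h0] at h1
  have h2 : c = C (coeff 0 c) := (totalDegree_eq_zero_iff_eq_C).1 (by omega)
  refine ⟨coeff 0 c, fun h => hc0 ?_, h2⟩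
  rw [h2, h, C_0]

lemma isRelPrime_C_mul_iff {P Q : MvPolynomial (Fin m) ℝ} {a : ℝ} (ha : a ≠ 0) :
    IsRelPrime (C a * P) (C a * Q) ↔ IsRelPrime P Q := by
  have hu : IsUnit (C a : MvPolynomial (Fin m) ℝ) := (isUnit_iff_ne_zero.2 ha).map C
  rw [isRelPrime_mul_unit_left_left hu, isRelPrime_mul_unit_left_right hu]

lemma continuousOn_phaseEval {O : Set (E m)} {P : E m → MvPolynomial (Fin m) ℝ}
    (h : ContDiffOn ℝ ∞ (phaseEval P) (O ×ˢ univ)) (q : E m) :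
    ContinuousOn (fun x => phaseEval P (x, q)) O :=
  h.continuousOn.comp (by fun_prop) fun x hx => ⟨hx, mem_univ _⟩

lemma continuous_phaseEval_evalBase (A : PhasePoly m) (q : E m) :
    Continuous fun x => phaseEval (fun x => evalBase x A) (x, q) :=
  (contDiff_phaseEval_evalBase A).continuous.comp (by fun_prop)

lemma continuousOn_phaseEval_mul {O : Set (E m)} {P Q : E m → MvPolynomial (Fin m) ℝ} {q : E m}
    (hP : ContinuousOn (fun x => phaseEval P (x, q)) O)
    (hQ : ContinuousOn (fun x => phaseEval Q (x, q)) O) :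
    ContinuousOn (fun x => phaseEval (fun x => P x * Q x) (x, q)) O :=
  (hP.mul hQ).congr fun x _ => by simp [phaseEval]

lemma isOpen_setOf_ne_zero {O : Set (E m)} (hO : IsOpen O) {P : E m → MvPolynomial (Fin m) ℝ}
    (h : ContDiffOn ℝ ∞ (phaseEval P) (O ×ˢ univ)) : IsOpen {x ∈ O | P x ≠ 0} := by
  have : {x ∈ O | P x ≠ 0} = ⋃ q : E m, O ∩ {x | phaseEval P (x, q) ≠ 0} := by
    ext x
    simp only [mem_iUnion, mem_inter_iff]
    constructor
    · rintro ⟨hx, hne⟩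
      obtain ⟨q, -, hq⟩ := exists_eval_ne_zero isOpen_univ univ_nonempty hne
      exact ⟨q, hx, hq⟩
    · rintro ⟨q, hx, hq⟩
      exact ⟨hx, fun h0 => hq (by simp [phaseEval, h0])⟩
  rw [this]
  exact isOpen_iUnion fun q => (continuousOn_phaseEval h q).isOpen_inter_preimage hO isOpen_ne

lemma eq_of_eq_on_dense {O S : Set (E m)} (hO : IsOpen O) (hS : O ⊆ closure S)
    {P P' : E m → MvPolynomial (Fin m) ℝ}
    (hP : ∀ q, ContinuousOn (fun x => phaseEval P (x, q)) O)
    (hP' : ∀ q, ContinuousOn (fun x => phaseEval P' (x, q)) O)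
    (h : ∀ x ∈ S, x ∈ O → P x = P' x) : ∀ x ∈ O, P x = P' x := by
  intro x hx
  refine eq_of_eval_eq_all fun q => sub_eq_zero.1 ?_
  exact eq_zero_of_subset_closure ((hP q).sub (hP' q)) hO hS
    (fun y hy hyO => by simp [phaseEval, h y hy hyO]) x hx

lemma eq_zero_of_evalBase_eq_zero_on_dense {O S : Set (E m)} (hO : IsOpen O) (hne : O.Nonempty)
    (hS : O ⊆ closure S) {A : PhasePoly m} (h : ∀ x ∈ S, x ∈ O → evalBase x A = 0) : A = 0 := by
  refine eq_zero_of_evalBase_eq_zero hO hne fun x hx => ?_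
  refine eq_of_eq_on_dense (P := fun x => evalBase x A) (P' := fun _ => 0) hO hS
    (fun q => (continuous_phaseEval_evalBase A q).continuousOn)
    (fun q => by simpa [phaseEval] using continuousOn_const) h x hx

/-- Each coefficient of the wrong degree is a polynomial in x that vanishes on a dense part of an
open set, hence everywhere. Homogeneity thereby leaves the set O. -/
lemma isHomogeneous_evalBase_of_dense {O S : Set (E m)} (hO : IsOpen O) (hne : O.Nonempty)
    (hS : O ⊆ closure S) {A : PhasePoly m} {d : ℕ}
    (h : ∀ x ∈ S, x ∈ O → (evalBase x A).IsHomogeneous d) (x : E m) :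
    (evalBase x A).IsHomogeneous d := by
  intro α hα
  by_contra hd
  obtain ⟨p, hp⟩ := exists_coeff_evalBase A α
  have hp0 : p = 0 := by
    refine eq_zero_of_eval_eq_zero hO hne
      (eq_zero_of_subset_closure (S := S) ?_ hO hS fun y hy hyO => ?_)
    · exact ((MvPolynomial.continuous_eval p).comp (by fun_prop)).continuousOn
    · rw [← hp]
      by_contra hne
      exact hd (h y hy hyO hne)
  exact hα (by rw [hp, hp0, map_zero])

/-- A coprime pair of polynomials on the phase space, homogeneous in the momenta and invariant under
the straight line flow. -/
structure IsPrimitivePair (r s : ℕ) (A B : PhasePoly m) : Prop where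
  relPrime : IsRelPrime A B
  lineDerivation_left : lineDerivation A = 0
  lineDerivation_right : lineDerivation B = 0
  homogeneous_left : ∀ x, (evalBase x A).IsHomogeneous r
  homogeneous_right : ∀ x, (evalBase x B).IsHomogeneous s

lemma IsPrimitivePair.symm {r s : ℕ} {A B : PhasePoly m} (h : IsPrimitivePair r s A B) :
    IsPrimitivePair s r B A :=
  ⟨h.relPrime.symm, h.lineDerivation_right, h.lineDerivation_left, h.homogeneous_right,
    h.homogeneous_left⟩

namespace IsFlatPair

variable {O : Set (E m)} {r s : ℕ} {P Q : E m → MvPolynomial (Fin m) ℝ}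

/-- V/U equals P/Q on O₁ and so is invariant too. Differentiating VQ = UP along the flow and
eliminating the derivatives of P and Q gives the claim multiplied by Q². -/
lemma wronskian_eq_zero (h : IsFlatPair O r s P Q) {O₁ : Set (E m)} (hO₁ : IsOpen O₁)
    (hne : O₁.Nonempty) (hO₁O : O₁ ⊆ O) (hQ : ∀ x ∈ O₁, Q x ≠ 0) {V U : PhasePoly m}
    (hVU : ∀ x ∈ O₁, evalBase x V * Q x = evalBase x U * P x) :
    U * lineDerivation V = V * lineDerivation U := by
  refine sub_eq_zero.1 (eq_zero_of_evalBase_eq_zero hO₁ hne fun x hx => ?_)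
  have hQ2 : Q x * Q x ≠ 0 := mul_ne_zero (hQ x hx) (hQ x hx)
  refine (mul_eq_zero.1 (?_ : Q x * Q x * _ = 0)).resolve_left hQ2
  refine eq_of_eval_eq_all fun q => ?_
  have hdA : ∀ A : PhasePoly m, DifferentiableAt ℝ (phaseEval fun x => evalBase x A) (x, q) :=
    fun A => (contDiff_phaseEval_evalBase A).differentiable (by simp) _
  have hdP := (contDiffAt_phaseEval h.isOpen h.smooth_left (hO₁O hx) q).differentiableAt (by simp)
  have hdQ := (contDiffAt_phaseEval h.isOpen h.smooth_right (hO₁O hx) q).differentiableAt (by simp)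
  have hev : (fun z => phaseEval (fun x => evalBase x V) z * phaseEval Q z) =ᶠ[𝓝 (x, q)]
      fun z => phaseEval (fun x => evalBase x U) z * phaseEval P z := by
    filter_upwards [(hO₁.prod isOpen_univ).mem_nhds (⟨hx, mem_univ q⟩ : (x, q) ∈ O₁ ×ˢ univ)]
      with z hz
    simp only [phaseEval, ← map_mul, hVU z.1 hz.1]
  have h1 : flowDeriv (fun z => phaseEval (fun x => evalBase x V) z * phaseEval Q z) (x, q)
      = flowDeriv (fun z => phaseEval (fun x => evalBase x U) z * phaseEval P z) (x, q) := by
    simp only [flowDeriv, hev.fderiv_eq]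
  rw [flowDeriv_mul (hdA V) hdQ, flowDeriv_mul (hdA U) hdP, flowDeriv_phaseEval_evalBase,
    flowDeriv_phaseEval_evalBase] at h1
  have h2 := h.flow x (hO₁O hx) q
  have h3 := hev.eq_of_nhds
  simp only [phaseEval] at h1 h2 h3
  simp only [map_mul, map_sub, map_zero]
  set p := MvPolynomial.eval (fun i => q i) (P x)
  set k := MvPolynomial.eval (fun i => q i) (Q x)
  set v := MvPolynomial.eval (fun i => q i) (evalBase x V)
  set u := MvPolynomial.eval (fun i => q i) (evalBase x U)
  linear_combination u * k * h1 + u * u * h2 - (k * MvPolynomial.eval (fun i => q i)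
    (evalBase x (lineDerivation U)) + u * flowDeriv (phaseEval Q) (x, q)) * h3

/-- Reducing V/U to lowest terms A/B in the factorial ring of phase polynomials makes A and B
separately invariant. Their degrees in q are read off at generic points, where (A, B) is a multiple
of the coprime pair (P, Q). -/
lemma exists_local_pair (h : IsFlatPair O r s P Q) {x₁ : E m} (hx₁ : x₁ ∈ O) (hQ : Q x₁ ≠ 0) :
    ∃ (A B : PhasePoly m) (O₁ : Set (E m)), IsPrimitivePair r s A B ∧ IsOpen O₁ ∧ x₁ ∈ O₁ ∧
      O₁ ⊆ O ∧ ∀ x ∈ O₁, P x * evalBase x B = evalBase x A * Q x := by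
  obtain ⟨O₁, V, U, hO₁, hx₁O₁, hO₁O, hQO₁, hne, hV, hU, hVU⟩ := h.exists_rational hx₁ hQ
  have hO₁n : O₁.Nonempty := ⟨x₁, hx₁O₁⟩
  have hU0 : U ≠ 0 := by
    rintro rfl
    refine hne.elim (fun hV0 => hV0 (eq_zero_of_evalBase_eq_zero hO₁ hO₁n fun x hx => ?_))
      fun h => h rfl
    have := hVU x hx
    rw [map_zero, zero_mul] at this
    exact (mul_eq_zero.1 this).resolve_right (hQO₁ x hx)
  obtain ⟨A, B, G, hAB, hGA, hGB⟩ := UniqueFactorizationMonoid.exists_reduced_factors' V U hU0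
  have hG0 : G ≠ 0 := fun h0 => hU0 (by rw [← hGB, h0, zero_mul])
  have hW := h.wronskian_eq_zero hO₁ hO₁n hO₁O hQO₁ hVU
  have hW2 : B * lineDerivation A = A * lineDerivation B := by
    rw [← hGA, ← hGB, Derivation.leibniz, Derivation.leibniz, smul_eq_mul, smul_eq_mul,
      smul_eq_mul, smul_eq_mul] at hW
    refine mul_left_cancel₀ (mul_ne_zero hG0 hG0) ?_
    linear_combination hW
  -- The common factor G is nonzero over a dense set of positions; cancel it there and extend by
  -- continuity.
  have hABx : ∀ x ∈ O₁, evalBase x A * Q x = evalBase x B * P x := by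
    refine eq_of_eq_on_dense hO₁ (fun x _ => dense_evalBase_ne_zero hG0 x)
      (P := fun x => evalBase x A * Q x) (P' := fun x => evalBase x B * P x) (fun q => ?_)
      (fun q => ?_) fun x hGx hx => mul_left_cancel₀ hGx ?_
    · exact continuousOn_phaseEval_mul (continuous_phaseEval_evalBase A q).continuousOn
        ((continuousOn_phaseEval h.smooth_right q).mono hO₁O)
    · exact continuousOn_phaseEval_mul (continuous_phaseEval_evalBase B q).continuousOn
        ((continuousOn_phaseEval h.smooth_left q).mono hO₁O)
    · have := hVU x hx
      rw [← hGA, ← hGB, map_mul, map_mul] at this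
      linear_combination this
  have hdense : O₁ ⊆ closure (({x ∈ O | IsRelPrime (P x) (Q x)}) ∩ {x | evalBase x U ≠ 0}) := by
    refine subset_closure_inter_of_dense (hO₁O.trans h.relPrime) ?_
      (fun x _ => dense_evalBase_ne_zero hU0 x) hO₁
    have := isOpen_setOf_ne_zero isOpen_univ (contDiff_phaseEval_evalBase U).contDiffOn
    simpa using this
  have hprop : ∀ x ∈ ({x ∈ O | IsRelPrime (P x) (Q x)}) ∩ {x | evalBase x U ≠ 0}, x ∈ O₁ →
      ∃ a : ℝ, evalBase x A = C a * P x ∧ evalBase x B = C a * Q x := by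
    rintro x ⟨⟨hxO, hrel⟩, hUx⟩ hx
    obtain ⟨c, hA, hB⟩ := exists_eq_mul_of_isRelPrime hrel (hQO₁ x hx) (hABx x hx)
    -- U(x) and Q(x) have the same degree s, so the cofactor G(x)c is a nonzero constant, and then
    -- its factor c is constant as well.
    have hU' : evalBase x U = evalBase x G * c * Q x := by
      rw [← hGB, map_mul, hB, mul_assoc]
    obtain ⟨a, ha, hac⟩ := exists_eq_C_of_isHomogeneous_mul (h.homogeneous_right x hxO)
      (hU' ▸ hU x) (hU' ▸ hUx)
    have hc : c.totalDegree = 0 := by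
      have h0 : evalBase x G * c ≠ 0 := by
        rw [hac]
        simpa using ha
      have := totalDegree_mul_of_isDomain (left_ne_zero_of_mul h0) (right_ne_zero_of_mul h0)
      rw [hac, totalDegree_C] at this
      omega
    rw [totalDegree_eq_zero_iff_eq_C] at hc
    exact ⟨coeff 0 c, by rw [← hc, hA], by rw [← hc, hB]⟩
  refine ⟨A, B, O₁, ⟨hAB, lineDerivation_eq_zero_of_isRelPrime hAB hW2,
    lineDerivation_eq_zero_of_isRelPrime hAB.symm hW2.symm,
    isHomogeneous_evalBase_of_dense hO₁ hO₁n hdense fun x hxS hx => ?_,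
    isHomogeneous_evalBase_of_dense hO₁ hO₁n hdense fun x hxS hx => ?_⟩, hO₁, hx₁O₁, hO₁O,
    fun x hx => by rw [hABx x hx, mul_comm]⟩
  · obtain ⟨a, hA, -⟩ := hprop x hxS hx
    rw [hA]
    exact (h.homogeneous_left x (hO₁O hx)).C_mul a
  · obtain ⟨a, -, hB⟩ := hprop x hxS hx
    rw [hB]
    exact (h.homogeneous_right x (hO₁O hx)).C_mul a

lemma exists_local_pair_of_ne_zero (h : IsFlatPair O r s P Q) {x₁ : E m} (hx₁ : x₁ ∈ O)
    (hPQ : ¬(P x₁ = 0 ∧ Q x₁ = 0)) :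
    ∃ (A B : PhasePoly m) (O₁ : Set (E m)), IsPrimitivePair r s A B ∧ IsOpen O₁ ∧ x₁ ∈ O₁ ∧
      O₁ ⊆ O ∧ ∀ x ∈ O₁, P x * evalBase x B = evalBase x A * Q x := by
  by_cases hQ : Q x₁ = 0
  · obtain ⟨A, B, O₁, hp, hO₁, hx, hsub, hAB⟩ :=
      h.symm.exists_local_pair hx₁ fun hP => hPQ ⟨hP, hQ⟩
    exact ⟨B, A, O₁, hp.symm, hO₁, hx, hsub, fun x hx => by
      rw [mul_comm, ← hAB x hx, mul_comm]⟩
  · exact h.exists_local_pair hx₁ hQ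

lemma not_both_zero {x : E m} (h : IsRelPrime (P x) (Q x)) : ¬(P x = 0 ∧ Q x = 0) := by
  rintro ⟨h1, h2⟩
  rw [h1, h2, isRelPrime_zero_left] at h
  exact not_isUnit_zero h

/-- Analytic continuation: a local pair consists of polynomials defined everywhere, and the set near
whose points it represents P/Q is open and relatively closed in the complement of the common zeros.
At a common zero the identity reads 0 = 0. -/
lemma exists_pair (h : IsFlatPair O r s P Q) (hne : O.Nonempty)
    (hconn : IsPreconnected (O \ {x | P x = 0 ∧ Q x = 0})) :
    ∃ A B : PhasePoly m, IsPrimitivePair r s A B ∧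
      ∀ x ∈ O, P x * evalBase x B = evalBase x A * Q x := by
  obtain ⟨x₀, hx₀O, hx₀⟩ : (O \ {x | P x = 0 ∧ Q x = 0}).Nonempty := by
    obtain ⟨y, hy⟩ := hne
    obtain ⟨z, hz, hz'⟩ := mem_closure_iff_nhds.1 (h.relPrime hy) O (h.isOpen.mem_nhds hy)
    exact ⟨z, hz, not_both_zero hz'.2⟩
  obtain ⟨A, B, O₀, hAB, hO₀, hx₀O₀, hO₀O, hid⟩ := h.exists_local_pair_of_ne_zero hx₀O hx₀
  refine ⟨A, B, hAB, ?_⟩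
  set S : Set (E m) := {x | ∀ᶠ y in 𝓝 x, P y * evalBase y B = evalBase y A * Q y} with hS
  have hSo : IsOpen S := isOpen_setOfPred_eventually_nhds
  have key : O \ {x | P x = 0 ∧ Q x = 0} ⊆ S := by
    refine hconn.subset_of_closure_inter_subset hSo
      ⟨x₀, ⟨hx₀O, hx₀⟩, Filter.eventually_of_mem (hO₀.mem_nhds hx₀O₀) hid⟩ ?_
    rintro x ⟨hxS, hxO, hx⟩
    obtain ⟨A', B', O', hAB', hO', hxO', hO'O, hid'⟩ := h.exists_local_pair_of_ne_zero hxO hx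
    have hW : IsOpen (O' ∩ S) := hO'.inter hSo
    have hWn : (O' ∩ S).Nonempty := mem_closure_iff_nhds.1 hxS O' (hO'.mem_nhds hxO')
    -- On the overlap both pairs represent P/Q, so the cross product vanishes on a nonempty open
    -- set, and hence identically.
    have hcross : A * B' = A' * B := by
      refine sub_eq_zero.1 (eq_zero_of_evalBase_eq_zero_on_dense hW hWn
        ((inter_subset_left.trans hO'O).trans h.relPrime) ?_)
      rintro y ⟨hyO, hrel⟩ ⟨hyO', hyS⟩
      have e1 : P y * evalBase y B = evalBase y A * Q y := hyS.self_of_nhds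
      have e2 := hid' y hyO'
      rw [map_sub, map_mul, map_mul, sub_eq_zero]
      by_cases hQ : Q y = 0
      · have hP : P y ≠ 0 := fun hP => not_both_zero hrel ⟨hP, hQ⟩
        refine mul_left_cancel₀ hP ?_
        linear_combination evalBase y A * e2 - evalBase y A' * e1
      · refine mul_left_cancel₀ hQ ?_
        linear_combination evalBase y B * e2 - evalBase y B' * e1
    refine Filter.eventually_of_mem (hO'.mem_nhds hxO') ?_
    -- B' may be zero, as Q may vanish near x; then A' is not, by coprimality, and serves as the
    -- multiplier to be cancelled.
    obtain ⟨T, hT0, hT⟩ : ∃ T : PhasePoly m, T ≠ 0 ∧ ∀ y ∈ O',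
        evalBase y T * (P y * evalBase y B) = evalBase y T * (evalBase y A * Q y) := by
      have hc : ∀ y, evalBase y A * evalBase y B' = evalBase y A' * evalBase y B := fun y => by
        rw [← map_mul, hcross, map_mul]
      by_cases hB' : B' = 0
      · refine ⟨A', fun hA' => ?_, fun y hy => ?_⟩
        · have := hAB'.relPrime
          rw [hA', hB', isRelPrime_zero_left] at this
          exact not_isUnit_zero this
        · linear_combination (evalBase y A) * hid' y hy - P y * hc y
      · exact ⟨B', hB', fun y hy => by
          linear_combination evalBase y B * hid' y hy - Q y * hc y⟩
    refine eq_of_eq_on_dense hO' (fun x _ => dense_evalBase_ne_zero hT0 x)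
      (P := fun x => P x * evalBase x B) (P' := fun x => evalBase x A * Q x) (fun q => ?_)
      (fun q => ?_) fun y hTy hy => mul_left_cancel₀ hTy (hT y hy)
    · exact continuousOn_phaseEval_mul ((continuousOn_phaseEval h.smooth_left q).mono hO'O)
        (continuous_phaseEval_evalBase B q).continuousOn
    · exact continuousOn_phaseEval_mul (continuous_phaseEval_evalBase A q).continuousOn
        ((continuousOn_phaseEval h.smooth_right q).mono hO'O)
  intro x hx
  by_cases hx0 : P x = 0 ∧ Q x = 0
  · rw [hx0.1, hx0.2, zero_mul, mul_zero]
  · exact (key ⟨hx, hx0⟩ : ∀ᶠ y in 𝓝 x, _).self_of_nhds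

end IsFlatPair

/-- Coprimality in the ring of phase polynomials does not by itself give coprimality at each
position. It is inherited from P and Q: where these are coprime and B(x) ≠ 0, equal degrees make (A,
B)(x) a nonzero constant multiple of (P, Q)(x). -/
lemma IsPrimitivePair.dense_isRelPrime {O : Set (E m)} {r s : ℕ} {A B : PhasePoly m}
    {P Q : E m → MvPolynomial (Fin m) ℝ} (hAB : IsPrimitivePair r s A B) (hO : IsOpen O)
    (hne : O.Nonempty) (hQ : ∀ x ∈ O, (Q x).IsHomogeneous s)
    (hd : O ⊆ closure {x ∈ O | Q x ≠ 0 ∧ IsRelPrime (P x) (Q x)})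
    (hid : ∀ x ∈ O, P x * evalBase x B = evalBase x A * Q x) :
    O ⊆ closure {x ∈ O | evalBase x B ≠ 0 ∧ IsRelPrime (evalBase x A) (evalBase x B)} := by
  have hB0 : B ≠ 0 := by
    rintro rfl
    have hA0 : A = 0 := by
      refine eq_zero_of_evalBase_eq_zero_on_dense hO hne hd ?_
      rintro x ⟨-, hQx, -⟩ hx
      have := hid x hx
      rw [map_zero, mul_zero] at this
      exact (mul_eq_zero.1 this.symm).resolve_right hQx
    have := hAB.relPrime
    rw [hA0, isRelPrime_zero_left] at this
    exact not_isUnit_zero this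
  have hopen : IsOpen {x : E m | evalBase x B ≠ 0} := by
    simpa using isOpen_setOf_ne_zero isOpen_univ (contDiff_phaseEval_evalBase B).contDiffOn
  refine (subset_closure_inter_of_dense hd hopen
    (fun x _ => dense_evalBase_ne_zero hB0 x) hO).trans (closure_mono ?_)
  rintro x ⟨⟨hx, hQx, hrel⟩, hBx⟩
  refine ⟨hx, hBx, ?_⟩
  obtain ⟨c, hA, hB⟩ := exists_eq_mul_of_isRelPrime (A := evalBase x A) (B := evalBase x B) hrel hQx
    (by rw [← hid x hx, mul_comm])
  obtain ⟨a, ha, rfl⟩ := exists_eq_C_of_isHomogeneous_mul (hQ x hx)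
    (hB ▸ hAB.homogeneous_right x) (hB ▸ hBx)
  rw [hA, hB]
  exact (isRelPrime_C_mul_iff ha).2 hrel

/-- Two coprime pairs of invariants with the same ratio differ by a constant factor. -/
lemma exists_const_of_same_ratio {O : Set (E m)} {s : ℕ}
    {A B A' B' : E m → MvPolynomial (Fin m) ℝ} (hO : IsOpen O) (hconv : Convex ℝ O)
    (hne : O.Nonempty) (hAs : ContDiffOn ℝ ∞ (phaseEval A) (O ×ˢ univ))
    (hBs : ContDiffOn ℝ ∞ (phaseEval B) (O ×ˢ univ))
    (hAs' : ContDiffOn ℝ ∞ (phaseEval A') (O ×ˢ univ))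
    (hBs' : ContDiffOn ℝ ∞ (phaseEval B') (O ×ˢ univ))
    (hBh : ∀ x ∈ O, (B x).IsHomogeneous s) (hBh' : ∀ x ∈ O, (B' x).IsHomogeneous s)
    (hB : ∀ x ∈ O, ∀ q, flowDeriv (phaseEval B) (x, q) = 0)
    (hB' : ∀ x ∈ O, ∀ q, flowDeriv (phaseEval B') (x, q) = 0)
    (hid : ∀ x ∈ O, A x * B' x = A' x * B x) (hd : O ⊆ closure {x ∈ O | B x ≠ 0})
    (hd' : O ⊆ closure {x ∈ O | B' x ≠ 0 ∧ IsRelPrime (A' x) (B' x)}) :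
    ∃ c : ℝ, c ≠ 0 ∧ ∀ x ∈ O, A x = C c * A' x ∧ B x = C c * B' x := by
  have hS := subset_closure_inter_of_dense hd' (isOpen_setOf_ne_zero hO hBs) hd hO
  set S := {x ∈ O | B' x ≠ 0 ∧ IsRelPrime (A' x) (B' x)} ∩ {x ∈ O | B x ≠ 0}
  have hratio : ∀ x ∈ S, ∃ c : ℝ, c ≠ 0 ∧ A x = C c * A' x ∧ B x = C c * B' x := by
    rintro x ⟨⟨hx, hBx', hrel⟩, -, hBx⟩
    obtain ⟨c, hA, hB⟩ := exists_eq_mul_of_isRelPrime (A := A x) (B := B x) hrel hBx'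
      (by rw [hid x hx, mul_comm])
    obtain ⟨a, ha, rfl⟩ := exists_eq_C_of_isHomogeneous_mul (hBh' x hx)
      (hB ▸ hBh x hx) (hB ▸ hBx)
    exact ⟨a, ha, hA, hB⟩
  obtain ⟨x₁, hx₁S⟩ : S.Nonempty := closure_nonempty_iff.1 (hne.mono hS)
  have hx₁ : x₁ ∈ O := hx₁S.1.1
  obtain ⟨c, hc, hcA, hcB⟩ := hratio x₁ hx₁S
  have hseg : ∀ z ∈ O, ∀ t ∈ Icc (0 : ℝ) 1, x₁ + t • (z - x₁) ∈ O := fun z hz t ht =>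
    hconv.add_smul_sub_mem hx₁ hz ht
  -- Points that can be compared with x₁: the invariant B' is nonzero on the line from x₁ to z.
  set T : Set (E m) := {z | phaseEval B' (x₁, z - x₁) ≠ 0} with hT
  have hTo : IsOpen T := by
    refine isOpen_ne.preimage (f := fun z => phaseEval B' (x₁, z - x₁)) ?_
    exact (MvPolynomial.continuous_eval (B' x₁)).comp (by fun_prop)
  have hTd : O ⊆ closure T := by
    intro y _
    rw [mem_closure_iff]
    intro N hN hyN
    obtain ⟨q, hq, hq'⟩ := exists_eval_ne_zero (O := (fun q => x₁ + q) ⁻¹' N)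
      (hN.preimage (by fun_prop)) ⟨y - x₁, by simpa using hyN⟩ hx₁S.1.2.1
    exact ⟨x₁ + q, hq, by simpa [hT, phaseEval] using hq'⟩
  have hST := subset_closure_inter_of_dense hS hTo hTd hO
  have hconst : ∀ z ∈ S ∩ T, A z = C c * A' z ∧ B z = C c * B' z := by
    rintro z ⟨hzS, hzT⟩
    obtain ⟨c', -, hA, hB''⟩ := hratio z hzS
    have hz : z ∈ O := hzS.1.1
    have e1 := eq_of_flowDeriv_eq_zero hO hBs hB (hseg z hz) 1 (by simp)
    have e2 := eq_of_flowDeriv_eq_zero hO hBs' hB' (hseg z hz) 1 (by simp)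
    rw [one_smul, add_sub_cancel] at e1 e2
    have hzT' : phaseEval B' (x₁, z - x₁) ≠ 0 := hzT
    -- Both B and B' are conserved from x₁ to z, so their factor of proportionality at z is the one
    -- at x₁.
    have hcc : c' = c := by
      refine mul_right_cancel₀ hzT' ?_
      calc c' * phaseEval B' (x₁, z - x₁) = c' * phaseEval B' (z, z - x₁) := by rw [e2]
        _ = phaseEval B (z, z - x₁) := by simp [phaseEval, hB'']
        _ = phaseEval B (x₁, z - x₁) := e1
        _ = c * phaseEval B' (x₁, z - x₁) := by simp [phaseEval, hcB]
    exact hcc ▸ ⟨hA, hB''⟩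
  refine ⟨c, hc, fun x hx => ⟨?_, ?_⟩⟩
  · refine eq_of_eq_on_dense (P := A) (P' := fun x => C c * A' x) hO hST
      (continuousOn_phaseEval hAs) (fun q => ?_) (fun z hz _ => (hconst z hz).1) x hx
    exact ((continuousOn_phaseEval hAs' q).const_smul c).congr fun x _ => by simp [phaseEval]
  · refine eq_of_eq_on_dense (P := B) (P' := fun x => C c * B' x) hO hST
      (continuousOn_phaseEval hBs) (fun q => ?_) (fun z hz _ => (hconst z hz).2) x hx
    exact ((continuousOn_phaseEval hBs' q).const_smul c).congr fun x _ => by simp [phaseEval]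

/-- An invariant that vanishes somewhere on every segment from `V₁` to `V₂` vanishes on `V₁`. -/
lemma eq_zero_of_forall_segment {O V₁ V₂ : Set (E m)} (hO : IsOpen O) (hconv : Convex ℝ O)
    {B : E m → MvPolynomial (Fin m) ℝ} (hBs : ContDiffOn ℝ ∞ (phaseEval B) (O ×ˢ univ))
    (hB : ∀ x ∈ O, ∀ q, flowDeriv (phaseEval B) (x, q) = 0) (h₁ : V₁ ⊆ O) (h₂ : V₂ ⊆ O)
    (hV₂ : IsOpen V₂) (hne : V₂.Nonempty)
    (h : ∀ x ∈ V₁, ∀ z ∈ V₂, ∃ t ∈ Icc (0 : ℝ) 1, B (x + t • (z - x)) = 0) :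
    ∀ x ∈ V₁, B x = 0 := by
  intro x hx
  refine eq_zero_of_eval_eq_zero (O := (fun q => x + q) ⁻¹' V₂) (hV₂.preimage (by fun_prop)) ?_ ?_
  · obtain ⟨z, hz⟩ := hne
    exact ⟨z - x, by simpa using hz⟩
  intro q hq
  obtain ⟨t, ht, h0⟩ := h x hx (x + q) hq
  have := eq_of_flowDeriv_eq_zero hO hBs hB (x := x) (q := q) (fun t ht => by
    simpa using hconv.add_smul_sub_mem (h₁ hx) (h₂ hq) ht) t ht
  rw [add_sub_cancel_left] at h0
  simpa [phaseEval, h0] using this.symm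

end FlatGlobal

/-! ### The Poisson bracket under changes of coordinates. -/

section Poisson

variable {m : ℕ}

open scoped RealInnerProductSpace

/-- The gradient in the momenta. -/
def gradP (F : E m → E m → ℝ) (u a : E m) : E m := WithLp.toLp 2 fun i => pd i (fun b => F u b) a

/-- The gradient in the positions. -/
def gradX (F : E m → E m → ℝ) (u a : E m) : E m := WithLp.toLp 2 fun i => pd i (fun y => F y a) u

lemma sum_smul_stdVec (v : E m) : ∑ i, v i • stdVec i = v := by
  have := (EuclideanSpace.basisFun (Fin m) ℝ).sum_repr v
  simpa [stdVec] using this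

lemma inner_toLp_apply_stdVec (f : E m →L[ℝ] ℝ) (v : E m) :
    ⟪(WithLp.toLp 2 fun i => f (stdVec i) : E m), v⟫ = f v := by
  conv_rhs => rw [← sum_smul_stdVec v]
  simp [PiLp.inner_apply]

lemma inner_gradP (F : E m → E m → ℝ) (u a v : E m) :
    ⟪gradP F u a, v⟫ = fderiv ℝ (fun b => F u b) a v := inner_toLp_apply_stdVec _ v

lemma inner_gradX (F : E m → E m → ℝ) (u a v : E m) :
    ⟪gradX F u a, v⟫ = fderiv ℝ (fun y => F y a) u v := inner_toLp_apply_stdVec _ v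

lemma poisson_eq_inner (H F : E m → E m → ℝ) (u a : E m) :
    poisson H F u a = ⟪gradP H u a, gradX F u a⟫ - ⟪gradX H u a, gradP F u a⟫ := by
  simp [poisson, gradP, gradX, PiLp.inner_apply, Finset.sum_sub_distrib, mul_comm]

lemma fderiv_uncurry_apply {F : E m → E m → ℝ} {u a : E m}
    (hF : DifferentiableAt ℝ (fun z : E m × E m => F z.1 z.2) (u, a)) (v w : E m) :
    fderiv ℝ (fun z : E m × E m => F z.1 z.2) (u, a) (v, w)
      = ⟪gradX F u a, v⟫ + ⟪gradP F u a, w⟫ := by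
  have h1 : HasFDerivAt (fun y : E m => F y a)
      ((fderiv ℝ (fun z : E m × E m => F z.1 z.2) (u, a)).comp
        (ContinuousLinearMap.inl ℝ (E m) (E m))) u :=
    HasFDerivAt.comp (f := fun y : E m => (y, a)) u hF.hasFDerivAt
      ((hasFDerivAt_id u).prodMk (hasFDerivAt_const a u))
  have h2 : HasFDerivAt (fun b : E m => F u b)
      ((fderiv ℝ (fun z : E m × E m => F z.1 z.2) (u, a)).comp
        (ContinuousLinearMap.inr ℝ (E m) (E m))) a :=
    HasFDerivAt.comp (f := fun b : E m => (u, b)) a hF.hasFDerivAt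
      ((hasFDerivAt_const u a).prodMk (hasFDerivAt_id a))
  rw [inner_gradX, inner_gradP, h1.fderiv, h2.fderiv]
  simp [← map_add]

lemma poisson_eq_fderiv (H : E m → E m → ℝ) {F : E m → E m → ℝ} {u a : E m}
    (hF : DifferentiableAt ℝ (fun z : E m × E m => F z.1 z.2) (u, a)) :
    poisson H F u a
      = fderiv ℝ (fun z : E m × E m => F z.1 z.2) (u, a) (gradP H u a, -gradX H u a) := by
  rw [fderiv_uncurry_apply hF, poisson_eq_inner, inner_neg_right, real_inner_comm (gradP H u a),
    real_inner_comm (gradX H u a)]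
  ring

/-- The pull-back of the covector `a` under `L`, as a function of `L`. -/
def coPull (a : E m) : (E m →L[ℝ] E m) →L[ℝ] E m :=
  ((EuclideanSpace.equiv (Fin m) ℝ).symm : (Fin m → ℝ) →L[ℝ] E m).comp
    (ContinuousLinearMap.pi fun j => (innerSL ℝ a).comp
      (ContinuousLinearMap.apply ℝ (E m) (stdVec j)))

/-- For fixed a the adjoint is continuous linear in L, so the chain rule applies to the momentum
(dτ)* a as the position varies. -/
lemma coPull_eq (a : E m) (L : E m →L[ℝ] E m) : coPull a L = L.adjoint a := by
  refine ext_inner_right ℝ fun v => ?_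
  rw [ContinuousLinearMap.adjoint_inner_left]
  exact inner_toLp_apply_stdVec ((innerSL ℝ a).comp L) v

/-- The Poisson bracket is invariant under the cotangent lift of a change of coordinates. -/
theorem poisson_cotangentLift {τ : E m → E m} {H F H' F' : E m → E m → ℝ} {u : E m}
    (hτ : ContDiffAt ℝ 2 τ u)
    (hFF' : ∀ᶠ y in 𝓝 u, ∀ b, F' (τ y) b = F y ((fderiv ℝ τ y).adjoint b))
    (hHH' : ∀ᶠ y in 𝓝 u, ∀ b, H' (τ y) b = H y ((fderiv ℝ τ y).adjoint b)) (a : E m)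
    (hF : DifferentiableAt ℝ (fun z : E m × E m => F z.1 z.2) (u, (fderiv ℝ τ u).adjoint a))
    (hH : DifferentiableAt ℝ (fun z : E m × E m => H z.1 z.2) (u, (fderiv ℝ τ u).adjoint a))
    (hF' : DifferentiableAt ℝ (fun y => F' y a) (τ u))
    (hH' : DifferentiableAt ℝ (fun y => H' y a) (τ u)) :
    poisson H' F' (τ u) a = poisson H F u ((fderiv ℝ τ u).adjoint a) := by
  have hd : HasFDerivAt τ (fderiv ℝ τ u) u := (hτ.differentiableAt (by simp)).hasFDerivAt
  have hdd : HasFDerivAt (fderiv ℝ τ) (fderiv ℝ (fderiv ℝ τ) u) u :=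
    ((hτ.fderiv_right (m := 1) (by norm_num)).differentiableAt (by simp)).hasFDerivAt
  have hsymm : ∀ v w, fderiv ℝ (fderiv ℝ τ) u v w = fderiv ℝ (fderiv ℝ τ) u w v :=
    (hτ.isSymmSndFDerivAt (by simp))
  -- The momentum gradient transforms as a vector. The position gradient acquires a term in the
  -- second derivative of τ, because the lifted momentum depends on position; in the bracket these
  -- terms cancel by the symmetry of that derivative.
  have main : ∀ {F F' : E m → E m → ℝ},
      (∀ᶠ y in 𝓝 u, ∀ b, F' (τ y) b = F y ((fderiv ℝ τ y).adjoint b)) →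
      DifferentiableAt ℝ (fun z : E m × E m => F z.1 z.2) (u, (fderiv ℝ τ u).adjoint a) →
      DifferentiableAt ℝ (fun y => F' y a) (τ u) →
      gradP F' (τ u) a = fderiv ℝ τ u (gradP F u ((fderiv ℝ τ u).adjoint a)) ∧
      ∀ v, ⟪gradX F' (τ u) a, fderiv ℝ τ u v⟫ = ⟪gradX F u ((fderiv ℝ τ u).adjoint a), v⟫
        + ⟪a, fderiv ℝ (fderiv ℝ τ) u v (gradP F u ((fderiv ℝ τ u).adjoint a))⟫ := by
    intro F F' hFF' hF hF'
    constructor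
    · refine ext_inner_right ℝ fun δ => ?_
      rw [inner_gradP, ← ContinuousLinearMap.adjoint_inner_right]
      have h1 : (fun b => F' (τ u) b) = fun b => F u ((fderiv ℝ τ u).adjoint b) :=
        funext hFF'.self_of_nhds
      have h2 : HasFDerivAt (fun b => ((u, (fderiv ℝ τ u).adjoint b) : E m × E m))
          ((0 : E m →L[ℝ] E m).prod (fderiv ℝ τ u).adjoint) a :=
        (hasFDerivAt_const u a).prodMk (fderiv ℝ τ u).adjoint.hasFDerivAt
      have h3 : HasFDerivAt (fun b => F u ((fderiv ℝ τ u).adjoint b)) _ a :=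
        HasFDerivAt.comp (g := fun z : E m × E m => F z.1 z.2) a hF.hasFDerivAt h2
      rw [h1, h3.fderiv, ContinuousLinearMap.comp_apply]
      simp only [ContinuousLinearMap.prod_apply]
      rw [fderiv_uncurry_apply hF]
      simp
    · intro v
      rw [inner_gradX]
      have h2 : HasFDerivAt (fun y => ((y, coPull a (fderiv ℝ τ y)) : E m × E m))
          ((ContinuousLinearMap.id ℝ (E m)).prod
            ((coPull a).comp (fderiv ℝ (fderiv ℝ τ) u))) u :=
        (hasFDerivAt_id u).prodMk ((coPull a).hasFDerivAt.comp u hdd)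
      have h3 := HasFDerivAt.comp u (g := fun z : E m × E m => F z.1 z.2)
        (by rw [coPull_eq]; exact hF.hasFDerivAt) h2
      have h4 : (fun y => F' (τ y) a) =ᶠ[𝓝 u]
          (fun z : E m × E m => F z.1 z.2) ∘ fun y => (y, coPull a (fderiv ℝ τ y)) := by
        filter_upwards [hFF'] with y hy
        simp [coPull_eq, hy a]
      have h5 := (HasFDerivAt.comp u hF'.hasFDerivAt hd).unique (h3.congr_of_eventuallyEq h4)
      have h6 := congrArg (fun L : E m →L[ℝ] ℝ => L v) h5
      simp only [ContinuousLinearMap.comp_apply, ContinuousLinearMap.prod_apply,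
        ContinuousLinearMap.id_apply] at h6
      rw [h6, fderiv_uncurry_apply hF, coPull_eq, ContinuousLinearMap.adjoint_inner_right,
        real_inner_comm a]
  obtain ⟨f1, f2⟩ := main hFF' hF hF'
  obtain ⟨h1, h2⟩ := main hHH' hH hH'
  rw [poisson_eq_inner, poisson_eq_inner, f1, h1, real_inner_comm, f2, h2, hsymm,
    real_inner_comm (gradP H u _)]
  ring

end Poisson

/-! ### Charts, the metric and the Hamiltonian under transition maps. -/

section Charts

variable {m : ℕ} {M : Type*} [TopologicalSpace M] [ChartedSpace (E m) M]

open scoped RealInnerProductSpace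

/-- The differential of a chart. -/
def chartDeriv (φ : OpenPartialHomeomorph M (E m)) (x : M) : E m →L[ℝ] E m :=
  mfderiv (𝓡 m) (𝓡 m) φ x

/-- The differential of the inverse of a chart. -/
def chartSymmDeriv (φ : OpenPartialHomeomorph M (E m)) (u : E m) : E m →L[ℝ] E m :=
  mfderiv (𝓡 m) (𝓡 m) φ.symm u

/-- The change of coordinates between two charts. -/
def transition (φ ψ : OpenPartialHomeomorph M (E m)) (u : E m) : E m := ψ (φ.symm u)

lemma IsChart.mdifferentiable {φ : OpenPartialHomeomorph M (E m)} (hφ : IsChart φ) :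
    φ.MDifferentiable (𝓡 m) (𝓡 m) :=
  ⟨(contMDiffOn_of_mem_maximalAtlas hφ).mdifferentiableOn (by simp),
    (contMDiffOn_symm_of_mem_maximalAtlas hφ).mdifferentiableOn (by simp)⟩

lemma IsChart.chartDeriv_chartSymmDeriv {φ : OpenPartialHomeomorph M (E m)} (hφ : IsChart φ)
    {u : E m} (hu : u ∈ φ.target) (v : E m) :
    chartDeriv φ (φ.symm u) (chartSymmDeriv φ u v) = v :=
  congrArg (fun L : E m →L[ℝ] E m => L v) (hφ.mdifferentiable.comp_symm_deriv hu)

lemma IsChart.chartSymmDeriv_chartDeriv {φ : OpenPartialHomeomorph M (E m)} (hφ : IsChart φ)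
    {x : M} (hx : x ∈ φ.source) (v : E m) :
    chartSymmDeriv φ (φ x) (chartDeriv φ x v) = v :=
  congrArg (fun L : E m →L[ℝ] E m => L v) (hφ.mdifferentiable.symm_comp_deriv hx)

variable {φ ψ : OpenPartialHomeomorph M (E m)} {u : E m}

lemma contDiffAt_transition (hφ : IsChart φ) (hψ : IsChart ψ) (hu : u ∈ φ.target)
    (hx : φ.symm u ∈ ψ.source) : ContDiffAt ℝ ∞ (transition φ ψ) u := by
  rw [← contMDiffAt_iff_contDiffAt]
  exact (contMDiffAt_of_mem_maximalAtlas hψ hx).comp u (contMDiffAt_symm_of_mem_maximalAtlas hφ hu)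

lemma fderiv_transition (hφ : IsChart φ) (hψ : IsChart ψ) (hu : u ∈ φ.target)
    (hx : φ.symm u ∈ ψ.source) : fderiv ℝ (transition φ ψ) u
      = (chartDeriv ψ (φ.symm u)).comp (chartSymmDeriv φ u) := by
  rw [← mfderiv_eq_fderiv]
  exact mfderiv_comp u (hψ.mdifferentiable.mdifferentiableAt hx)
    (hφ.mdifferentiable.mdifferentiableAt_symm hu)

lemma fderiv_transition_chartDeriv (hφ : IsChart φ) (hψ : IsChart ψ) (hu : u ∈ φ.target)
    (hx : φ.symm u ∈ ψ.source) (v : E m) :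
    fderiv ℝ (transition φ ψ) u (chartDeriv φ (φ.symm u) v) = chartDeriv ψ (φ.symm u) v := by
  rw [fderiv_transition hφ hψ hu hx, ContinuousLinearMap.comp_apply]
  have := hφ.chartSymmDeriv_chartDeriv (φ.map_target hu) v
  rw [φ.right_inv hu] at this
  rw [this]

lemma chartSymmDeriv_fderiv_transition (hφ : IsChart φ) (hψ : IsChart ψ) (hu : u ∈ φ.target)
    (hx : φ.symm u ∈ ψ.source) (v : E m) :
    chartSymmDeriv ψ (transition φ ψ u) (fderiv ℝ (transition φ ψ) u v)
      = chartSymmDeriv φ u v := by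
  rw [fderiv_transition hφ hψ hu hx, ContinuousLinearMap.comp_apply, transition]
  exact hψ.chartSymmDeriv_chartDeriv hx _

lemma inChart_eq (P : M → MvPolynomial (Fin m) ℝ) (φ : OpenPartialHomeomorph M (E m)) (u a : E m) :
    inChart P φ u a
      = MvPolynomial.eval (fun i => ⟪a, chartDeriv φ (φ.symm u) (stdVec i)⟫) (P (φ.symm u)) := rfl

lemma inChart_transition (P : M → MvPolynomial (Fin m) ℝ) (hφ : IsChart φ) (hψ : IsChart ψ)
    (hu : u ∈ φ.target) (hx : φ.symm u ∈ ψ.source) (b : E m) :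
    inChart P ψ (transition φ ψ u) b
      = inChart P φ u ((fderiv ℝ (transition φ ψ) u).adjoint b) := by
  rw [inChart_eq, inChart_eq, transition, ψ.left_inv hx]
  congr 1
  congr 1
  funext i
  rw [ContinuousLinearMap.adjoint_inner_left, fderiv_transition_chartDeriv hφ hψ hu hx]

/-- The metric at a point, as a bilinear form on `ℝ^m`. -/
def PseudoMetric.formAt (g : PseudoMetric m M) (x : M) : E m →L[ℝ] E m →L[ℝ] ℝ := g.form x

/-- The metric in a chart as a bilinear form. -/
def PseudoMetric.chartForm (g : PseudoMetric m M) (φ : OpenPartialHomeomorph M (E m)) (u : E m)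
    (v w : E m) : ℝ := g.formAt (φ.symm u) (chartSymmDeriv φ u v) (chartSymmDeriv φ u w)

lemma PseudoMetric.chartForm_eq_sum (g : PseudoMetric m M) (φ : OpenPartialHomeomorph M (E m))
    (u v w : E m) : g.chartForm φ u v w = ∑ i, ∑ j, v i * w j * g.lower φ u i j := by
  let B : E m →ₗ[ℝ] E m →ₗ[ℝ] ℝ := LinearMap.mk₂ ℝ (g.chartForm φ u)
    (fun v₁ v₂ w => by simp [chartForm]) (fun c v w => by simp [chartForm])
    (fun v w₁ w₂ => by simp [chartForm]) (fun c v w => by simp [chartForm])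
  change B v w = _
  conv_lhs => rw [← sum_smul_stdVec v, ← sum_smul_stdVec w]
  simp only [map_sum, map_smul, LinearMap.sum_apply, LinearMap.smul_apply, smul_eq_mul,
    Finset.mul_sum, ← mul_assoc]
  rw [Finset.sum_comm]
  exact Finset.sum_congr rfl fun i _ => Finset.sum_congr rfl fun j _ => by
    rw [mul_comm (w j)]
    rfl

lemma PseudoMetric.isUnit_det_lower (g : PseudoMetric m M) (hφ : IsChart φ) (hu : u ∈ φ.target) :
    IsUnit (g.lower φ u).det := by
  rw [isUnit_iff_ne_zero]
  intro h0
  obtain ⟨v, hv, hv0⟩ := Matrix.exists_mulVec_eq_zero_iff.2 h0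
  apply hv
  set V : E m := WithLp.toLp 2 v with hV
  have h1 : ∀ w : E m, g.formAt (φ.symm u) (chartSymmDeriv φ u V) w = 0 := by
    intro w
    have h2 : chartSymmDeriv φ u (chartDeriv φ (φ.symm u) w) = w := by
      have := hφ.chartSymmDeriv_chartDeriv (φ.map_target hu) w
      rwa [φ.right_inv hu] at this
    have hs : ∀ a b : E m, g.formAt (φ.symm u) a b = g.formAt (φ.symm u) b a := g.symm _
    rw [← h2, hs]
    change g.chartForm φ u _ V = 0
    rw [g.chartForm_eq_sum]
    refine Finset.sum_eq_zero fun i _ => ?_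
    have := congrFun hv0 i
    simp only [Matrix.mulVec, dotProduct, Pi.zero_apply] at this
    calc _ = (chartDeriv φ (φ.symm u) w) i * ∑ j, g.lower φ u i j * v j := by
          rw [Finset.mul_sum]
          exact Finset.sum_congr rfl fun j _ => by simp [hV]; ring
      _ = 0 := by rw [this, mul_zero]
  have h2 := g.nondegenerate _ _ h1
  have h3 : V = 0 := by
    rw [← hφ.chartDeriv_chartSymmDeriv hu V]
    exact (congrArg (chartDeriv φ (φ.symm u)) h2).trans (map_zero _)
  simpa [hV] using h3

lemma PseudoMetric.lower_symm (g : PseudoMetric m M) (φ : OpenPartialHomeomorph M (E m)) (u : E m)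
    (i j : Fin m) : g.lower φ u i j = g.lower φ u j i := g.symm _ _ _

lemma PseudoMetric.lower_transition (g : PseudoMetric m M) (hφ : IsChart φ) (hψ : IsChart ψ)
    (hu : u ∈ φ.target) (hx : φ.symm u ∈ ψ.source) (v w : E m) :
    g.chartForm ψ (transition φ ψ u) (fderiv ℝ (transition φ ψ) u v)
      (fderiv ℝ (transition φ ψ) u w) = g.chartForm φ u v w := by
  have h : ∀ (x y : M) (a b : E m), x = y → g.formAt x a b = g.formAt y a b := by
    rintro x _ a b rfl
    rfl
  rw [chartForm, chartForm, chartSymmDeriv_fderiv_transition hφ hψ hu hx,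
    chartSymmDeriv_fderiv_transition hφ hψ hu hx]
  exact h _ _ _ _ (ψ.left_inv hx)

/-- The Hamiltonian is half the value of a covector on the corresponding vector. -/
lemma PseudoMetric.hamiltonian_eq (g : PseudoMetric m M) (hφ : IsChart φ) (hu : u ∈ φ.target)
    {a v : E m} (hv : ∀ w, g.chartForm φ u v w = ⟪a, w⟫) : g.hamiltonian φ u a = 1 / 2 * ⟪a, v⟫ := by
  have ha : ∀ j, a j = ∑ k, g.lower φ u j k * v k := by
    intro j
    have := hv (stdVec j)
    rw [g.chartForm_eq_sum] at this
    simp only [stdVec, EuclideanSpace.inner_single_right, PiLp.single_apply] at this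
    simp only [mul_ite, mul_one, mul_zero, ite_mul, zero_mul, Finset.sum_ite_eq',
      Finset.mem_univ, if_true, one_mul] at this
    simp only [conj_trivial] at this
    rw [← this]
    exact Finset.sum_congr rfl fun k _ => by rw [g.lower_symm φ u j k, mul_comm]
  have hinv : g.upper φ u * g.lower φ u = 1 := Matrix.nonsing_inv_mul _ (g.isUnit_det_lower hφ hu)
  have hua : ∀ i, ∑ j, g.upper φ u i j * a j = v i := by
    intro i
    have h1 := congrArg (fun A : Matrix (Fin m) (Fin m) ℝ => A.mulVec (v : Fin m → ℝ) i) hinv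
    simp only [← Matrix.mulVec_mulVec, Matrix.one_mulVec] at h1
    rw [← h1]
    simp only [Matrix.mulVec, dotProduct, ha]
  rw [hamiltonian]
  congr 1
  rw [PiLp.inner_apply]
  refine Finset.sum_congr rfl fun i _ => ?_
  rw [← hua i]
  simp only [RCLike.inner_apply, conj_trivial, Finset.sum_mul]
  exact Finset.sum_congr rfl fun j _ => by ring

/-- The vector that corresponds to a covector under the metric, in a chart. -/
def PseudoMetric.sharp (g : PseudoMetric m M) (φ : OpenPartialHomeomorph M (E m)) (u : E m)
    (a : E m) : E m := WithLp.toLp 2 fun i => ∑ j, g.upper φ u i j * a j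

lemma PseudoMetric.chartForm_sharp (g : PseudoMetric m M) (hφ : IsChart φ) (hu : u ∈ φ.target)
    (a w : E m) : g.chartForm φ u (g.sharp φ u a) w = ⟪a, w⟫ := by
  have hinv : g.lower φ u * g.upper φ u = 1 := Matrix.mul_nonsing_inv _ (g.isUnit_det_lower hφ hu)
  have h1 : ∀ j, ∑ i, g.lower φ u j i * (g.sharp φ u a) i = a j := by
    intro j
    have h1 := congrArg (fun A : Matrix (Fin m) (Fin m) ℝ => A.mulVec (a : Fin m → ℝ) j) hinv
    simp only [← Matrix.mulVec_mulVec, Matrix.one_mulVec] at h1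
    rw [← h1]
    simp only [Matrix.mulVec, dotProduct, sharp]
  rw [g.chartForm_eq_sum, Finset.sum_comm, PiLp.inner_apply]
  refine Finset.sum_congr rfl fun j _ => ?_
  rw [← h1 j]
  simp only [RCLike.inner_apply, conj_trivial, Finset.mul_sum]
  exact Finset.sum_congr rfl fun i _ => by rw [g.lower_symm φ u i j]; ring

/-- The vector dual to the pulled-back covector is pushed forward to the vector dual to b. With
`hamiltonian_eq` this gives the invariance of H without transforming the inverse matrix. -/
lemma PseudoMetric.sharp_transition (g : PseudoMetric m M) (hφ : IsChart φ) (hψ : IsChart ψ)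
    (hu : u ∈ φ.target) (hx : φ.symm u ∈ ψ.source) (b w : E m) :
    g.chartForm ψ (transition φ ψ u) (fderiv ℝ (transition φ ψ) u
      (g.sharp φ u ((fderiv ℝ (transition φ ψ) u).adjoint b))) w = ⟪b, w⟫ := by
  have hw : w = fderiv ℝ (transition φ ψ) u (chartDeriv φ (φ.symm u)
      (chartSymmDeriv ψ (transition φ ψ u) w)) := by
    rw [fderiv_transition_chartDeriv hφ hψ hu hx]
    have := hψ.chartDeriv_chartSymmDeriv (ψ.map_source hx) w
    rw [ψ.left_inv hx] at this
    exact this.symm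
  rw [hw, g.lower_transition hφ hψ hu hx, g.chartForm_sharp hφ hu,
    ContinuousLinearMap.adjoint_inner_left]

lemma PseudoMetric.hamiltonian_transition (g : PseudoMetric m M) (hφ : IsChart φ) (hψ : IsChart ψ)
    (hu : u ∈ φ.target) (hx : φ.symm u ∈ ψ.source) (b : E m) :
    g.hamiltonian ψ (transition φ ψ u) b
      = g.hamiltonian φ u ((fderiv ℝ (transition φ ψ) u).adjoint b) := by
  rw [g.hamiltonian_eq (u := transition φ ψ u) hψ (ψ.map_source hx) (g.sharp_transition hφ hψ hu hx b),
    g.hamiltonian_eq hφ hu (g.chartForm_sharp hφ hu _), ContinuousLinearMap.adjoint_inner_left]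

lemma contDiffOn_det {n : ℕ} {X : Type*} [NormedAddCommGroup X] [NormedSpace ℝ X] {s : Set X}
    {A : X → Matrix (Fin n) (Fin n) ℝ} (hA : ∀ i j, ContDiffOn ℝ ∞ (fun x => A x i j) s) :
    ContDiffOn ℝ ∞ (fun x => (A x).det) s := by
  simp only [Matrix.det_apply]
  refine ContDiffOn.sum fun σ _ => ContDiffOn.const_smul _ ?_
  exact contDiffOn_prod fun i _ => hA _ _

lemma contDiffOn_inv {n : ℕ} {X : Type*} [NormedAddCommGroup X] [NormedSpace ℝ X] {s : Set X}
    {A : X → Matrix (Fin n) (Fin n) ℝ} (hA : ∀ i j, ContDiffOn ℝ ∞ (fun x => A x i j) s)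
    (hdet : ∀ x ∈ s, IsUnit (A x).det) (i j : Fin n) : ContDiffOn ℝ ∞ (fun x => (A x)⁻¹ i j) s := by
  have h1 : ContDiffOn ℝ ∞ (fun x => (A x).det⁻¹ * (A x).adjugate i j) s := by
    refine ((contDiffOn_det hA).inv fun x hx => (hdet x hx).ne_zero).mul ?_
    simp only [Matrix.adjugate_apply]
    refine contDiffOn_det fun k l => ?_
    simp only [Matrix.updateRow_apply]
    split_ifs
    · exact contDiffOn_const
    · exact hA k l
  exact h1.congr fun x hx => by simp [Matrix.inv_def]

lemma PseudoMetric.contDiffOn_upper (g : PseudoMetric m M) (hφ : IsChart φ) (i j : Fin m) :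
    ContDiffOn ℝ ∞ (fun u => g.upper φ u i j) φ.target :=
  contDiffOn_inv (g.smooth φ hφ) (fun _ hu => g.isUnit_det_lower hφ hu) i j

lemma contDiff_coord (i : Fin m) : ContDiff ℝ ∞ fun x : E m => x i :=
  (EuclideanSpace.proj i : E m →L[ℝ] ℝ).contDiff

lemma PseudoMetric.contDiffOn_hamiltonian (g : PseudoMetric m M) (hφ : IsChart φ) :
    ContDiffOn ℝ ∞ (fun z : E m × E m => g.hamiltonian φ z.1 z.2) (φ.target ×ˢ univ) := by
  unfold hamiltonian
  refine contDiffOn_const.mul (ContDiffOn.sum fun i _ => ContDiffOn.sum fun j _ => ?_)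
  refine (((g.contDiffOn_upper hφ i j).comp contDiffOn_fst fun z hz => hz.1).mul ?_).mul ?_
  · exact ((contDiff_coord i).comp contDiff_snd).contDiffOn
  · exact ((contDiff_coord j).comp contDiff_snd).contDiffOn

lemma PseudoMetric.contDiffAt_hamiltonian (g : PseudoMetric m M) (hφ : IsChart φ)
    (hu : u ∈ φ.target) (a : E m) :
    ContDiffAt ℝ ∞ (fun z : E m × E m => g.hamiltonian φ z.1 z.2) (u, a) :=
  (g.contDiffOn_hamiltonian hφ).contDiffAt
    ((φ.open_target.prod isOpen_univ).mem_nhds ⟨hu, mem_univ _⟩)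

lemma eventually_mem_transition_source (hu : u ∈ φ.target) (hx : φ.symm u ∈ ψ.source) :
    ∀ᶠ y in 𝓝 u, y ∈ φ.target ∧ φ.symm y ∈ ψ.source :=
  Filter.Eventually.and (φ.open_target.mem_nhds hu)
    ((φ.continuousAt_symm hu).eventually (ψ.open_source.mem_nhds hx))

/-- Smoothness of a momentum polynomial can be checked in one chart. -/
lemma contDiffAt_inChart_transition {P : M → MvPolynomial (Fin m) ℝ} (hφ : IsChart φ)
    (hψ : IsChart ψ) (hu : u ∈ φ.target) (hx : φ.symm u ∈ ψ.source)
    (h : ∀ a, ContDiffAt ℝ ∞ (fun z : E m × E m => inChart P ψ z.1 z.2) (transition φ ψ u, a))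
    (a : E m) : ContDiffAt ℝ ∞ (fun z : E m × E m => inChart P φ z.1 z.2) (u, a) := by
  have hxφ : ∀ y ∈ φ.target, φ.symm y ∈ ψ.source →
      transition φ ψ y ∈ ψ.target ∧ ψ.symm (transition φ ψ y) ∈ φ.source ∧
        transition ψ φ (transition φ ψ y) = y := by
    intro y hy hyx
    refine ⟨ψ.map_source hyx, ?_, ?_⟩
    · rw [transition, ψ.left_inv hyx]
      exact φ.map_target hy
    · rw [transition, transition, ψ.left_inv hyx, φ.right_inv hy]
  -- Near u the expression in φ is the one in ψ composed with the cotangent lift, whose momentum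
  -- part uses the inverse transition.
  have hev : (fun z : E m × E m => inChart P φ z.1 z.2) =ᶠ[𝓝 (u, a)]
      (fun z : E m × E m => inChart P ψ z.1 z.2) ∘ fun z => (transition φ ψ z.1,
        coPull z.2 (fderiv ℝ (transition ψ φ) (transition φ ψ z.1))) := by
    have h1 := continuous_fst.continuousAt.eventually
      (eventually_mem_transition_source (φ := φ) (ψ := ψ) hu hx : ∀ᶠ y in 𝓝 (u, a).1, _)
    filter_upwards [h1] with z hz
    obtain ⟨h2, h3, h4⟩ := hxφ z.1 hz.1 hz.2
    simp only [Function.comp_apply]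
    rw [coPull_eq, ← inChart_transition P hψ hφ h2 h3, h4]
  refine ContDiffAt.congr_of_eventuallyEq ?_ hev
  obtain ⟨h2, h3, h4⟩ := hxφ u hu hx
  have hτ : ContDiffAt ℝ ∞ (fun z : E m × E m => transition φ ψ z.1) (u, a) :=
    ContDiffAt.comp (g := transition φ ψ) (u, a) (contDiffAt_transition hφ hψ hu hx) contDiffAt_fst
  have hd : ContDiffAt ℝ ∞
      (fun z : E m × E m => fderiv ℝ (transition ψ φ) (transition φ ψ z.1)) (u, a) :=
    ContDiffAt.comp (g := fderiv ℝ (transition ψ φ)) (u, a)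
      ((contDiffAt_transition hψ hφ h2 h3).fderiv_right (m := ∞) (by simp)) hτ
  have hc : ContDiffAt ℝ ∞ (fun z : E m × E m => coPull z.2
      (fderiv ℝ (transition ψ φ) (transition φ ψ z.1))) (u, a) := by
    rw [contDiffAt_euclidean]
    intro j
    exact contDiffAt_snd.inner ℝ (hd.clm_apply contDiffAt_const)
  exact ContDiffAt.comp (u, a) (h _) (hτ.prodMk hc)

/-- The bracket with the Hamiltonian can be computed in any chart. -/
lemma poisson_transition (g : PseudoMetric m M) {P : M → MvPolynomial (Fin m) ℝ} (hφ : IsChart φ)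
    (hψ : IsChart ψ) (hu : u ∈ φ.target) (hx : φ.symm u ∈ ψ.source)
    (h : ∀ a, ContDiffAt ℝ ∞ (fun z : E m × E m => inChart P ψ z.1 z.2) (transition φ ψ u, a))
    (b : E m) :
    poisson (g.hamiltonian ψ) (inChart P ψ) (transition φ ψ u) b
      = poisson (g.hamiltonian φ) (inChart P φ) u ((fderiv ℝ (transition φ ψ) u).adjoint b) := by
  have hy : ∀ {F : E m → E m → ℝ} {y a : E m},
      ContDiffAt ℝ ∞ (fun z : E m × E m => F z.1 z.2) (y, a) →
      DifferentiableAt ℝ (fun y => F y a) y := fun {F y a} h =>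
    DifferentiableAt.comp (g := fun z : E m × E m => F z.1 z.2) (f := fun y => (y, a)) y
      (h.differentiableAt (by simp)) (by fun_prop)
  have hev := eventually_mem_transition_source (φ := φ) (ψ := ψ) hu hx
  refine poisson_cotangentLift ((contDiffAt_transition hφ hψ hu hx).of_le (by decide)) ?_ ?_ b
    ((contDiffAt_inChart_transition hφ hψ hu hx h _).differentiableAt (by simp))
    ((g.contDiffAt_hamiltonian hφ hu _).differentiableAt (by simp)) (hy (h b))
    (hy (g.contDiffAt_hamiltonian hψ (ψ.map_source hx) b))
  · filter_upwards [hev] with y hy b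
    exact inChart_transition P hφ hψ hy.1 hy.2 b
  · filter_upwards [hev] with y hy b
    exact g.hamiltonian_transition hφ hψ hy.1 hy.2 b

end Charts

/-! ### Christoffel symbols and metric compatibility. -/

section Christoffel

variable {m : ℕ} {M : Type*} [TopologicalSpace M] [ChartedSpace (E m) M]
  {φ : OpenPartialHomeomorph M (E m)} {u : E m}

namespace PseudoMetric

variable (g : PseudoMetric m M)

lemma pd_lower_symm (φ : OpenPartialHomeomorph M (E m)) (u : E m) (l i j : Fin m) :
    pd l (fun y => g.lower φ y i j) u = pd l (fun y => g.lower φ y j i) u := by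
  simp_rw [g.lower_symm φ _ i j]

lemma christoffel_symm (φ : OpenPartialHomeomorph M (E m)) (k i j : Fin m) :
    g.christoffel φ k i j = g.christoffel φ k j i := by
  funext u
  unfold christoffel
  congr 1
  refine Finset.sum_congr rfl fun l _ => ?_
  rw [g.pd_lower_symm φ u l i j]
  ring

lemma sum_lower_christoffel (hφ : IsChart φ) (hu : u ∈ φ.target) (l i j : Fin m) :
    ∑ k, g.lower φ u l k * g.christoffel φ k i j u
      = 1 / 2 * (pd i (fun y => g.lower φ y j l) u + pd j (fun y => g.lower φ y i l) u
        - pd l (fun y => g.lower φ y i j) u) := by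
  have hinv : g.lower φ u * g.upper φ u = 1 := Matrix.mul_nonsing_inv _ (g.isUnit_det_lower hφ hu)
  set t : Fin m → ℝ := fun l => pd i (fun y => g.lower φ y j l) u
    + pd j (fun y => g.lower φ y i l) u - pd l (fun y => g.lower φ y i j) u with ht
  have h1 := congrArg (fun A : Matrix (Fin m) (Fin m) ℝ => A.mulVec t l) hinv
  simp only [← Matrix.mulVec_mulVec, Matrix.one_mulVec] at h1
  change _ = 1 / 2 * t l
  rw [← h1]
  simp only [Matrix.mulVec, dotProduct, christoffel, Finset.mul_sum]
  exact Finset.sum_congr rfl fun k _ => Finset.sum_congr rfl fun n _ => by simp only [ht]; ring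

/-- This is ∇g = 0 in coordinates. -/
lemma pd_lower (hφ : IsChart φ) (hu : u ∈ φ.target) (a i b : Fin m) :
    pd a (fun y => g.lower φ y i b) u
      = ∑ k, g.lower φ u b k * g.christoffel φ k a i u
        + ∑ k, g.lower φ u i k * g.christoffel φ k a b u := by
  rw [g.sum_lower_christoffel hφ hu, g.sum_lower_christoffel hφ hu, g.pd_lower_symm φ u a b i]
  ring

lemma contDiffOn_christoffel (hφ : IsChart φ) (k i j : Fin m) :
    ContDiffOn ℝ ∞ (g.christoffel φ k i j) φ.target := by
  have hpd : ∀ l a b : Fin m, ContDiffOn ℝ ∞ (pd l (fun y => g.lower φ y a b)) φ.target := by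
    intro l a b
    have h1 : ContDiffOn ℝ ∞ (fderiv ℝ (fun y => g.lower φ y a b)) φ.target :=
      (g.smooth φ hφ a b).fderiv_of_isOpen φ.open_target (by simp)
    exact h1.clm_apply contDiffOn_const
  unfold christoffel
  refine contDiffOn_const.mul (ContDiffOn.sum fun l _ => ?_)
  exact (g.contDiffOn_upper hφ k l).mul (((hpd _ _ _).add (hpd _ _ _)).sub (hpd _ _ _))

end PseudoMetric

end Christoffel

/-! ### The flat connection behind Hess f = -κ f g. -/

section Connection

variable {m : ℕ} {M : Type*} [TopologicalSpace M] [ChartedSpace (E m) M]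
  {φ : OpenPartialHomeomorph M (E m)} {u : E m}

/-- The map `v ↦ p ↦ L v • N p • w`. -/
def rankOne (L : E m →L[ℝ] ℝ) (N : ℝ × E m →L[ℝ] ℝ) (w : ℝ × E m) :
    E m →L[ℝ] (ℝ × E m) →L[ℝ] (ℝ × E m) := L.smulRight (N.smulRight w)

@[simp] lemma rankOne_apply (L : E m →L[ℝ] ℝ) (N : ℝ × E m →L[ℝ] ℝ) (w : ℝ × E m) (v : E m)
    (p : ℝ × E m) : rankOne L N w v p = L v • N p • w := rfl

/-- The `i`-th coordinate of the second component. -/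
def sndCoord (i : Fin m) : ℝ × E m →L[ℝ] ℝ :=
  (EuclideanSpace.proj i : E m →L[ℝ] ℝ).comp (ContinuousLinearMap.snd ℝ ℝ (E m))

@[simp] lemma sndCoord_apply (i : Fin m) (p : ℝ × E m) : sndCoord i p = p.2 i := rfl

namespace PseudoMetric

variable (g : PseudoMetric m M)

/-- The linear system `∂_j f = ω_j`, `∂_j ω_i = Γ^k_ij ω_k - κ g_ij f`. -/
def hessConnection (κ : ℝ) (φ : OpenPartialHomeomorph M (E m)) (u : E m) :
    E m →L[ℝ] (ℝ × E m) →L[ℝ] (ℝ × E m) :=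
  ∑ j, rankOne (EuclideanSpace.proj j) (sndCoord j) (1, 0)
    + ∑ i, ∑ j, (∑ k, g.christoffel φ k i j u •
        rankOne (EuclideanSpace.proj j) (sndCoord k) (0, stdVec i)
      - (κ * g.lower φ u i j) •
        rankOne (EuclideanSpace.proj j) (ContinuousLinearMap.fst ℝ ℝ (E m)) (0, stdVec i))

lemma stdVec_apply (i j : Fin m) : (stdVec i : E m) j = if j = i then 1 else 0 := by
  simp [stdVec, PiLp.single_apply]

set_option maxSynthPendingDepth 10 in
lemma hessConnection_apply (κ : ℝ) (φ : OpenPartialHomeomorph M (E m)) (u v : E m) (p : ℝ × E m) :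
    g.hessConnection κ φ u v p = (∑ j, v j * p.2 j, WithLp.toLp 2 fun i =>
      ∑ j, v j * (∑ k, g.christoffel φ k i j u * p.2 k - κ * g.lower φ u i j * p.1)) := by
  ext i
  · simp [hessConnection, Prod.fst_sum]
  · simp only [hessConnection, add_apply, sum_apply, rankOne_apply, sndCoord_apply,
      Prod.snd_add, Prod.snd_sum, Prod.snd_sub, Prod.smul_snd, sub_apply, smul_apply]
    simp [stdVec_apply, mul_sub, Finset.mul_sum, Finset.sum_sub_distrib, mul_left_comm]

set_option maxSynthPendingDepth 10 in
lemma contDiffOn_hessConnection (κ : ℝ) (hφ : IsChart φ) :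
    ContDiffOn ℝ ∞ (g.hessConnection κ φ) φ.target := by
  unfold hessConnection
  refine contDiffOn_const.add (ContDiffOn.sum fun i _ => ContDiffOn.sum fun j _ => ContDiffOn.sub
    (ContDiffOn.sum fun k _ => (g.contDiffOn_christoffel hφ k i j).smul contDiffOn_const) ?_)
  exact (contDiffOn_const.mul (g.smooth φ hφ i j)).smul contDiffOn_const

set_option maxSynthPendingDepth 10 in
lemma apply_fderiv_bilinear {X W : Type*} [NormedAddCommGroup X] [NormedSpace ℝ X]
    [NormedAddCommGroup W] [NormedSpace ℝ W] {𝒜 : X → X →L[ℝ] W →L[ℝ] W} {u : X}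
    (h : DifferentiableAt ℝ 𝒜 u) (v w : X) (p : W) (ℓ : W →L[ℝ] ℝ) :
    ℓ (fderiv ℝ 𝒜 u v w p) = fderiv ℝ (fun u => ℓ (𝒜 u w p)) u v := by
  have h1 : HasFDerivAt (fun u => 𝒜 u w) _ u := h.hasFDerivAt.clm_apply (hasFDerivAt_const w u)
  have h2 : HasFDerivAt (fun u => 𝒜 u w p) _ u := h1.clm_apply (hasFDerivAt_const p u)
  have h3 : HasFDerivAt (fun u => ℓ (𝒜 u w p)) _ u := ℓ.hasFDerivAt.comp u h2
  rw [h3.fderiv]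
  simp

-- The integrability conditions of the prolonged system. The f-component is symmetric since Γ and g
-- are. In the ω-component the terms in f cancel by ∇g = 0, and the terms in ω are the curvature
-- minus its constant-curvature value.
set_option maxSynthPendingDepth 10 in
lemma hessConnection_flat {κ : ℝ} (hφ : IsChart φ) (hu : u ∈ φ.target)
    (hκ : ∀ l k i j : Fin m, g.curvature φ l k i j u =
      κ * (g.lower φ u j k * (if l = i then 1 else 0) - g.lower φ u i k * (if l = j then 1 else 0)))
    (v w : E m) :
    fderiv ℝ (g.hessConnection κ φ) u v w
        + (g.hessConnection κ φ u w).comp (g.hessConnection κ φ u v)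
      = fderiv ℝ (g.hessConnection κ φ) u w v
        + (g.hessConnection κ φ u v).comp (g.hessConnection κ φ u w) := by
  set 𝒜 := g.hessConnection κ φ with h𝒜
  let B : E m →ₗ[ℝ] E m →ₗ[ℝ] (ℝ × E m →L[ℝ] ℝ × E m) :=
    LinearMap.mk₂ ℝ (fun v w => fderiv ℝ 𝒜 u v w + (𝒜 u w).comp (𝒜 u v))
      (fun v₁ v₂ w => by simp only [map_add, add_apply, ContinuousLinearMap.comp_add]; abel)
      (fun c v w => by simp only [map_smul, smul_apply, ContinuousLinearMap.comp_smul, smul_add])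
      (fun v w₁ w₂ => by simp only [map_add, ContinuousLinearMap.add_comp]; abel)
      (fun c v w => by simp only [map_smul, ContinuousLinearMap.smul_comp, smul_add])
  suffices hB : B = B.flip from congrArg (fun B => B v w) hB
  refine LinearMap.ext_basis (EuclideanSpace.basisFun (Fin m) ℝ).toBasis
    (EuclideanSpace.basisFun (Fin m) ℝ).toBasis fun a b => ?_
  simp only [OrthonormalBasis.coe_toBasis, EuclideanSpace.basisFun_apply]
  change B (stdVec a) (stdVec b) = B (stdVec b) (stdVec a)
  refine ContinuousLinearMap.ext fun p => ?_
  have hdiff : DifferentiableAt ℝ 𝒜 u :=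
    ((g.contDiffOn_hessConnection κ hφ).contDiffAt (φ.open_target.mem_nhds hu)).differentiableAt
      (by simp)
  have hG : ∀ i j, DifferentiableAt ℝ (fun u => g.lower φ u i j) u := fun i j =>
    ((g.smooth φ hφ i j).contDiffAt (φ.open_target.mem_nhds hu)).differentiableAt (by simp)
  have hΓ : ∀ k i j, DifferentiableAt ℝ (g.christoffel φ k i j) u := fun k i j =>
    ((g.contDiffOn_christoffel hφ k i j).contDiffAt (φ.open_target.mem_nhds hu)).differentiableAt
      (by simp)
  have hbasis : ∀ u b, 𝒜 u (stdVec b) p = (p.2 b, WithLp.toLp 2 fun i =>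
      (∑ k, g.christoffel φ k i b u * p.2 k - κ * g.lower φ u i b * p.1)) := by
    intro u b
    rw [h𝒜, hessConnection_apply]
    simp [stdVec_apply]
  have hd : ∀ a b, fderiv ℝ 𝒜 u (stdVec a) (stdVec b) p = (0, WithLp.toLp 2 fun i =>
      (∑ k, pd a (g.christoffel φ k i b) u * p.2 k
        - κ * pd a (fun u => g.lower φ u i b) u * p.1)) := by
    intro a b
    ext i
    · change ContinuousLinearMap.fst ℝ ℝ (E m) _ = 0
      rw [apply_fderiv_bilinear hdiff]
      simp only [hbasis, ContinuousLinearMap.coe_fst']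
      simp
    · change sndCoord i _ = _
      rw [apply_fderiv_bilinear hdiff]
      simp only [hbasis, sndCoord_apply]
      have h1 : HasFDerivAt (fun u => ∑ k, g.christoffel φ k i b u * p.2 k
          - κ * g.lower φ u i b * p.1) _ u :=
        (HasFDerivAt.fun_sum fun k _ => (hΓ k i b).hasFDerivAt.mul_const (p.2 k)).sub
          (((hG i b).hasFDerivAt.const_mul κ).mul_const p.1)
      rw [h1.fderiv]
      simp [pd, mul_comm]
  change fderiv ℝ 𝒜 u (stdVec a) (stdVec b) p + 𝒜 u (stdVec b) (𝒜 u (stdVec a) p)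
    = fderiv ℝ 𝒜 u (stdVec b) (stdVec a) p + 𝒜 u (stdVec a) (𝒜 u (stdVec b) p)
  rw [hd, hd]
  ext i
  · rw [hbasis, hbasis, h𝒜, hessConnection_apply, hessConnection_apply]
    simp [stdVec_apply, g.christoffel_symm φ _ a b, g.lower_symm φ _ a b]
  · rw [hbasis, hbasis, h𝒜, hessConnection_apply, hessConnection_apply]
    simp [stdVec_apply]
    -- The Codazzi identity ∇_a g_ib = ∇_b g_ia, which is the coefficient of f.
    have hf : pd a (fun u => g.lower φ u i b) u + ∑ x, g.christoffel φ x i b u * g.lower φ u x a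
        = pd b (fun u => g.lower φ u i a) u + ∑ x, g.christoffel φ x i a u * g.lower φ u x b := by
      rw [g.pd_lower hφ hu a i b, g.pd_lower hφ hu b i a]
      simp only [g.christoffel_symm φ _ b a, g.christoffel_symm φ _ b i, g.christoffel_symm φ _ a i,
        g.lower_symm φ u _ a, g.lower_symm φ u _ b, mul_comm]
      ring
    -- Constant curvature enters only here.
    have hω : ∑ n, g.curvature φ n i a b u * p.2 n
        = κ * (g.lower φ u i b * p.2 a - g.lower φ u i a * p.2 b) := by
      simp only [hκ, g.lower_symm φ u b i, g.lower_symm φ u a i]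
      simp [mul_sub, sub_mul, Finset.sum_sub_distrib, mul_assoc]
    have hexp : ∑ n, g.curvature φ n i a b u * p.2 n
        = (∑ x, pd a (g.christoffel φ x i b) u * p.2 x - ∑ x, pd b (g.christoffel φ x i a) u * p.2 x)
          + (∑ x, ∑ n, g.christoffel φ x i b u * (g.christoffel φ n x a u * p.2 n)
            - ∑ x, ∑ n, g.christoffel φ x i a u * (g.christoffel φ n x b u * p.2 n)) := by
      rw [Finset.sum_comm, Finset.sum_comm (s := Finset.univ) (t := Finset.univ)
        (f := fun x n => g.christoffel φ x i a u * (g.christoffel φ n x b u * p.2 n)),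
        ← Finset.sum_sub_distrib, ← Finset.sum_sub_distrib, ← Finset.sum_add_distrib]
      refine Finset.sum_congr rfl fun n _ => ?_
      rw [curvature, g.christoffel_symm φ _ b i, g.christoffel_symm φ _ a i,
        ← Finset.sum_sub_distrib, add_mul, sub_mul, Finset.sum_mul]
      congr 1
      refine Finset.sum_congr rfl fun x _ => ?_
      rw [g.christoffel_symm φ n a x, g.christoffel_symm φ n b x, g.christoffel_symm φ x b i,
        g.christoffel_symm φ x a i]
      ring
    have hsplit : ∀ a b, ∑ x, g.christoffel φ x i b u *
          (∑ n, g.christoffel φ n x a u * p.2 n - κ * g.lower φ u x a * p.1)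
        = ∑ x, ∑ n, g.christoffel φ x i b u * (g.christoffel φ n x a u * p.2 n)
          - κ * p.1 * ∑ x, g.christoffel φ x i b u * g.lower φ u x a := by
      intro a b
      simp only [mul_sub, Finset.sum_sub_distrib, Finset.mul_sum]
      congr 1
      exact Finset.sum_congr rfl fun x _ => by ring
    rw [hsplit, hsplit]
    linear_combination hω - hexp - κ * p.1 * hf

end PseudoMetric

end Connection

/-! ### Hessian solutions and their second derivative along geodesics. -/

section Flat

variable {m : ℕ} {M : Type*} [TopologicalSpace M] [ChartedSpace (E m) M]
  {φ : OpenPartialHomeomorph M (E m)} {u : E m}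

open scoped RealInnerProductSpace

/-- The endomorphism of `ℝ^m` with the given matrix. -/
def matrixCLM (A : Matrix (Fin m) (Fin m) ℝ) : E m →L[ℝ] E m :=
  ∑ i, ∑ j, A i j • (EuclideanSpace.proj j : E m →L[ℝ] ℝ).smulRight (stdVec i)

lemma matrixCLM_apply (A : Matrix (Fin m) (Fin m) ℝ) (v : E m) (i : Fin m) :
    matrixCLM A v i = ∑ j, A i j * v j := by
  have h : ∀ k : Fin m, (stdVec k : E m) i = if i = k then 1 else 0 := fun k => by
    simp [stdVec, PiLp.single_apply]
  simp [matrixCLM, h]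

lemma matrixCLM_mul (A B : Matrix (Fin m) (Fin m) ℝ) (v : E m) :
    matrixCLM (A * B) v = matrixCLM A (matrixCLM B v) := by
  ext i
  have := congrFun (Matrix.mulVec_mulVec (v : Fin m → ℝ) A B) i
  simp only [Matrix.mulVec, dotProduct] at this
  simp only [matrixCLM_apply, this]

lemma matrixCLM_one (v : E m) : matrixCLM (1 : Matrix (Fin m) (Fin m) ℝ) v = v := by
  ext i
  simp [matrixCLM_apply, Matrix.one_apply]

lemma inner_matrixCLM (A : Matrix (Fin m) (Fin m) ℝ) (v w : E m) :
    ⟪matrixCLM A v, w⟫ = ∑ i, ∑ j, v j * w i * A i j := by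
  simp only [PiLp.inner_apply, RCLike.inner_apply, conj_trivial, matrixCLM_apply, Finset.mul_sum]
  exact Finset.sum_congr rfl fun i _ => Finset.sum_congr rfl fun j _ => by ring

lemma inner_matrixCLM_comm {A : Matrix (Fin m) (Fin m) ℝ} (hA : ∀ i j, A i j = A j i) (v w : E m) :
    ⟪matrixCLM A v, w⟫ = ⟪v, matrixCLM A w⟫ := by
  rw [real_inner_comm (matrixCLM A w) v, inner_matrixCLM, inner_matrixCLM, Finset.sum_comm]
  exact Finset.sum_congr rfl fun i _ => Finset.sum_congr rfl fun j _ => by rw [hA i j]; ring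

lemma contDiffOn_matrixCLM {A : E m → Matrix (Fin m) (Fin m) ℝ} {s : Set (E m)}
    (hA : ∀ i j, ContDiffOn ℝ ∞ (fun u => A u i j) s) :
    ContDiffOn ℝ ∞ (fun u => matrixCLM (A u)) s :=
  ContDiffOn.sum fun i _ => ContDiffOn.sum fun j _ => (hA i j).smul contDiffOn_const

lemma inner_fderiv_matrixCLM {A : E m → Matrix (Fin m) (Fin m) ℝ}
    (hA : ∀ i j, DifferentiableAt ℝ (fun u => A u i j) u) (v x y : E m) :
    ⟪fderiv ℝ (fun u => matrixCLM (A u)) u v x, y⟫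
      = ∑ i, ∑ j, x j * y i * fderiv ℝ (fun u => A u i j) u v := by
  have h1 : HasFDerivAt (fun u => matrixCLM (A u)) _ u :=
    HasFDerivAt.fun_sum fun i (_ : i ∈ Finset.univ) => HasFDerivAt.fun_sum
      fun j (_ : j ∈ Finset.univ) => (hA i j).hasFDerivAt.smul_const
        ((EuclideanSpace.proj j : E m →L[ℝ] ℝ).smulRight (stdVec i))
  have h2 : fderiv ℝ (fun u => matrixCLM (A u)) u v
      = matrixCLM (Matrix.of fun i j => fderiv ℝ (fun u => A u i j) u v) := by
    rw [h1.fderiv]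
    simp [matrixCLM]
  rw [h2, inner_matrixCLM]
  rfl

namespace PseudoMetric

variable (g : PseudoMetric m M)

/-- The covector that corresponds to a vector under the metric, in a chart. -/
def flatL (φ : OpenPartialHomeomorph M (E m)) (u : E m) : E m →L[ℝ] E m := matrixCLM (g.lower φ u)

/-- The vector that corresponds to a covector under the metric, in a chart. -/
def sharpL (φ : OpenPartialHomeomorph M (E m)) (u : E m) : E m →L[ℝ] E m := matrixCLM (g.upper φ u)

lemma flatL_sharpL (hφ : IsChart φ) (hu : u ∈ φ.target) (a : E m) :
    g.flatL φ u (g.sharpL φ u a) = a := by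
  rw [flatL, sharpL, ← matrixCLM_mul, upper, Matrix.mul_nonsing_inv _ (g.isUnit_det_lower hφ hu),
    matrixCLM_one]

lemma sharpL_flatL (hφ : IsChart φ) (hu : u ∈ φ.target) (a : E m) :
    g.sharpL φ u (g.flatL φ u a) = a := by
  rw [flatL, sharpL, ← matrixCLM_mul, upper, Matrix.nonsing_inv_mul _ (g.isUnit_det_lower hφ hu),
    matrixCLM_one]

lemma inner_flatL_comm (φ : OpenPartialHomeomorph M (E m)) (u v w : E m) :
    ⟪g.flatL φ u v, w⟫ = ⟪v, g.flatL φ u w⟫ := inner_matrixCLM_comm (g.lower_symm φ u) v w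

lemma inner_sharpL_comm (hφ : IsChart φ) (hu : u ∈ φ.target) (a b : E m) :
    ⟪g.sharpL φ u a, b⟫ = ⟪a, g.sharpL φ u b⟫ := by
  conv_lhs => rw [← g.flatL_sharpL hφ hu b]
  rw [← inner_flatL_comm, g.flatL_sharpL hφ hu]

lemma contDiffOn_flatL (hφ : IsChart φ) : ContDiffOn ℝ ∞ (g.flatL φ) φ.target :=
  contDiffOn_matrixCLM (g.smooth φ hφ)

lemma contDiffOn_sharpL (hφ : IsChart φ) : ContDiffOn ℝ ∞ (g.sharpL φ) φ.target :=
  contDiffOn_matrixCLM (g.contDiffOn_upper hφ)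

lemma hasFDerivAt_flatL (hφ : IsChart φ) (hu : u ∈ φ.target) :
    HasFDerivAt (g.flatL φ) (fderiv ℝ (g.flatL φ) u) u :=
  (((g.contDiffOn_flatL hφ).contDiffAt (φ.open_target.mem_nhds hu)).differentiableAt
    (by simp)).hasFDerivAt

lemma hasFDerivAt_sharpL (hφ : IsChart φ) (hu : u ∈ φ.target) :
    HasFDerivAt (g.sharpL φ) (fderiv ℝ (g.sharpL φ) u) u :=
  (((g.contDiffOn_sharpL hφ).contDiffAt (φ.open_target.mem_nhds hu)).differentiableAt
    (by simp)).hasFDerivAt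

/-- Differentiate g g⁻¹ = 1. Position derivatives of H and of {H, y} can then be written with dg
alone. -/
lemma fderiv_sharpL_apply (hφ : IsChart φ) (hu : u ∈ φ.target) (v a : E m) :
    fderiv ℝ (g.sharpL φ) u v a
      = -g.sharpL φ u (fderiv ℝ (g.flatL φ) u v (g.sharpL φ u a)) := by
  have h1 : HasFDerivAt (fun u => g.flatL φ u (g.sharpL φ u a)) _ u :=
    (g.hasFDerivAt_flatL hφ hu).clm_apply
      ((g.hasFDerivAt_sharpL hφ hu).clm_apply (hasFDerivAt_const a u))
  have h2 : (fun u => g.flatL φ u (g.sharpL φ u a)) =ᶠ[𝓝 u] fun _ => a := by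
    filter_upwards [φ.open_target.mem_nhds hu] with y hy
    exact g.flatL_sharpL hφ hy a
  have h3 := congrArg (fun L : E m →L[ℝ] E m => L v)
    (h1.unique ((hasFDerivAt_const a u).congr_of_eventuallyEq h2))
  simp only [ContinuousLinearMap.comp_zero, zero_add, add_apply, ContinuousLinearMap.comp_apply,
    ContinuousLinearMap.flip_apply, zero_apply] at h3
  have h4 := congrArg (g.sharpL φ u) (eq_neg_of_add_eq_zero_left h3)
  rwa [g.sharpL_flatL hφ hu, map_neg] at h4

lemma hamiltonian_eq_inner (φ : OpenPartialHomeomorph M (E m)) (u a : E m) :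
    g.hamiltonian φ u a = 1 / 2 * ⟪a, g.sharpL φ u a⟫ := by
  rw [real_inner_comm, sharpL, inner_matrixCLM, hamiltonian]
  congr 1
  exact Finset.sum_congr rfl fun i _ => Finset.sum_congr rfl fun j _ => by ring

lemma gradP_hamiltonian (hφ : IsChart φ) (hu : u ∈ φ.target) (a : E m) :
    gradP (g.hamiltonian φ) u a = g.sharpL φ u a := by
  refine ext_inner_right ℝ fun v => ?_
  rw [inner_gradP]
  have h1 : HasFDerivAt (fun b => 1 / 2 * ⟪b, g.sharpL φ u b⟫) _ a :=
    ((hasFDerivAt_id a).inner ℝ (g.sharpL φ u).hasFDerivAt).const_mul (1 / 2)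
  simp only [hamiltonian_eq_inner]
  rw [h1.fderiv]
  simp [fderivInnerCLM_apply, ← g.inner_sharpL_comm hφ hu, real_inner_comm v]
  ring

lemma inner_gradX_hamiltonian (hφ : IsChart φ) (hu : u ∈ φ.target) (a v : E m) :
    ⟪gradX (g.hamiltonian φ) u a, v⟫
      = -(1 / 2 * ⟪fderiv ℝ (g.flatL φ) u v (g.sharpL φ u a), g.sharpL φ u a⟫) := by
  rw [inner_gradX]
  have h1 : HasFDerivAt (fun u => 1 / 2 * ⟪a, g.sharpL φ u a⟫) _ u :=
    ((hasFDerivAt_const a u).inner ℝ ((g.hasFDerivAt_sharpL hφ hu).clm_apply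
      (hasFDerivAt_const a u))).const_mul (1 / 2)
  simp only [hamiltonian_eq_inner]
  rw [h1.fderiv]
  simp only [smul_apply, ContinuousLinearMap.comp_apply, ContinuousLinearMap.prod_apply,
    fderivInnerCLM_apply, zero_apply, inner_zero_left, add_zero, add_apply, map_zero, zero_add,
    ContinuousLinearMap.flip_apply, g.fderiv_sharpL_apply hφ hu, inner_neg_right, smul_eq_mul]
  rw [← g.inner_sharpL_comm hφ hu, real_inner_comm, mul_neg]

/-- A solution `y`, with gradient `β`, of the equation `Hess y = -κ y g`, along the diagonal. -/
structure IsHessianSolution (κ : ℝ) (φ : OpenPartialHomeomorph M (E m)) (O : Set (E m))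
    (y : E m → ℝ) (β : E m → E m) : Prop where
  smooth : ContDiffOn ℝ ∞ β O
  hasFDerivAt : ∀ u ∈ O, HasFDerivAt y (innerSL ℝ (β u)) u
  hess : ∀ u ∈ O, ∀ x, ⟪fderiv ℝ β u x, x⟫
    = ⟪fderiv ℝ (g.flatL φ) u x x, g.sharpL φ u (β u)⟫
      - 1 / 2 * ⟪fderiv ℝ (g.flatL φ) u (g.sharpL φ u (β u)) x, x⟫ - κ * y u * ⟪g.flatL φ u x, x⟫

variable {g} {κ : ℝ} {O : Set (E m)} {y : E m → ℝ} {β : E m → E m}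

lemma IsHessianSolution.contDiffOn (h : g.IsHessianSolution κ φ O y β) (hO : IsOpen O) :
    ContDiffOn ℝ ∞ y O := by
  rw [contDiffOn_infty_iff_fderiv_of_isOpen hO]
  refine ⟨fun u hu => (h.hasFDerivAt u hu).differentiableAt.differentiableWithinAt, ?_⟩
  exact ((innerSL ℝ : E m →L[ℝ] E m →L[ℝ] ℝ).contDiff.comp_contDiffOn h.smooth).congr
    fun u hu => (h.hasFDerivAt u hu).fderiv

lemma IsHessianSolution.poisson_eq (h : g.IsHessianSolution κ φ O y β) (hφ : IsChart φ)
    (hOφ : O ⊆ φ.target) (hu : u ∈ O) (a : E m) :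
    poisson (g.hamiltonian φ) (fun u _ => y u) u a = ⟪β u, g.sharpL φ u a⟫ := by
  have h1 : gradP (fun u _ => y u) u a = 0 := by
    refine ext_inner_right ℝ fun v => ?_
    rw [inner_gradP]
    simp
  rw [poisson_eq_inner, h1, inner_zero_right, sub_zero, g.gradP_hamiltonian hφ (hOφ hu),
    real_inner_comm, inner_gradX, (h.hasFDerivAt u hu).fderiv, innerSL_apply_apply]

/-- The second derivative along a geodesic with velocity a♯ is Hess y(a♯, a♯) = -κ y g(a♯, a♯), and
g(a♯, a♯) = 2H. Only the diagonal of the Hessian matters, so `IsHessianSolution` records no more. -/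
lemma IsHessianSolution.poisson_poisson_eq (h : g.IsHessianSolution κ φ O y β) (hφ : IsChart φ)
    (hOφ : O ⊆ φ.target) (hO : IsOpen O) (hu : u ∈ O) (a : E m) :
    poisson (g.hamiltonian φ) (fun u a => ⟪β u, g.sharpL φ u a⟫) u a
      = -2 * κ * g.hamiltonian φ u a * y u := by
  have hβ : HasFDerivAt β (fderiv ℝ β u) u :=
    ((h.smooth.contDiffAt (hO.mem_nhds hu)).differentiableAt (by simp)).hasFDerivAt
  have h1 : gradP (fun u a => ⟪β u, g.sharpL φ u a⟫) u a = g.sharpL φ u (β u) := by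
    refine ext_inner_right ℝ fun v => ?_
    rw [inner_gradP]
    have h1 : HasFDerivAt (fun b => ⟪β u, g.sharpL φ u b⟫) _ a :=
      (hasFDerivAt_const (β u) a).inner ℝ (g.sharpL φ u).hasFDerivAt
    rw [h1.fderiv]
    simp [fderivInnerCLM_apply, g.inner_sharpL_comm hφ (hOφ hu)]
  have h2 : ∀ v, ⟪gradX (fun u a => ⟪β u, g.sharpL φ u a⟫) u a, v⟫
      = ⟪fderiv ℝ β u v, g.sharpL φ u a⟫
        - ⟪fderiv ℝ (g.flatL φ) u v (g.sharpL φ u a), g.sharpL φ u (β u)⟫ := by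
    intro v
    rw [inner_gradX]
    have h1 : HasFDerivAt (fun u => ⟪β u, g.sharpL φ u a⟫) _ u :=
      hβ.inner ℝ ((g.hasFDerivAt_sharpL hφ (hOφ hu)).clm_apply (hasFDerivAt_const a u))
    rw [h1.fderiv]
    simp only [ContinuousLinearMap.comp_apply, ContinuousLinearMap.prod_apply,
      fderivInnerCLM_apply, zero_apply, add_apply, map_zero, zero_add,
      ContinuousLinearMap.flip_apply, g.fderiv_sharpL_apply hφ (hOφ hu), inner_neg_right]
    rw [← g.inner_sharpL_comm hφ (hOφ hu), real_inner_comm (g.sharpL φ u (β u))]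
    ring
  rw [poisson_eq_inner, h1, g.gradP_hamiltonian hφ (hOφ hu), real_inner_comm, h2,
    g.inner_gradX_hamiltonian hφ (hOφ hu), h.hess u hu, g.hamiltonian_eq_inner,
    g.flatL_sharpL hφ (hOφ hu)]
  ring

end PseudoMetric

end Flat

/-! ### Local existence of Hessian solutions. -/

section Existence

variable {m : ℕ} {M : Type*} [TopologicalSpace M] [ChartedSpace (E m) M]
  {φ : OpenPartialHomeomorph M (E m)} {u : E m}

open scoped RealInnerProductSpace

-- Bootstrapping: if F is Cⁿ, the equation shows that its derivative is Cⁿ, so F is Cⁿ⁺¹.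
set_option maxSynthPendingDepth 10 in
lemma contDiffOn_of_hasFDerivAt_flip {X W : Type*} [NormedAddCommGroup X] [NormedSpace ℝ X]
    [NormedAddCommGroup W] [NormedSpace ℝ W] {𝒜 : X → X →L[ℝ] W →L[ℝ] W} {O : Set X}
    (hO : IsOpen O) (h𝒜 : ContDiffOn ℝ ∞ 𝒜 O) {F : X → W}
    (hF : ∀ u ∈ O, HasFDerivAt F ((𝒜 u).flip (F u)) u) : ContDiffOn ℝ ∞ F O := by
  rw [contDiffOn_infty]
  intro n
  induction n with
  | zero =>
    exact contDiffOn_zero.2 fun u hu => (hF u hu).continuousAt.continuousWithinAt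
  | succ n ih =>
    rw [Nat.cast_add, Nat.cast_one, contDiffOn_succ_iff_fderiv_of_isOpen hO]
    refine ⟨fun u hu => (hF u hu).differentiableAt.differentiableWithinAt, by simp, ?_⟩
    have h1 : ContDiffOn ℝ n (fun u => (𝒜 u).flip) O :=
      (ContinuousLinearMap.flipₗᵢ ℝ X W W).contDiff.comp_contDiffOn
        (h𝒜.of_le (by exact_mod_cast le_top))
    exact (h1.clm_apply ih).congr fun u hu => (hF u hu).fderiv

namespace PseudoMetric

variable (g : PseudoMetric m M)

/-- In constant curvature, the equation `Hess y = -κ y g` is locally solvable with any initial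
value and gradient. -/
lemma exists_isHessianSolution {κ : ℝ} (hφ : IsChart φ)
    (hκ : ∀ u ∈ φ.target, ∀ l k i j : Fin m, g.curvature φ l k i j u =
      κ * (g.lower φ u j k * (if l = i then 1 else 0) - g.lower φ u i k * (if l = j then 1 else 0)))
    (hu : u ∈ φ.target) :
    ∃ δ > 0, Metric.ball u δ ⊆ φ.target ∧ ∀ (c : ℝ) (w : E m), ∃ y β,
      g.IsHessianSolution κ φ (Metric.ball u δ) y β ∧ y u = c ∧ β u = w := by
  obtain ⟨δ, hδ, hsub, H⟩ := exists_parallel_sections (g.hessConnection κ φ) φ.open_target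
    hu (g.contDiffOn_hessConnection κ hφ) fun u hu => g.hessConnection_flat hφ hu (hκ u hu)
  refine ⟨δ, hδ, hsub, fun c w => ?_⟩
  obtain ⟨F, hF0, hF⟩ := H (c, w)
  have hsm := contDiffOn_of_hasFDerivAt_flip Metric.isOpen_ball
    ((g.contDiffOn_hessConnection κ hφ).mono hsub) hF
  refine ⟨fun u => (F u).1, fun u => (F u).2, ⟨hsm.snd, fun y hy => ?_, fun y hy x => ?_⟩,
    congrArg Prod.fst hF0, congrArg Prod.snd hF0⟩
  · refine (hF y hy).fst.congr_fderiv ?_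
    ext v
    simp [hessConnection_apply, PiLp.inner_apply]
  · rw [(hF y hy).snd.fderiv]
    have hyφ := hsub hy
    set η := g.sharpL φ y (F y).2 with hη
    have hβ : ∀ k, (F y).2 k = ∑ l, g.lower φ y k l * η l := by
      intro k
      conv_lhs => rw [← g.flatL_sharpL hφ hyφ (F y).2]
      exact matrixCLM_apply _ _ _
    have hG : ∀ i j, DifferentiableAt ℝ (fun u => g.lower φ u i j) y := fun i j =>
      ((g.smooth φ hφ i j).contDiffAt (φ.open_target.mem_nhds hyφ)).differentiableAt (by simp)
    have hpd : ∀ (f : E m → ℝ) (v : E m), fderiv ℝ f y v = ∑ l, v l * pd l f y := by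
      intro f v
      conv_lhs => rw [← sum_smul_stdVec v]
      simp [pd]
    have hΓ : ∀ i j, ∑ k, g.christoffel φ k i j y * (F y).2 k
        = ∑ l, η l * (1 / 2 * (pd i (fun y => g.lower φ y j l) y + pd j (fun y => g.lower φ y i l) y
        - pd l (fun y => g.lower φ y i j) y)) := by
      intro i j
      simp only [← g.sum_lower_christoffel hφ hyφ, hβ, Finset.mul_sum]
      rw [Finset.sum_comm]
      exact Finset.sum_congr rfl fun l _ => Finset.sum_congr rfl fun k _ => by
        rw [g.lower_symm φ y l k]; ring
    unfold flatL
    rw [inner_fderiv_matrixCLM hG, inner_fderiv_matrixCLM hG, inner_matrixCLM]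
    simp only [hpd]
    have e1 : ∑ i, ∑ j, ∑ l, x i * x j * η l * pd i (fun y => g.lower φ y j l) y
        = ∑ l, ∑ j, x j * η l * ∑ i, x i * pd i (fun u => g.lower φ u l j) y := by
      simp only [Finset.mul_sum]
      rw [Finset.sum_comm, Finset.sum_congr rfl fun j _ => Finset.sum_comm, Finset.sum_comm]
      refine Finset.sum_congr rfl fun l _ => Finset.sum_congr rfl fun j _ =>
        Finset.sum_congr rfl fun i _ => ?_
      rw [g.pd_lower_symm φ y i l j]
      ring
    -- Contracted twice with x, the first two terms of the Christoffel symbol coincide. This is why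
    -- they appear in `IsHessianSolution` with coefficient 1 and the third with -1/2.
    have e2 : ∑ i, ∑ j, ∑ l, x i * x j * η l * pd j (fun y => g.lower φ y i l) y
        = ∑ i, ∑ j, ∑ l, x i * x j * η l * pd i (fun y => g.lower φ y j l) y := by
      rw [Finset.sum_comm]
      exact Finset.sum_congr rfl fun l _ => Finset.sum_congr rfl fun j _ =>
        Finset.sum_congr rfl fun i _ => by ring
    have e3 : ∑ i, ∑ j, ∑ l, x i * x j * η l * pd l (fun y => g.lower φ y i j) y
        = ∑ i, ∑ j, x j * x i * ∑ l, η l * pd l (fun u => g.lower φ u i j) y := by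
      simp only [Finset.mul_sum]
      exact Finset.sum_congr rfl fun l _ => Finset.sum_congr rfl fun j _ =>
        Finset.sum_congr rfl fun i _ => by ring
    have e4 : ⟪(ContinuousLinearMap.snd ℝ ℝ (E m) ∘SL (g.hessConnection κ φ y).flip (F y)) x, x⟫
        = ∑ i, ∑ j, (x i * x j * ∑ k, g.christoffel φ k i j y * (F y).2 k
          - κ * (F y).1 * (x j * x i * g.lower φ y i j)) := by
      change ⟪(g.hessConnection κ φ y x (F y)).2, x⟫ = _
      rw [hessConnection_apply, PiLp.inner_apply]
      refine Finset.sum_congr rfl fun i _ => ?_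
      simp only [RCLike.inner_apply, conj_trivial]
      rw [Finset.mul_sum]
      exact Finset.sum_congr rfl fun j _ => by ring
    rw [e4, ← e3, ← e1]
    simp only [hΓ, Finset.sum_sub_distrib, ← Finset.mul_sum]
    congr 1
    have e5 : ∀ i j, x i * x j * ∑ l, η l * (1 / 2 * (pd i (fun y => g.lower φ y j l) y
          + pd j (fun y => g.lower φ y i l) y - pd l (fun y => g.lower φ y i j) y))
        = 1 / 2 * (∑ l, x i * x j * η l * pd i (fun y => g.lower φ y j l) y
          + ∑ l, x i * x j * η l * pd j (fun y => g.lower φ y i l) y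
          - ∑ l, x i * x j * η l * pd l (fun y => g.lower φ y i j) y) := by
      intro i j
      rw [← Finset.sum_add_distrib, ← Finset.sum_sub_distrib, Finset.mul_sum, Finset.mul_sum]
      exact Finset.sum_congr rfl fun l _ => by ring
    simp only [e5]
    simp only [← Finset.mul_sum, Finset.sum_sub_distrib, Finset.sum_add_distrib, e2]
    ring

end PseudoMetric

end Existence

/-! ### Straight coordinates from Wronskians. -/

section Lift

variable {m : ℕ} {M : Type*} [TopologicalSpace M] [ChartedSpace (E m) M]
  {φ ψ : OpenPartialHomeomorph M (E m)} {u : E m}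

open scoped RealInnerProductSpace

lemma transition_transition (hu : u ∈ φ.target) (hx : φ.symm u ∈ ψ.source) :
    transition ψ φ (transition φ ψ u) = u := by
  rw [transition, transition, ψ.left_inv hx, φ.right_inv hu]

lemma transition_mem (hu : u ∈ φ.target) (hx : φ.symm u ∈ ψ.source) :
    transition φ ψ u ∈ ψ.target ∧ ψ.symm (transition φ ψ u) ∈ φ.source := by
  refine ⟨ψ.map_source hx, ?_⟩
  rw [transition, ψ.left_inv hx]
  exact φ.map_target hu

lemma contDiffAt_coPull {X : Type*} [NormedAddCommGroup X] [NormedSpace ℝ X] {a : X → E m}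
    {L : X → E m →L[ℝ] E m} {x : X} (ha : ContDiffAt ℝ ∞ a x) (hL : ContDiffAt ℝ ∞ L x) :
    ContDiffAt ℝ ∞ (fun x => coPull (a x) (L x)) x := by
  rw [contDiffAt_euclidean]
  intro j
  exact ha.inner ℝ (hL.clm_apply contDiffAt_const)

/-- Smoothness in canonical coordinates does not depend on the chart. -/
lemma contDiffAt_lift (hφ : IsChart φ) (hψ : IsChart ψ) (hu : u ∈ φ.target)
    (hx : φ.symm u ∈ ψ.source) {F F' : E m → E m → ℝ}
    (h : ∀ᶠ y in 𝓝 u, ∀ b, F' (transition φ ψ y) b = F y ((fderiv ℝ (transition φ ψ) y).adjoint b))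
    (hF : ∀ a, ContDiffAt ℝ ∞ (fun z : E m × E m => F z.1 z.2) (u, a)) (b : E m) :
    ContDiffAt ℝ ∞ (fun z : E m × E m => F' z.1 z.2) (transition φ ψ u, b) := by
  obtain ⟨h2, h3⟩ := transition_mem hu hx
  have h4 := transition_transition hu hx
  have hσ : ContDiffAt ℝ ∞ (transition ψ φ) (transition φ ψ u) := contDiffAt_transition hψ hφ h2 h3
  have hσ' : ContDiffAt ℝ ∞ (fun z : E m × E m => transition ψ φ z.1) (transition φ ψ u, b) :=
    ContDiffAt.comp (g := transition ψ φ) _ hσ contDiffAt_fst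
  have hτ : ContDiffAt ℝ ∞ (fderiv ℝ (transition φ ψ)) (transition ψ φ (transition φ ψ u)) := by
    rw [h4]
    exact (contDiffAt_transition hφ hψ hu hx).fderiv_right (m := ∞) (by simp)
  have hd : ContDiffAt ℝ ∞ (fun z : E m × E m => fderiv ℝ (transition φ ψ) (transition ψ φ z.1))
      (transition φ ψ u, b) := ContDiffAt.comp (g := fderiv ℝ (transition φ ψ)) _ hτ hσ'
  have hev : (fun z : E m × E m => F' z.1 z.2) =ᶠ[𝓝 (transition φ ψ u, b)]
      (fun z : E m × E m => F z.1 z.2) ∘ fun z => (transition ψ φ z.1,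
        coPull z.2 (fderiv ℝ (transition φ ψ) (transition ψ φ z.1))) := by
    have h1 : ∀ᶠ ξ in 𝓝 (transition φ ψ u), (∀ b, F' (transition φ ψ (transition ψ φ ξ)) b
        = F (transition ψ φ ξ) ((fderiv ℝ (transition φ ψ) (transition ψ φ ξ)).adjoint b)) :=
      hσ.continuousAt.eventually (by rwa [h4])
    have h5 := (continuous_fst.tendsto (transition φ ψ u, b)).eventually
      (h1.and (eventually_mem_transition_source (φ := ψ) (ψ := φ) h2 h3))
    filter_upwards [h5] with z hz
    have h6 := hz.1 z.2
    rw [transition_transition hz.2.1 hz.2.2] at h6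
    simp only [Function.comp_apply]
    rw [coPull_eq, h6]
  refine ContDiffAt.congr_of_eventuallyEq ?_ hev
  refine ContDiffAt.comp (transition φ ψ u, b) ?_ (hσ'.prodMk (contDiffAt_coPull contDiffAt_snd hd))
  simp only [h4]
  exact hF _

/-- The bracket with the Hamiltonian does not depend on the chart. -/
lemma poisson_lift (g : PseudoMetric m M) (hφ : IsChart φ) (hψ : IsChart ψ) (hu : u ∈ φ.target)
    (hx : φ.symm u ∈ ψ.source) {F F' : E m → E m → ℝ}
    (h : ∀ᶠ y in 𝓝 u, ∀ b, F' (transition φ ψ y) b = F y ((fderiv ℝ (transition φ ψ) y).adjoint b))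
    (hF : ∀ a, ContDiffAt ℝ ∞ (fun z : E m × E m => F z.1 z.2) (u, a)) (b : E m) :
    poisson (g.hamiltonian ψ) F' (transition φ ψ u) b
      = poisson (g.hamiltonian φ) F u ((fderiv ℝ (transition φ ψ) u).adjoint b) := by
  have hy : ∀ {F : E m → E m → ℝ} {y a : E m},
      ContDiffAt ℝ ∞ (fun z : E m × E m => F z.1 z.2) (y, a) →
      DifferentiableAt ℝ (fun y => F y a) y := fun {F y a} h =>
    DifferentiableAt.comp (g := fun z : E m × E m => F z.1 z.2) (f := fun y => (y, a)) y
      (h.differentiableAt (by simp)) (by fun_prop)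
  refine poisson_cotangentLift ((contDiffAt_transition hφ hψ hu hx).of_le (by decide)) h ?_ b
    ((hF _).differentiableAt (by simp))
    ((g.contDiffAt_hamiltonian hφ hu _).differentiableAt (by simp))
    (hy (contDiffAt_lift hφ hψ hu hx h hF b))
    (hy (g.contDiffAt_hamiltonian hψ (ψ.map_source hx) b))
  filter_upwards [eventually_mem_transition_source (φ := φ) (ψ := ψ) hu hx] with y hy b
  exact g.hamiltonian_transition hφ hψ hy.1 hy.2 b

/-- Along every geodesic, a solution of `Hess y = -κ y g` satisfies `y'' = -2 κ H y`, in any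
chart. -/
lemma PseudoMetric.IsHessianSolution.lift {g : PseudoMetric m M} {κ : ℝ} {O : Set (E m)}
    {y : E m → ℝ} {β : E m → E m} (h : g.IsHessianSolution κ φ O y β) (hφ : IsChart φ)
    (hψ : IsChart ψ) (hO : IsOpen O) (hOφ : O ⊆ φ.target) (hu : u ∈ O) (hx : φ.symm u ∈ ψ.source)
    (b : E m) :
    ContDiffAt ℝ ∞ (fun z : E m × E m => poisson (g.hamiltonian ψ)
      (fun ξ _ => y (transition ψ φ ξ)) z.1 z.2) (transition φ ψ u, b) ∧
    poisson (g.hamiltonian ψ) (poisson (g.hamiltonian ψ) (fun ξ _ => y (transition ψ φ ξ)))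
      (transition φ ψ u) b
      = -2 * κ * g.hamiltonian ψ (transition φ ψ u) b * y u := by
  have hev : ∀ {u : E m}, u ∈ O → φ.symm u ∈ ψ.source →
      ∀ᶠ v in 𝓝 u, v ∈ O ∧ φ.symm v ∈ ψ.source := fun hu hx =>
    (hO.eventually_mem hu).and ((eventually_mem_transition_source (hOφ hu) hx).mono fun _ h => h.2)
  have h1 : ∀ {u : E m}, u ∈ O → φ.symm u ∈ ψ.source → ∀ b,
      poisson (g.hamiltonian ψ) (fun ξ _ => y (transition ψ φ ξ)) (transition φ ψ u) b
        = ⟪β u, g.sharpL φ u ((fderiv ℝ (transition φ ψ) u).adjoint b)⟫ := by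
    intro u hu hx b
    rw [← h.poisson_eq hφ hOφ hu]
    refine poisson_lift g hφ hψ (hOφ hu) hx ?_ (fun a => ?_) b
    · filter_upwards [hev hu hx] with v hv b
      rw [transition_transition (hOφ hv.1) hv.2]
    · exact ContDiffAt.comp (g := y) (u, a) ((h.contDiffOn hO).contDiffAt (hO.mem_nhds hu))
        contDiffAt_fst
  have h2 : ∀ᶠ v in 𝓝 u, ∀ b,
      poisson (g.hamiltonian ψ) (fun ξ _ => y (transition ψ φ ξ)) (transition φ ψ v) b
        = (fun u a => ⟪β u, g.sharpL φ u a⟫) v ((fderiv ℝ (transition φ ψ) v).adjoint b) := by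
    filter_upwards [hev hu hx] with v hv b
    exact h1 hv.1 hv.2 b
  have h3 : ∀ a, ContDiffAt ℝ ∞
      (fun z : E m × E m => (fun u a => ⟪β u, g.sharpL φ u a⟫) z.1 z.2) (u, a) := by
    intro a
    have h4 : ContDiffAt ℝ ∞ (fun z : E m × E m => β z.1) (u, a) :=
      ContDiffAt.comp (g := β) (u, a) (h.smooth.contDiffAt (hO.mem_nhds hu)) contDiffAt_fst
    have h5 : ContDiffAt ℝ ∞ (fun z : E m × E m => g.sharpL φ z.1) (u, a) :=
      ContDiffAt.comp (g := g.sharpL φ) (u, a) ((g.contDiffOn_sharpL hφ).contDiffAt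
        (φ.open_target.mem_nhds (hOφ hu))) contDiffAt_fst
    exact h4.inner ℝ (h5.clm_apply contDiffAt_snd)
  refine ⟨contDiffAt_lift (F := fun u a => ⟪β u, g.sharpL φ u a⟫) hφ hψ (hOφ hu) hx h2 h3 b, ?_⟩
  rw [poisson_lift (F := fun u a => ⟪β u, g.sharpL φ u a⟫) g hφ hψ (hOφ hu) hx h2 h3 b, h.poisson_poisson_eq hφ hOφ hO hu,
    g.hamiltonian_transition hφ hψ (hOφ hu) hx]

/-- In the chart `ψ` the geodesic flow is straight: in the coordinates `(ξ, q)` with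
momentum `S ξ q`, the Hamiltonian vector field is proportional to `q ∂/∂ξ`. -/
structure IsStraightening (g : PseudoMetric m M) (ψ : OpenPartialHomeomorph M (E m))
    (S T : E m → E m →L[ℝ] E m) (ρ : E m → ℝ) : Prop where
  isChart : IsChart ψ
  smooth : ContDiffOn ℝ ∞ S ψ.target
  smooth_symm : ContDiffOn ℝ ∞ T ψ.target
  left_inv : ∀ ξ ∈ ψ.target, ∀ q, T ξ (S ξ q) = q
  right_inv : ∀ ξ ∈ ψ.target, ∀ a, S ξ (T ξ a) = a
  ne_zero : ∀ ξ ∈ ψ.target, ρ ξ ≠ 0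
  poisson_eq : ∀ (F : E m → E m → ℝ), ∀ ξ ∈ ψ.target, ∀ q,
    DifferentiableAt ℝ (fun z : E m × E m => F z.1 z.2) (ξ, S ξ q) →
    poisson (g.hamiltonian ψ) F ξ (S ξ q)
      = ρ ξ * fderiv ℝ (fun z : E m × E m => F z.1 (S z.1 z.2)) (ξ, q) (q, 0)

lemma poisson_fst (g : PseudoMetric m M) (hψ : IsChart ψ) {ξ : E m} (hξ : ξ ∈ ψ.target)
    (y : E m → ℝ) (a : E m) :
    poisson (g.hamiltonian ψ) (fun ξ _ => y ξ) ξ a = fderiv ℝ y ξ (g.sharpL ψ ξ a) := by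
  have h1 : gradP (fun u _ => y u) ξ a = 0 := by
    refine ext_inner_right ℝ fun v => ?_
    rw [inner_gradP]
    simp
  rw [poisson_eq_inner, h1, inner_zero_right, sub_zero, g.gradP_hamiltonian hψ hξ,
    real_inner_comm, inner_gradX]

/-- Since l and yᵢ = ξᵢ l satisfy the same second-order equation along the flow, the Wronskian l yᵢ'
- yᵢ l' = l² ξᵢ' is conserved. The new momentum q = l² a♯ is therefore constant, while ξ' = a♯ = l⁻²
q; the factor l⁻² is ρ. -/
lemma isStraightening_of_conformal (g : PseudoMetric m M) (hψ : IsChart ψ) {κ : ℝ} {l : E m → ℝ}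
    (hl : ContDiffOn ℝ ∞ l ψ.target) (hl0 : ∀ ξ ∈ ψ.target, l ξ ≠ 0)
    (h : ∀ ξ ∈ ψ.target, ∀ a,
      ContDiffAt ℝ ∞ (fun z : E m × E m =>
        poisson (g.hamiltonian ψ) (fun ξ _ => l ξ) z.1 z.2) (ξ, a) ∧
      poisson (g.hamiltonian ψ) (poisson (g.hamiltonian ψ) (fun ξ _ => l ξ)) ξ a
        = -2 * κ * g.hamiltonian ψ ξ a * l ξ)
    {y : Fin m → E m → ℝ} (hy : ∀ i, ∀ ξ ∈ ψ.target, y i ξ = ξ i * l ξ)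
    (hi : ∀ i, ∀ ξ ∈ ψ.target, ∀ a,
      ContDiffAt ℝ ∞ (fun z : E m × E m =>
        poisson (g.hamiltonian ψ) (fun ξ _ => y i ξ) z.1 z.2) (ξ, a) ∧
      poisson (g.hamiltonian ψ) (poisson (g.hamiltonian ψ) (fun ξ _ => y i ξ)) ξ a
        = -2 * κ * g.hamiltonian ψ ξ a * y i ξ) :
    IsStraightening g ψ (fun ξ => (l ξ ^ 2)⁻¹ • g.flatL ψ ξ) (fun ξ => l ξ ^ 2 • g.sharpL ψ ξ)
      fun ξ => (l ξ ^ 2)⁻¹ := by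
  have hld : ∀ ξ ∈ ψ.target, HasFDerivAt l (fderiv ℝ l ξ) ξ := fun ξ hξ =>
    ((hl.contDiffAt (ψ.open_target.mem_nhds hξ)).differentiableAt (by simp)).hasFDerivAt
  have hsS : ContDiffOn ℝ ∞ (fun ξ => (l ξ ^ 2)⁻¹ • g.flatL ψ ξ) ψ.target :=
    ((hl.pow 2).inv fun ξ hξ => pow_ne_zero 2 (hl0 ξ hξ)).smul (g.contDiffOn_flatL hψ)
  have hsT : ContDiffOn ℝ ∞ (fun ξ => l ξ ^ 2 • g.sharpL ψ ξ) ψ.target :=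
    (hl.pow 2).smul (g.contDiffOn_sharpL hψ)
  have hTS : ∀ ξ ∈ ψ.target, ∀ q, (l ξ ^ 2 • g.sharpL ψ ξ) (((l ξ ^ 2)⁻¹ • g.flatL ψ ξ) q) = q := by
    intro ξ hξ q
    have := pow_ne_zero 2 (hl0 ξ hξ)
    simp [g.sharpL_flatL hψ hξ, smul_smul, this]
  have hST : ∀ ξ ∈ ψ.target, ∀ q, ((l ξ ^ 2)⁻¹ • g.flatL ψ ξ) ((l ξ ^ 2 • g.sharpL ψ ξ) q) = q := by
    intro ξ hξ q
    have := pow_ne_zero 2 (hl0 ξ hξ)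
    simp [g.flatL_sharpL hψ hξ, smul_smul, this]
  have hdot : ∀ i, ∀ ξ ∈ ψ.target, ∀ a, l ξ ^ 2 * (g.sharpL ψ ξ a) i
      = l ξ * poisson (g.hamiltonian ψ) (fun ξ _ => y i ξ) ξ a
        - (ξ i * l ξ) * poisson (g.hamiltonian ψ) (fun ξ _ => l ξ) ξ a := by
    intro i ξ hξ a
    have h1 : HasFDerivAt (fun ξ : E m => ξ i * l ξ) _ ξ :=
      (EuclideanSpace.proj i : E m →L[ℝ] ℝ).hasFDerivAt.mul (hld ξ hξ)
    have h2 : y i =ᶠ[𝓝 ξ] fun ξ => ξ i * l ξ := by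
      filter_upwards [ψ.open_target.mem_nhds hξ] with ζ hζ
      exact hy i ζ hζ
    rw [poisson_fst g hψ hξ, poisson_fst g hψ hξ, h2.fderiv_eq, h1.fderiv]
    simp
    ring
  -- Conservation of the Wronskian along the Hamiltonian vector field.
  have hY : ∀ i, ∀ ξ ∈ ψ.target, ∀ a, fderiv ℝ (fun z : E m × E m =>
      l z.1 ^ 2 * (g.sharpL ψ z.1 z.2) i) (ξ, a)
        (gradP (g.hamiltonian ψ) ξ a, -gradX (g.hamiltonian ψ) ξ a) = 0 := by
    intro i ξ hξ a
    obtain ⟨h1, h2⟩ := h ξ hξ a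
    obtain ⟨h3, h4⟩ := hi i ξ hξ a
    have hev : (fun z : E m × E m => l z.1 ^ 2 * (g.sharpL ψ z.1 z.2) i) =ᶠ[𝓝 (ξ, a)] fun z =>
        l z.1 * poisson (g.hamiltonian ψ) (fun ξ _ => y i ξ) z.1 z.2
        - (z.1 i * l z.1) * poisson (g.hamiltonian ψ) (fun ξ _ => l ξ) z.1 z.2 := by
      filter_upwards [(ψ.open_target.prod isOpen_univ).mem_nhds
        (⟨hξ, mem_univ _⟩ : (ξ, a) ∈ ψ.target ×ˢ univ)] with z hz
      exact hdot i z.1 hz.1 z.2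
    rw [poisson_eq_fderiv _ (h1.differentiableAt (by simp))] at h2
    rw [poisson_eq_fderiv _ (h3.differentiableAt (by simp))] at h4
    have hl1 : HasFDerivAt (fun z : E m × E m => l z.1) _ (ξ, a) :=
      HasFDerivAt.comp (g := l) (ξ, a) (hld ξ hξ) hasFDerivAt_fst
    have hp1 : HasFDerivAt (fun z : E m × E m => z.1 i) _ (ξ, a) :=
      HasFDerivAt.comp (g := fun ξ : E m => ξ i) (ξ, a)
        (EuclideanSpace.proj i : E m →L[ℝ] ℝ).hasFDerivAt hasFDerivAt_fst
    have hA : HasFDerivAt (fun z : E m × E m =>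
        l z.1 * poisson (g.hamiltonian ψ) (fun ξ _ => y i ξ) z.1 z.2
        - (z.1 i * l z.1) * poisson (g.hamiltonian ψ) (fun ξ _ => l ξ) z.1 z.2) _ (ξ, a) :=
      (hl1.mul (h3.differentiableAt (by simp)).hasFDerivAt).sub
        ((hp1.mul hl1).mul (h1.differentiableAt (by simp)).hasFDerivAt)
    have hB : l ξ * (g.sharpL ψ ξ a) i = poisson (g.hamiltonian ψ) (fun ξ _ => y i ξ) ξ a
        - ξ i * poisson (g.hamiltonian ψ) (fun ξ _ => l ξ) ξ a :=
      mul_left_cancel₀ (hl0 ξ hξ) (by linear_combination hdot i ξ hξ a)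
    have hP : (EuclideanSpace.proj i : E m →L[ℝ] ℝ) (gradP (g.hamiltonian ψ) ξ a)
        = (g.sharpL ψ ξ a) i := by rw [g.gradP_hamiltonian hψ hξ]; rfl
    have hL := poisson_fst g hψ hξ l a
    rw [← g.gradP_hamiltonian hψ hξ] at hL
    rw [hev.fderiv_eq, hA.fderiv]
    simp only [sub_apply, add_apply, smul_apply, smul_eq_mul, ContinuousLinearMap.comp_apply,
      ContinuousLinearMap.coe_fst', Pi.mul_apply, h2, h4, hy i ξ hξ, hP, ← hL]
    linear_combination (-poisson (g.hamiltonian ψ) (fun ξ _ => l ξ) ξ a) * hB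
  refine ⟨hψ, hsS, hsT, hTS, hST, fun ξ hξ => inv_ne_zero (pow_ne_zero 2 (hl0 ξ hξ)), ?_⟩
  intro F ξ hξ q hF
  set S : E m → E m →L[ℝ] E m := fun ξ => (l ξ ^ 2)⁻¹ • g.flatL ψ ξ with hS
  set T : E m → E m →L[ℝ] E m := fun ξ => l ξ ^ 2 • g.sharpL ψ ξ with hT
  set a := S ξ q with ha
  set X : E m × E m := (gradP (g.hamiltonian ψ) ξ a, -gradX (g.hamiltonian ψ) ξ a) with hX
  have hSd : DifferentiableAt ℝ (fun z : E m × E m => ((z.1, S z.1 z.2) : E m × E m)) (ξ, q) := by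
    have h1 : DifferentiableAt ℝ (fun z : E m × E m => S z.1) (ξ, q) :=
      DifferentiableAt.comp (g := S) (ξ, q) ((hsS.contDiffAt
        (ψ.open_target.mem_nhds hξ)).differentiableAt (by simp)) differentiableAt_fst
    exact differentiableAt_fst.prodMk (h1.clm_apply differentiableAt_snd)
  have hT1 : DifferentiableAt ℝ (fun z : E m × E m => T z.1 z.2) (ξ, a) := by
    have h1 : DifferentiableAt ℝ (fun z : E m × E m => T z.1) (ξ, a) :=
      DifferentiableAt.comp (g := T) (ξ, a) ((hsT.contDiffAt
        (ψ.open_target.mem_nhds hξ)).differentiableAt (by simp)) differentiableAt_fst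
    exact h1.clm_apply differentiableAt_snd
  have hTd := (hasFDerivAt_fst (𝕜 := ℝ) (p := (ξ, a))).prodMk hT1.hasFDerivAt
  have hTX : fderiv ℝ (fun z : E m × E m => T z.1 z.2) (ξ, a) X = 0 := by
    ext i
    have h1 := (EuclideanSpace.proj i : E m →L[ℝ] ℝ).hasFDerivAt.comp (ξ, a) hT1.hasFDerivAt
    have h2 := hY i ξ hξ a
    have h3 : (fun z : E m × E m => l z.1 ^ 2 * (g.sharpL ψ z.1 z.2) i)
      = (EuclideanSpace.proj i : E m →L[ℝ] ℝ) ∘ fun z : E m × E m => T z.1 z.2 := by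
      funext z
      simp [hT]
    rw [h3, h1.fderiv] at h2
    exact h2
  have hTa : T ξ a = q := hTS ξ hξ q
  -- The maps (ξ, a) ↦ (ξ, T a) and (ξ, q) ↦ (ξ, S q) are inverse to each other. The first carries
  -- the Hamiltonian vector X to (X.1, 0), so the second carries that back to X.
  have hcomp : fderiv ℝ (fun z : E m × E m => ((z.1, S z.1 z.2) : E m × E m)) (ξ, q) (X.1, 0) = X := by
    have h1 : HasFDerivAt (fun z : E m × E m => ((z.1, S z.1 (T z.1 z.2)) : E m × E m)) _ (ξ, a) :=
      HasFDerivAt.comp (g := fun z : E m × E m => ((z.1, S z.1 z.2) : E m × E m))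
        (f := fun z : E m × E m => (z.1, T z.1 z.2)) (ξ, a)
        (by simpa only [hTa] using hSd.hasFDerivAt) hTd
    have h2 : (fun z : E m × E m => ((z.1, S z.1 (T z.1 z.2)) : E m × E m)) =ᶠ[𝓝 (ξ, a)] id := by
      filter_upwards [(ψ.open_target.prod isOpen_univ).mem_nhds
        (⟨hξ, mem_univ _⟩ : (ξ, a) ∈ ψ.target ×ˢ univ)] with z hz
      exact Prod.ext rfl (hST z.1 hz.1 z.2)
    have h3 := congrArg (fun L : E m × E m →L[ℝ] E m × E m => L X)
      (h1.unique ((hasFDerivAt_id (ξ, a)).congr_of_eventuallyEq h2))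
    simpa [hTX] using h3
  have hX1 : X.1 = (l ξ ^ 2)⁻¹ • q := by
    have h1 := pow_ne_zero 2 (hl0 ξ hξ)
    rw [hX, g.gradP_hamiltonian hψ hξ, ← hTa, hT, smul_apply, smul_smul, inv_mul_cancel₀ h1, one_smul]
  have hFd : HasFDerivAt (fun z : E m × E m => F z.1 (S z.1 z.2)) _ (ξ, q) :=
    HasFDerivAt.comp (g := fun z : E m × E m => F z.1 z.2)
      (f := fun z : E m × E m => (z.1, S z.1 z.2)) (ξ, q) hF.hasFDerivAt hSd.hasFDerivAt
  rw [poisson_eq_fderiv _ hF, hFd.fderiv, ← smul_eq_mul, ← map_smul, ContinuousLinearMap.comp_apply]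
  congr 1
  rw [← hX, Prod.smul_mk, smul_zero, ← hX1, hcomp]

end Lift

/-! ### Existence of straightening charts in constant curvature. -/

section StraightChart

variable {m : ℕ} {M : Type*} [TopologicalSpace M] [ChartedSpace (E m) M] [IsManifold (𝓡 m) ∞ M]

open scoped RealInnerProductSpace

lemma IsChart.trans {φ : OpenPartialHomeomorph M (E m)} (hφ : IsChart φ)
    {e : OpenPartialHomeomorph (E m) (E m)} (he : ContDiffOn ℝ ∞ e e.source)
    (he' : ContDiffOn ℝ ∞ e.symm e.target) : IsChart (φ.trans e) := by
  rw [IsChart, IsManifold.mem_maximalAtlas_iff_contMDiffOn]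
  constructor
  · exact he.contMDiffOn.comp ((contMDiffOn_of_mem_maximalAtlas hφ).mono fun x hx => hx.1)
      fun x hx => hx.2
  · exact (contMDiffOn_symm_of_mem_maximalAtlas hφ).comp (he'.contMDiffOn.mono fun x hx => hx.1)
      fun x hx => hx.2

/-- The inverse function theorem, with smoothness on the whole of source and target. -/
lemma exists_openPartialHomeomorph {x : E m → E m} {O : Set (E m)} (hO : IsOpen O) {u : E m}
    (hu : u ∈ O) (hx : ContDiffOn ℝ ∞ x O) {L : E m ≃L[ℝ] E m} (hL : fderiv ℝ x u = L) :
    ∃ e : OpenPartialHomeomorph (E m) (E m), u ∈ e.source ∧ e.source ⊆ O ∧ (∀ y, e y = x y) ∧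
      ContDiffOn ℝ ∞ e e.source ∧ ContDiffOn ℝ ∞ e.symm e.target := by
  have hat : ∀ y ∈ O, ContDiffAt ℝ ∞ x y := fun y hy => hx.contDiffAt (hO.mem_nhds hy)
  have hd : HasFDerivAt x (L : E m →L[ℝ] E m) u := by
    rw [← hL]
    exact ((hat u hu).differentiableAt (by simp)).hasFDerivAt
  set e₀ := (hat u hu).toOpenPartialHomeomorph x hd (by simp) with he₀
  have hcont : ContinuousOn (fderiv ℝ x) O :=
    (hx.fderiv_of_isOpen (m := ∞) hO (by simp)).continuousOn
  -- Keeping only points with invertible derivative makes the inverse smooth on the whole target, as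
  -- a chart requires.
  set O' : Set (E m) := O ∩ fderiv ℝ x ⁻¹' range ((↑) : (E m ≃L[ℝ] E m) → E m →L[ℝ] E m) with hO'
  have hO'o : IsOpen O' := hcont.isOpen_inter_preimage hO ContinuousLinearEquiv.isOpen
  have huO' : u ∈ O' := ⟨hu, ⟨L, hL.symm⟩⟩
  have hsrc : (e₀.restrOpen O' hO'o).source = e₀.source ∩ O' := rfl
  have hcoe : ∀ y, e₀.restrOpen O' hO'o y = x y := fun y => rfl
  refine ⟨e₀.restrOpen O' hO'o, ⟨(hat u hu).mem_toOpenPartialHomeomorph_source hd (by simp), huO'⟩,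
    fun y hy => hy.2.1, hcoe, hx.mono fun y hy => hy.2.1, fun y hy => ?_⟩
  have hy' := (e₀.restrOpen O' hO'o).map_target hy
  obtain ⟨L', hL'⟩ := hy'.2.2
  refine (OpenPartialHomeomorph.contDiffAt_symm (f₀' := L') _ hy ?_ (hat _ hy'.2.1)).contDiffWithinAt
  rw [hL']
  exact ((hat _ hy'.2.1).differentiableAt (by simp)).hasFDerivAt

/-- In constant curvature, every point has a chart in which the geodesic flow is straight. -/
theorem exists_isStraightening (g : PseudoMetric m M) (hg : g.HasConstantCurvature) (p : M) :
    ∃ ψ S T ρ, p ∈ ψ.source ∧ IsStraightening g ψ S T ρ := by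
  obtain ⟨κ, hκ⟩ := hg
  set φ := chartAt (E m) p with hφdef
  have hφ : IsChart φ := IsManifold.chart_mem_maximalAtlas p
  have hp : p ∈ φ.source := mem_chart_source _ p
  obtain ⟨δ, hδ, hsub, H⟩ := g.exists_isHessianSolution hφ (hκ φ hφ) (φ.map_source hp)
  set u := φ p with hu
  -- These initial data give the quotients yᵢ/y₀ the identity as derivative at u, so the inverse
  -- function theorem applies.
  obtain ⟨y₀, β₀, h₀, hy₀, hβ₀⟩ := H 1 0
  choose y β hyβ hy hβ using fun i : Fin m => H 0 (stdVec i)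
  have hball : IsOpen (Metric.ball u δ) := Metric.isOpen_ball
  set O : Set (E m) := Metric.ball u δ ∩ y₀ ⁻¹' {0}ᶜ with hO
  have hOo : IsOpen O :=
    (h₀.contDiffOn hball).continuousOn.isOpen_inter_preimage hball isOpen_compl_singleton
  have huO : u ∈ O := ⟨Metric.mem_ball_self hδ, by simp [hy₀]⟩
  set x : E m → E m := fun v => WithLp.toLp 2 fun i => y i v / y₀ v with hx
  have hxs : ContDiffOn ℝ ∞ x O := by
    rw [contDiffOn_euclidean]
    exact fun i => (((hyβ i).contDiffOn hball).mono inter_subset_left).div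
      ((h₀.contDiffOn hball).mono inter_subset_left) fun v hv => hv.2
  have hxd : fderiv ℝ x u = (ContinuousLinearEquiv.refl ℝ (E m) : E m →L[ℝ] E m) := by
    refine HasFDerivAt.fderiv ?_
    rw [← hasFDerivWithinAt_univ, hasFDerivWithinAt_euclidean]
    intro i
    have h0 : y₀ u ≠ 0 := huO.2
    have h1 : HasFDerivAt (fun v => y i v * (y₀ v)⁻¹) _ u :=
      ((hyβ i).hasFDerivAt u huO.1).mul
        ((hasDerivAt_inv h0).hasFDerivAt.comp u (h₀.hasFDerivAt u huO.1))
    refine HasFDerivAt.hasFDerivWithinAt ?_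
    simp only [hx, div_eq_mul_inv]
    refine h1.congr_fderiv ?_
    ext v
    simp [hy₀, hβ₀, hy, hβ, stdVec, EuclideanSpace.inner_single_left]
  obtain ⟨e, hue, heO, hex, hes, hes'⟩ := exists_openPartialHomeomorph hOo huO hxs hxd
  set ψ := φ.trans e with hψdef
  have hψ : IsChart ψ := hφ.trans hes hes'
  have hback : ∀ ξ ∈ ψ.target, transition ψ φ ξ = e.symm ξ ∧ e.symm ξ ∈ O ∧ e.symm ξ ∈ φ.target ∧
      φ.symm (e.symm ξ) ∈ ψ.source ∧ transition φ ψ (e.symm ξ) = ξ ∧ x (e.symm ξ) = ξ := by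
    intro ξ hξ
    have h1 : ξ ∈ e.target := hξ.1
    have h2 : e.symm ξ ∈ φ.target := hξ.2
    refine ⟨φ.right_inv h2, heO (e.map_target h1), h2, ψ.map_target hξ, ?_, ?_⟩
    · change e (φ (φ.symm (e.symm ξ))) = ξ
      rw [φ.right_inv h2, e.right_inv h1]
    · rw [← hex, e.right_inv h1]
  have hls : ContDiffOn ℝ ∞ (fun ξ => y₀ (transition ψ φ ξ)) ψ.target := by
    refine (((h₀.contDiffOn hball).mono inter_subset_left).comp (hes'.mono fun ξ hξ => hξ.1)
      fun ξ hξ => (hback ξ hξ).2.1).congr fun ξ hξ => ?_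
    rw [(hback ξ hξ).1]
    rfl
  have hlift : ∀ {y : E m → ℝ} {β : E m → E m} (_ : g.IsHessianSolution κ φ (Metric.ball u δ) y β),
      ∀ ξ ∈ ψ.target, ∀ a,
      ContDiffAt ℝ ∞ (fun z : E m × E m =>
        poisson (g.hamiltonian ψ) (fun ξ _ => y (transition ψ φ ξ)) z.1 z.2) (ξ, a) ∧
      poisson (g.hamiltonian ψ)
        (poisson (g.hamiltonian ψ) (fun ξ _ => y (transition ψ φ ξ))) ξ a
        = -2 * κ * g.hamiltonian ψ ξ a * y (transition ψ φ ξ) := by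
    intro y β h ξ hξ a
    obtain ⟨h1, h2, h3, h4, h5, h6⟩ := hback ξ hξ
    have := h.lift hφ hψ hball hsub h2.1 h4 a
    rwa [h5, ← h1] at this
  refine ⟨ψ, _, _, _, ⟨hp, hue⟩, isStraightening_of_conformal g hψ (κ := κ) hls
    (fun ξ hξ => ?_) (hlift h₀) (y := fun i ξ => y i (transition ψ φ ξ)) (fun i ξ hξ => ?_)
    fun i => hlift (hyβ i)⟩
  · rw [(hback ξ hξ).1]
    exact (hback ξ hξ).2.1.2
  · obtain ⟨h1, h2, h3, h4, h5, h6⟩ := hback ξ hξ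
    have h7 : y₀ (e.symm ξ) ≠ 0 := h2.2
    have h8 := congrArg (fun v : E m => v i) h6
    simp only [hx] at h8
    rw [h1, ← h8, div_mul_cancel₀ _ h7]

end StraightChart

/-! ### Linear substitutions in momentum polynomials. -/

section LinearSubstitution

variable {m : ℕ}

/-- The linear substitution of variables `p ↦ p ∘ L`. -/
def linSubst (L : E m →L[ℝ] E m) : MvPolynomial (Fin m) ℝ →ₐ[ℝ] MvPolynomial (Fin m) ℝ :=
  MvPolynomial.bind₁ fun i => ∑ j, MvPolynomial.C (L (stdVec j) i) * MvPolynomial.X j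

lemma eval_linSubst (L : E m →L[ℝ] E m) (p : MvPolynomial (Fin m) ℝ) (q : E m) :
    MvPolynomial.eval (fun i => q i) (linSubst L p) = MvPolynomial.eval (fun i => L q i) p := by
  rw [linSubst, eval_bind₁']
  congr 2
  funext i
  conv_rhs => rw [← sum_smul_stdVec q]
  simp [mul_comm]

lemma linSubst_linSubst {L L' : E m →L[ℝ] E m} (h : ∀ q, L (L' q) = q)
    (p : MvPolynomial (Fin m) ℝ) : linSubst L' (linSubst L p) = p :=
  eq_of_eval_eq_all fun q => by rw [eval_linSubst, eval_linSubst, h]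

lemma linSubst_eq_zero_iff {L L' : E m →L[ℝ] E m} (h : ∀ q, L (L' q) = q)
    {p : MvPolynomial (Fin m) ℝ} : linSubst L p = 0 ↔ p = 0 :=
  ⟨fun h0 => by rw [← linSubst_linSubst h p, h0, map_zero], fun h0 => by rw [h0, map_zero]⟩

lemma isHomogeneous_linSubst (L : E m →L[ℝ] E m) {p : MvPolynomial (Fin m) ℝ} {d : ℕ}
    (hp : p.IsHomogeneous d) : (linSubst L p).IsHomogeneous d := by
  have h1 : ∀ i, (∑ j, MvPolynomial.C (L (stdVec j) i) * MvPolynomial.X j :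
      MvPolynomial (Fin m) ℝ).IsHomogeneous 1 := fun i =>
    MvPolynomial.IsHomogeneous.sum _ _ _ fun j _ => by
      simpa using (MvPolynomial.isHomogeneous_C (Fin m) (L (stdVec j) i)).mul
        (MvPolynomial.isHomogeneous_X ℝ j)
  have h2 := hp.aeval _ h1
  rwa [one_mul] at h2

lemma isRelPrime_linSubst {L L' : E m →L[ℝ] E m} (h : ∀ q, L (L' q) = q) (h' : ∀ q, L' (L q) = q)
    {p p' : MvPolynomial (Fin m) ℝ} (hp : IsRelPrime p p') :
    IsRelPrime (linSubst L p) (linSubst L p') := by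
  intro d hd hd'
  have h1 := map_dvd (linSubst L') hd
  have h2 := map_dvd (linSubst L') hd'
  rw [linSubst_linSubst h] at h1 h2
  have h3 := (hp h1 h2).map (linSubst L)
  rwa [linSubst_linSubst h'] at h3

end LinearSubstitution

/-! ### Transfer between momentum polynomials and straight coordinates. -/

section Straighten

variable {m : ℕ} {M : Type*} [TopologicalSpace M] [ChartedSpace (E m) M]

open scoped RealInnerProductSpace

/-- A momentum polynomial in the coordinates `(ξ, q)`, where the momentum is `S ξ q`. -/
def straighten (ψ : OpenPartialHomeomorph M (E m)) (S : E m → E m →L[ℝ] E m)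
    (P : M → MvPolynomial (Fin m) ℝ) (ξ : E m) : MvPolynomial (Fin m) ℝ :=
  linSubst ((chartDeriv ψ (ψ.symm ξ)).adjoint.comp (S ξ)) (P (ψ.symm ξ))

/-- The momentum polynomial given by polynomials in the coordinates `(ξ, q)`, where `q = T ξ a` for
the momentum `a`. -/
def unstraighten (ψ : OpenPartialHomeomorph M (E m)) (T : E m → E m →L[ℝ] E m)
    (A : E m → MvPolynomial (Fin m) ℝ) (x : M) : MvPolynomial (Fin m) ℝ :=
  linSubst ((T (ψ x)).comp (chartSymmDeriv ψ (ψ x)).adjoint) (A (ψ x))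

/-- The adjoint of dψ in `straighten` converts chart momenta into the fibre components that `value`
uses. -/
lemma phaseEval_straighten (ψ : OpenPartialHomeomorph M (E m)) (S : E m → E m →L[ℝ] E m)
    (P : M → MvPolynomial (Fin m) ℝ) (ξ q : E m) :
    phaseEval (straighten ψ S P) (ξ, q) = inChart P ψ ξ (S ξ q) := by
  rw [phaseEval, straighten, eval_linSubst, inChart_eq]
  congr 2
  funext i
  rw [ContinuousLinearMap.comp_apply, ← ContinuousLinearMap.adjoint_inner_left]
  simp [stdVec, EuclideanSpace.inner_single_right]

namespace IsStraightening

variable {g : PseudoMetric m M} {ψ : OpenPartialHomeomorph M (E m)} {S T : E m → E m →L[ℝ] E m}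
  {ρ : E m → ℝ} (hs : IsStraightening g ψ S T ρ) {ξ : E m}
include hs

lemma adjoint_chartDeriv (hξ : ξ ∈ ψ.target) (a : E m) :
    (chartDeriv ψ (ψ.symm ξ)).adjoint ((chartSymmDeriv ψ ξ).adjoint a) = a := by
  refine ext_inner_right ℝ fun v => ?_
  have h := hs.isChart.chartSymmDeriv_chartDeriv (ψ.map_target hξ) v
  rw [ψ.right_inv hξ] at h
  rw [ContinuousLinearMap.adjoint_inner_left, ContinuousLinearMap.adjoint_inner_left, h]

lemma adjoint_chartSymmDeriv (hξ : ξ ∈ ψ.target) (a : E m) :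
    (chartSymmDeriv ψ ξ).adjoint ((chartDeriv ψ (ψ.symm ξ)).adjoint a) = a := by
  refine ext_inner_right ℝ fun v => ?_
  rw [ContinuousLinearMap.adjoint_inner_left, ContinuousLinearMap.adjoint_inner_left,
    hs.isChart.chartDeriv_chartSymmDeriv hξ]

lemma inChart_unstraighten (A : E m → MvPolynomial (Fin m) ℝ) (hξ : ξ ∈ ψ.target) (a : E m) :
    inChart (unstraighten ψ T A) ψ ξ a = phaseEval A (ξ, T ξ a) := by
  rw [inChart_eq, unstraighten, ψ.right_inv hξ, phaseEval]
  have h1 : (fun i => ⟪a, chartDeriv ψ (ψ.symm ξ) (stdVec i)⟫)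
      = fun i => (chartDeriv ψ (ψ.symm ξ)).adjoint a i := by
    funext i
    rw [← ContinuousLinearMap.adjoint_inner_left]
    simp [stdVec, EuclideanSpace.inner_single_right]
  rw [h1, eval_linSubst, ContinuousLinearMap.comp_apply, hs.adjoint_chartSymmDeriv hξ]

lemma straighten_invertible (hξ : ξ ∈ ψ.target) :
    (∀ q, ((chartDeriv ψ (ψ.symm ξ)).adjoint.comp (S ξ))
      (((T ξ).comp (chartSymmDeriv ψ ξ).adjoint) q) = q) ∧
    ∀ q, ((T ξ).comp (chartSymmDeriv ψ ξ).adjoint)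
      (((chartDeriv ψ (ψ.symm ξ)).adjoint.comp (S ξ)) q) = q := by
  constructor
  · intro q
    simp only [ContinuousLinearMap.comp_apply]
    rw [hs.right_inv ξ hξ, hs.adjoint_chartDeriv hξ]
  · intro q
    simp only [ContinuousLinearMap.comp_apply]
    rw [hs.adjoint_chartSymmDeriv hξ, hs.left_inv ξ hξ]

lemma straighten_eq_zero_iff {P : M → MvPolynomial (Fin m) ℝ} (hξ : ξ ∈ ψ.target) :
    straighten ψ S P ξ = 0 ↔ P (ψ.symm ξ) = 0 :=
  linSubst_eq_zero_iff (hs.straighten_invertible hξ).1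

lemma isRelPrime_straighten {P Q : M → MvPolynomial (Fin m) ℝ} (hξ : ξ ∈ ψ.target)
    (h : IsRelPrime (P (ψ.symm ξ)) (Q (ψ.symm ξ))) :
    IsRelPrime (straighten ψ S P ξ) (straighten ψ S Q ξ) :=
  isRelPrime_linSubst (hs.straighten_invertible hξ).1 (hs.straighten_invertible hξ).2 h

lemma straighten_unstraighten (A : E m → MvPolynomial (Fin m) ℝ) (hξ : ξ ∈ ψ.target) :
    straighten ψ S (unstraighten ψ T A) ξ = A ξ :=
  eq_of_eval_eq_all fun q => by
    have h := phaseEval_straighten ψ S (unstraighten ψ T A) ξ q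
    rwa [hs.inChart_unstraighten A hξ, hs.left_inv ξ hξ] at h

lemma straighten_inj {p p' : M → MvPolynomial (Fin m) ℝ} (hξ : ξ ∈ ψ.target)
    (h : straighten ψ S p ξ = straighten ψ S p' ξ) : p (ψ.symm ξ) = p' (ψ.symm ξ) := by
  have h1 := (hs.straighten_invertible hξ).1
  rw [← linSubst_linSubst h1 (p (ψ.symm ξ)), ← linSubst_linSubst h1 (p' (ψ.symm ξ))]
  exact congrArg _ h

lemma contDiffOn_apply : ContDiffOn ℝ ∞ (fun z : E m × E m => S z.1 z.2) (ψ.target ×ˢ univ) :=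
  (hs.smooth.comp contDiffOn_fst fun _ hz => hz.1).clm_apply contDiffOn_snd

lemma contDiffOn_symm_apply :
    ContDiffOn ℝ ∞ (fun z : E m × E m => T z.1 z.2) (ψ.target ×ˢ univ) :=
  (hs.smooth_symm.comp contDiffOn_fst fun _ hz => hz.1).clm_apply contDiffOn_snd

lemma contDiffOn_straighten {U : Set M} {d : ℕ} {P : M → MvPolynomial (Fin m) ℝ}
    (hP : IsMomentumPolynomial U d P) {O : Set (E m)} (hO : O ⊆ ψ.target ∩ ψ.symm ⁻¹' U) :
    ContDiffOn ℝ ∞ (phaseEval (straighten ψ S P)) (O ×ˢ univ) := by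
  have h1 : ContDiffOn ℝ ∞ (fun z : E m × E m => ((z.1, S z.1 z.2) : E m × E m)) (O ×ˢ univ) :=
    contDiffOn_fst.prodMk (hs.contDiffOn_apply.mono (prod_mono (fun _ h => (hO h).1) Subset.rfl))
  exact ((hP.smooth ψ hs.isChart).comp h1 fun z hz => ⟨hO hz.1, mem_univ _⟩).congr
    fun z _ => phaseEval_straighten ψ S P z.1 z.2

/-- The bracket with the Hamiltonian in straight coordinates. -/
lemma poisson_eq_flowDeriv {U : Set M} (hU : IsOpen U) {d : ℕ} {P : M → MvPolynomial (Fin m) ℝ}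
    (hP : IsMomentumPolynomial U d P) (hξ : ξ ∈ ψ.target) (hξU : ψ.symm ξ ∈ U) (q : E m) :
    poisson (g.hamiltonian ψ) (inChart P ψ) ξ (S ξ q)
      = ρ ξ * flowDeriv (phaseEval (straighten ψ S P)) (ξ, q) := by
  have hO : IsOpen (ψ.target ∩ ψ.symm ⁻¹' U) := ψ.symm.isOpen_inter_preimage hU
  have hmem : (ξ, S ξ q) ∈ (ψ.target ∩ ψ.symm ⁻¹' U) ×ˢ (univ : Set (E m)) :=
    ⟨⟨hξ, hξU⟩, mem_univ _⟩
  rw [hs.poisson_eq _ ξ hξ q (((hP.smooth ψ hs.isChart).contDiffAt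
    ((hO.prod isOpen_univ).mem_nhds hmem)).differentiableAt (by simp)), flowDeriv]
  have h : (fun z : E m × E m => inChart P ψ z.1 (S z.1 z.2)) = phaseEval (straighten ψ S P) :=
    funext fun z => (phaseEval_straighten ψ S P z.1 z.2).symm
  rw [h]

end IsStraightening

end Straighten

/-! ### Rational integrals are locally quotients of Killing tensors. -/

section Local

variable {m : ℕ} {M : Type*} [TopologicalSpace M] [ChartedSpace (E m) M]

open scoped RealInnerProductSpace

lemma subset_closure_preimage_chart {ψ : OpenPartialHomeomorph M (E m)} {O : Set (E m)}
    (hO : IsOpen O) (hsub : O ⊆ ψ.target) {S : Set M} (h : ∀ ξ ∈ O, ψ.symm ξ ∈ closure S) :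
    O ⊆ closure {ξ ∈ O | ψ.symm ξ ∈ S} := by
  intro ξ hξ
  rw [mem_closure_iff]
  intro W hW hξW
  have h1 : IsOpen (ψ.source ∩ ψ ⁻¹' (O ∩ W)) := ψ.isOpen_inter_preimage (hO.inter hW)
  have h2 : ψ.symm ξ ∈ ψ.source ∩ ψ ⁻¹' (O ∩ W) :=
    ⟨ψ.map_target (hsub hξ), by
      rw [mem_preimage, ψ.right_inv (hsub hξ)]
      exact ⟨hξ, hξW⟩⟩
  obtain ⟨y, ⟨hy1, hy2⟩, hyS⟩ := mem_closure_iff.1 (h ξ hξ) _ h1 h2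
  exact ⟨ψ y, hy2.2, hy2.1, by rwa [ψ.left_inv hy1]⟩

lemma subset_closure_image_chart {ψ : OpenPartialHomeomorph M (E m)} {O S : Set (E m)}
    (hsub : O ⊆ ψ.target) (h : O ⊆ closure S) :
    ψ.symm '' O ⊆ closure (ψ.symm '' S) := by
  rintro _ ⟨ξ, hξ, rfl⟩
  exact ((ψ.continuousAt_symm (hsub hξ)).continuousWithinAt).mem_closure_image (h hξ)

lemma continuousOn_flowDeriv {O : Set (E m)} (hO : IsOpen O)
    {P : E m → MvPolynomial (Fin m) ℝ} (h : ContDiffOn ℝ ∞ (phaseEval P) (O ×ˢ univ)) :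
    ContinuousOn (flowDeriv (phaseEval P)) (O ×ˢ univ) := by
  have h1 : ContinuousOn (fderiv ℝ (phaseEval P)) (O ×ˢ univ) :=
    (h.fderiv_of_isOpen (m := ∞) (hO.prod isOpen_univ) (by simp)).continuousOn
  exact h1.clm_apply (by fun_prop)

/-- Over a generic position the denominator is a nonzero polynomial in q, hence nonzero at momenta
arbitrarily close to any given one. This extends the flow identity to phase points where the
denominator vanishes. -/
lemma prod_univ_subset_closure_ne_zero {O : Set (E m)} {Q : E m → MvPolynomial (Fin m) ℝ}
    (h : O ⊆ closure {ξ ∈ O | Q ξ ≠ 0}) :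
    O ×ˢ (univ : Set (E m)) ⊆ closure {z | z.1 ∈ O ∧ phaseEval Q z ≠ 0} := by
  rintro ⟨ξ, q⟩ ⟨hξ, -⟩
  rw [mem_closure_iff_nhds]
  intro W hW
  obtain ⟨W₁, hW₁, W₂, hW₂, hW₁₂⟩ := mem_nhds_prod_iff.1 hW
  obtain ⟨ζ, hζ, hζO, hζQ⟩ := mem_closure_iff_nhds.1 (h hξ) W₁ hW₁
  obtain ⟨V, hV, hVo, hqV⟩ := mem_nhds_iff.1 hW₂
  obtain ⟨q', hq', hne⟩ := exists_eval_ne_zero hVo ⟨q, hqV⟩ hζQ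
  exact ⟨(ζ, q'), hW₁₂ ⟨hζ, hV hq'⟩, hζO, hne⟩

lemma hasFDerivAt_div {X : Type*} [NormedAddCommGroup X] [NormedSpace ℝ X] {f h : X → ℝ} {x : X}
    (hf : DifferentiableAt ℝ f x) (hh : DifferentiableAt ℝ h x) (h0 : h x ≠ 0) :
    HasFDerivAt (fun z => f z / h z)
      ((h x ^ 2)⁻¹ • (h x • fderiv ℝ f x - f x • fderiv ℝ h x)) x := by
  have h1 : HasFDerivAt (fun z => f z * (h z)⁻¹) _ x :=
    hf.hasFDerivAt.mul ((hasDerivAt_inv h0).hasFDerivAt.comp x hh.hasFDerivAt)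
  simp only [div_eq_mul_inv]
  refine h1.congr_fderiv ?_
  ext v
  simp
  field_simp
  ring

/-- Where Q ≠ 0 the bracket of H with P/Q is ρ times the straight derivative of the ratio, and ρ ≠
0. The cleared identity makes sense everywhere and extends by continuity. -/
lemma IsRationalIntegral.isFlatPair {g : PseudoMetric m M} {U : Set M} (hU : IsOpen U) {r s : ℕ}
    {P Q : M → MvPolynomial (Fin m) ℝ} (h : IsRationalIntegral g U r s P Q)
    {ψ : OpenPartialHomeomorph M (E m)} {S T : E m → E m →L[ℝ] E m} {ρ : E m → ℝ}
    (hs : IsStraightening g ψ S T ρ) {O : Set (E m)} (hO : IsOpen O)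
    (hsub : O ⊆ ψ.target ∩ ψ.symm ⁻¹' U) :
    IsFlatPair O r s (straighten ψ S P) (straighten ψ S Q) := by
  have hPs := hs.contDiffOn_straighten h.numerator hsub
  have hQs := hs.contDiffOn_straighten h.denominator hsub
  have hd := subset_closure_preimage_chart hO (fun ξ hξ => (hsub hξ).1)
    fun ξ hξ => h.relPrime (hsub hξ).2
  refine ⟨hO, fun ξ hξ => isHomogeneous_linSubst _ (h.numerator.homogeneous _ (hsub hξ).2),
    fun ξ hξ => isHomogeneous_linSubst _ (h.denominator.homogeneous _ (hsub hξ).2), hPs, hQs, ?_,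
    hd.trans (closure_mono fun ξ hξ => ⟨hξ.1, hs.isRelPrime_straighten (hsub hξ.1).1 hξ.2.2.2⟩)⟩
  have hdQ : O ⊆ closure {ξ ∈ O | straighten ψ S Q ξ ≠ 0} := hd.trans (closure_mono fun ξ hξ =>
    ⟨hξ.1, fun h0 => hξ.2.2.1 ((hs.straighten_eq_zero_iff (hsub hξ.1).1).1 h0)⟩)
  have hcont : ContinuousOn (fun z => flowDeriv (phaseEval (straighten ψ S P)) z
      * phaseEval (straighten ψ S Q) z - phaseEval (straighten ψ S P) z
        * flowDeriv (phaseEval (straighten ψ S Q)) z) (O ×ˢ univ) :=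
    ((continuousOn_flowDeriv hO hPs).mul hQs.continuousOn).sub
      (hPs.continuousOn.mul (continuousOn_flowDeriv hO hQs))
  intro ξ hξ q
  refine sub_eq_zero.1 (eq_zero_of_subset_closure hcont (hO.prod isOpen_univ)
    (prod_univ_subset_closure_ne_zero hdQ) ?_ (ξ, q) ⟨hξ, mem_univ _⟩)
  rintro ⟨ξ, q⟩ ⟨hξ, hne⟩ -
  have hOU : IsOpen (ψ.target ∩ ψ.symm ⁻¹' U) := ψ.symm.isOpen_inter_preimage hU
  have hmem : (ξ, S ξ q) ∈ (ψ.target ∩ ψ.symm ⁻¹' U) ×ˢ (univ : Set (E m)) :=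
    ⟨hsub hξ, mem_univ _⟩
  have hPd : DifferentiableAt ℝ (fun z : E m × E m => inChart P ψ z.1 z.2) (ξ, S ξ q) :=
    ((h.numerator.smooth ψ hs.isChart).contDiffAt
      ((hOU.prod isOpen_univ).mem_nhds hmem)).differentiableAt (by simp)
  have hQd : DifferentiableAt ℝ (fun z : E m × E m => inChart Q ψ z.1 z.2) (ξ, S ξ q) :=
    ((h.denominator.smooth ψ hs.isChart).contDiffAt
      ((hOU.prod isOpen_univ).mem_nhds hmem)).differentiableAt (by simp)
  have hne' : inChart Q ψ ξ (S ξ q) ≠ 0 := by rwa [← phaseEval_straighten]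
  have h1 := h.integral ψ hs.isChart ξ (hsub hξ).1 (hsub hξ).2 _ hne'
  rw [hs.poisson_eq _ ξ (hsub hξ).1 q (hasFDerivAt_div hPd hQd hne').differentiableAt] at h1
  have h2 := (mul_eq_zero.1 h1).resolve_left (hs.ne_zero ξ (hsub hξ).1)
  have h3 : (fun z : E m × E m => inChart P ψ z.1 (S z.1 z.2) / inChart Q ψ z.1 (S z.1 z.2))
      = fun z => phaseEval (straighten ψ S P) z / phaseEval (straighten ψ S Q) z :=
    funext fun z => by rw [← phaseEval_straighten, ← phaseEval_straighten]
  rw [h3, (hasFDerivAt_div ((contDiffAt_phaseEval hO hPs hξ q).differentiableAt (by simp))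
    ((contDiffAt_phaseEval hO hQs hξ q).differentiableAt (by simp)) hne).fderiv] at h2
  simp only [smul_apply, sub_apply, smul_eq_mul] at h2
  have h4 := (mul_eq_zero.1 h2).resolve_left (inv_ne_zero (pow_ne_zero 2 hne))
  simp only [flowDeriv]
  linarith

/-- Being a Killing tensor can be checked in one chart. -/
lemma isKillingTensor_of_chart {g : PseudoMetric m M} {V : Set M} {d : ℕ}
    {K : M → MvPolynomial (Fin m) ℝ} {ψ : OpenPartialHomeomorph M (E m)} (hψ : IsChart ψ)
    (hV : V ⊆ ψ.source) (hhom : ∀ x ∈ V, (K x).IsHomogeneous d)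
    (hK : ∀ x ∈ V, ∀ a, ContDiffAt ℝ ∞ (fun z : E m × E m => inChart K ψ z.1 z.2) (ψ x, a) ∧
      poisson (g.hamiltonian ψ) (inChart K ψ) (ψ x) a = 0) : IsKillingTensor g V d K := by
  refine ⟨⟨hhom, fun φ hφ z hz => ?_⟩, fun φ hφ u hu hx a => ?_⟩
  · obtain ⟨⟨hz1, hz2⟩, -⟩ := hz
    exact (contDiffAt_inChart_transition hφ hψ hz1 (hV hz2) (fun a => (hK _ hz2 a).1)
      z.2).contDiffWithinAt
  · have h1 := poisson_transition g hφ hψ hu (hV hx) (fun a => (hK _ hx a).1)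
      ((fderiv ℝ (transition ψ φ) (transition φ ψ u)).adjoint a)
    have h2 : (fderiv ℝ (transition φ ψ) u).adjoint
        ((fderiv ℝ (transition ψ φ) (transition φ ψ u)).adjoint a) = a := by
      refine ext_inner_right ℝ fun v => ?_
      obtain ⟨h2, h3⟩ := transition_mem hu (hV hx)
      rw [ContinuousLinearMap.adjoint_inner_left, ContinuousLinearMap.adjoint_inner_left,
        fderiv_transition hψ hφ h2 h3, ContinuousLinearMap.comp_apply,
        chartSymmDeriv_fderiv_transition hφ hψ hu (hV hx)]
      have : ψ.symm (transition φ ψ u) = φ.symm u := ψ.left_inv (hV hx)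
      rw [this, hφ.chartDeriv_chartSymmDeriv hu]
    rw [h2] at h1
    rw [← h1]
    exact (hK _ hx _).2

/-- In the coordinates (ξ, q) the bracket with H is a multiple of the line derivation, which kills
A. -/
lemma IsStraightening.isKillingTensor_unstraighten {g : PseudoMetric m M}
    {ψ : OpenPartialHomeomorph M (E m)} {S T : E m → E m →L[ℝ] E m} {ρ : E m → ℝ}
    (hs : IsStraightening g ψ S T ρ) {V : Set M} (hV : V ⊆ ψ.source) {d : ℕ} {A : PhasePoly m}
    (hA : lineDerivation A = 0) (hd : ∀ ξ, (evalBase ξ A).IsHomogeneous d) :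
    IsKillingTensor g V d (unstraighten ψ T fun ξ => evalBase ξ A) := by
  refine isKillingTensor_of_chart hs.isChart hV (fun x _ => isHomogeneous_linSubst _ (hd _)) ?_
  intro x hx a
  have hξ : ψ x ∈ ψ.target := ψ.map_source (hV hx)
  have hsm : ContDiffOn ℝ ∞ (fun z : E m × E m =>
      inChart (unstraighten ψ T fun ξ => evalBase ξ A) ψ z.1 z.2) (ψ.target ×ˢ univ) :=
    ((contDiff_phaseEval_evalBase A).comp_contDiffOn
      (contDiffOn_fst.prodMk hs.contDiffOn_symm_apply)).congr
      fun z hz => hs.inChart_unstraighten _ hz.1 z.2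
  have hat : ∀ a, ContDiffAt ℝ ∞ (fun z : E m × E m =>
      inChart (unstraighten ψ T fun ξ => evalBase ξ A) ψ z.1 z.2) (ψ x, a) := fun a =>
    hsm.contDiffAt ((ψ.open_target.prod isOpen_univ).mem_nhds ⟨hξ, mem_univ _⟩)
  refine ⟨hat a, ?_⟩
  have h1 := hs.poisson_eq _ (ψ x) hξ (T (ψ x) a) ((hat _).differentiableAt (by simp))
  rw [hs.right_inv _ hξ] at h1
  rw [h1]
  have h2 : (fun z : E m × E m =>
      inChart (unstraighten ψ T fun ξ => evalBase ξ A) ψ z.1 (S z.1 z.2))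
      =ᶠ[𝓝 (ψ x, T (ψ x) a)] phaseEval fun ξ => evalBase ξ A := by
    filter_upwards [(ψ.open_target.prod isOpen_univ).mem_nhds
      (⟨hξ, mem_univ _⟩ : (ψ x, T (ψ x) a) ∈ ψ.target ×ˢ univ)] with z hz
    rw [hs.inChart_unstraighten _ hz.1, hs.left_inv _ hz.1]
  rw [h2.fderiv_eq]
  have h3 := flowDeriv_phaseEval_evalBase A (ψ x, T (ψ x) a)
  rw [flowDeriv, hA] at h3
  rw [h3]
  simp [phaseEval]

/-- Two generically relatively prime Killing tensors. -/
structure IsKillingPair (g : PseudoMetric m M) (V : Set M) (r s : ℕ)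
    (A B : M → MvPolynomial (Fin m) ℝ) : Prop where
  left : IsKillingTensor g V r A
  right : IsKillingTensor g V s B
  relPrime : GenericallyRelPrime V A B

lemma exists_ball_chart {ψ : OpenPartialHomeomorph M (E m)} {x : M} (hx : x ∈ ψ.source) {U : Set M}
    (hU : IsOpen U) (hxU : x ∈ U) :
    ∃ δ > 0, Metric.ball (ψ x) δ ⊆ ψ.target ∩ ψ.symm ⁻¹' U := by
  refine Metric.isOpen_iff.1 (ψ.symm.isOpen_inter_preimage hU) (ψ x) ⟨ψ.map_source hx, ?_⟩
  rwa [mem_preimage, ψ.left_inv hx]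

lemma isOpen_symm_image {ψ : OpenPartialHomeomorph M (E m)} {O : Set (E m)} (hO : IsOpen O)
    (hsub : O ⊆ ψ.target) : IsOpen (ψ.symm '' O) :=
  ψ.symm.isOpen_image_of_subset_source hO hsub

variable [IsManifold (𝓡 m) ∞ M]

/-- A rational integral is locally a quotient of Killing tensors. -/
lemma IsRationalIntegral.exists_isKillingPair {g : PseudoMetric m M}
    (hg : g.HasConstantCurvature) {U : Set M} (hU : IsOpen U) {r s : ℕ}
    {P Q : M → MvPolynomial (Fin m) ℝ} (h : IsRationalIntegral g U r s P Q) {x : M} (hx : x ∈ U) :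
    ∃ (V : Set M) (A B : M → MvPolynomial (Fin m) ℝ), IsOpen V ∧ x ∈ V ∧ V ⊆ U ∧
      IsKillingPair g V r s A B ∧ SameFraction V P Q A B := by
  obtain ⟨ψ, S, T, ρ, hxψ, hs⟩ := exists_isStraightening g hg x
  obtain ⟨δ, hδ, hsub⟩ := exists_ball_chart hxψ hU hx
  set O := Metric.ball (ψ x) δ with hO
  have hOo : IsOpen O := Metric.isOpen_ball
  have hxO : ψ x ∈ O := Metric.mem_ball_self hδ
  have hOt : O ⊆ ψ.target := fun ξ hξ => (hsub hξ).1
  have hVo : IsOpen (ψ.symm '' O) := isOpen_symm_image hOo hOt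
  have hVU : ψ.symm '' O ⊆ U := by
    rintro _ ⟨ξ, hξ, rfl⟩
    exact (hsub hξ).2
  have hVs : ψ.symm '' O ⊆ ψ.source := by
    rintro _ ⟨ξ, hξ, rfl⟩
    exact ψ.map_target (hOt hξ)
  have hflat := h.isFlatPair hU hs hOo hsub
  -- The non-separation hypothesis is used on the image of a coordinate ball and carried back
  -- through ψ.
  have hconn : IsPreconnected (O \ {ξ | straighten ψ S P ξ = 0 ∧ straighten ψ S Q ξ = 0}) := by
    have h1 := h.commonZeros (ψ.symm '' O) hVU hVo
      ((convex_ball _ _).isPreconnected.image _ (ψ.symm.continuousOn.mono hOt))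
    have h2 := h1.image ψ (ψ.continuousOn.mono (sdiff_subset.trans hVs))
    convert h2 using 1
    ext ξ
    constructor
    · rintro ⟨hξ, hne⟩
      refine ⟨ψ.symm ξ, ⟨⟨ξ, hξ, rfl⟩, fun h0 => hne ?_⟩, ψ.right_inv (hOt hξ)⟩
      exact ⟨(hs.straighten_eq_zero_iff (hOt hξ)).2 h0.1,
        (hs.straighten_eq_zero_iff (hOt hξ)).2 h0.2⟩
    · rintro ⟨_, ⟨⟨ζ, hζ, rfl⟩, hne⟩, rfl⟩
      rw [ψ.right_inv (hOt hζ)]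
      exact ⟨hζ, fun h0 => hne ⟨(hs.straighten_eq_zero_iff (hOt hζ)).1 h0.1,
        (hs.straighten_eq_zero_iff (hOt hζ)).1 h0.2⟩⟩
  obtain ⟨A, B, hAB, hid⟩ := hflat.exists_pair ⟨_, hxO⟩ hconn
  have hd : O ⊆ closure {ξ ∈ O | straighten ψ S Q ξ ≠ 0 ∧
      IsRelPrime (straighten ψ S P ξ) (straighten ψ S Q ξ)} :=
    (subset_closure_preimage_chart hOo hOt fun ξ hξ => h.relPrime (hsub hξ).2).trans
      (closure_mono fun ξ hξ => ⟨hξ.1,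
        fun h0 => hξ.2.2.1 ((hs.straighten_eq_zero_iff (hOt hξ.1)).1 h0),
        hs.isRelPrime_straighten (hOt hξ.1) hξ.2.2.2⟩)
  have hd' := hAB.dense_isRelPrime hOo ⟨_, hxO⟩ hflat.homogeneous_right hd hid
  refine ⟨ψ.symm '' O, unstraighten ψ T fun ξ => evalBase ξ A,
    unstraighten ψ T fun ξ => evalBase ξ B, hVo, ⟨ψ x, hxO, ψ.left_inv hxψ⟩, hVU,
    ⟨hs.isKillingTensor_unstraighten hVs hAB.lineDerivation_left hAB.homogeneous_left,
      hs.isKillingTensor_unstraighten hVs hAB.lineDerivation_right hAB.homogeneous_right, ?_⟩, ?_⟩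
  · refine (subset_closure_image_chart hOt hd').trans (closure_mono ?_)
    rintro _ ⟨ξ, ⟨hξ, hne, hrel⟩, rfl⟩
    obtain ⟨i1, i2⟩ := hs.straighten_invertible (hOt hξ)
    refine ⟨⟨ξ, hξ, rfl⟩, ?_, ?_⟩
    · rw [unstraighten, ψ.right_inv (hOt hξ)]
      exact fun h0 => hne ((linSubst_eq_zero_iff i2).1 h0)
    · rw [unstraighten, unstraighten, ψ.right_inv (hOt hξ)]
      exact isRelPrime_linSubst i2 i1 hrel
  · rintro _ ⟨ξ, hξ, rfl⟩
    have hξt := hOt hξ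
    -- Straightening is injective and multiplicative on fibres, so the fraction identity may be
    -- checked in straight coordinates.
    refine hs.straighten_inj (p := fun x => P x * unstraighten ψ T (fun ξ => evalBase ξ B) x)
      (p' := fun x => unstraighten ψ T (fun ξ => evalBase ξ A) x * Q x) hξt ?_
    have hmul : ∀ p p' : M → MvPolynomial (Fin m) ℝ, straighten ψ S (fun x => p x * p' x) ξ
        = straighten ψ S p ξ * straighten ψ S p' ξ := fun p p' => map_mul _ _ _
    rw [hmul, hmul, hs.straighten_unstraighten _ hξt, hs.straighten_unstraighten _ hξt, hid ξ hξ]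

end Local

/-! ### Vanishing of locally constant cocycles. -/

section Gluing

/-- A locally constant cocycle on a simply connected space is a coboundary. -/
theorem exists_locallyConstant_of_cocycle {X ι G : Type*} [TopologicalSpace X]
    [SimplyConnectedSpace X] [LocallyPathConnectedSpace X] [Group G] (V : ι → Set X)
    (hV : ∀ i, IsOpen (V i)) (idx : X → ι) (hidx : ∀ x, x ∈ V (idx x)) (c : ι → ι → X → G)
    (hc : ∀ i j, ∀ x ∈ V i ∩ V j, ∀ᶠ y in 𝓝 x, c i j y = c i j x)
    (hcomp : ∀ i j k, ∀ x ∈ V i ∩ V j ∩ V k, c i j x * c j k x = c i k x) :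
    ∃ h : ι → X → G, (∀ i, ∀ x ∈ V i, ∀ᶠ y in 𝓝 x, h i y = h i x) ∧
      ∀ i j, ∀ x ∈ V i ∩ V j, h i x * c i j x = h j x := by
  -- With G discrete, right multiplication by the locally constant cocycle gives transition maps of
  -- a fibre bundle, and such a bundle is a covering.
  let _ : TopologicalSpace G := ⊥
  have _ : DiscreteTopology G := ⟨rfl⟩
  let Z : FiberBundleCore ι X G :=
    { baseSet := V
      isOpen_baseSet := hV
      indexAt := idx
      mem_baseSet_at := hidx
      coordChange := fun i j x v => v * c i j x
      coordChange_self := fun i x hx v => by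
        have h1 := hcomp i i i x ⟨⟨hx, hx⟩, hx⟩
        rw [mul_eq_left.1 h1, mul_one]
      continuousOn_coordChange := fun i j => by
        rintro ⟨x, v⟩ ⟨hx, -⟩
        refine ContinuousAt.continuousWithinAt ?_
        have h1 : ∀ᶠ p : X × G in 𝓝 (x, v), p.2 * c i j p.1 = v * c i j x := by
          have h2 : ∀ᶠ p : X × G in 𝓝 (x, v), c i j p.1 = c i j x :=
            (continuous_fst.tendsto (x, v)).eventually (hc i j x hx)
          have h3 : ∀ᶠ p : X × G in 𝓝 (x, v), p.2 = v :=
            (continuous_snd.tendsto (x, v)).eventually (p := fun w => w = v) (by simp)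
          filter_upwards [h2, h3] with p hp hp'
          rw [hp, hp']
        exact (continuousAt_const (y := v * c i j x)).congr
          (h1.mono fun p hp => hp.symm)
      coordChange_comp := fun i j k x hx v => by
        rw [mul_assoc, hcomp i j k x hx] }
  have hcov : IsCoveringMap (Bundle.TotalSpace.proj : Bundle.TotalSpace G Z.Fiber → X) :=
    FiberBundle.isCoveringMap
  obtain ⟨x₀⟩ : Nonempty X := inferInstance
  -- Simple connectedness lifts the identity of X to a global section; its coordinates in the
  -- trivialisations are the functions h i.
  obtain ⟨s, ⟨-, hs⟩, -⟩ := hcov.existsUnique_continuousMap_lifts (ContinuousMap.id X) x₀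
    (⟨x₀, (1 : G)⟩ : Bundle.TotalSpace G Z.Fiber) rfl
  have hproj : ∀ x, (s x).proj = x := fun x => congrFun hs x
  let f : X → G := fun x => (s x).2
  have hfib : ∀ i x, x ∈ V i → (Z.localTriv i (s x)).2 = f x * c (idx x) i x := by
    intro i x hx
    rw [Z.localTriv_apply i (s x)]
    change f x * c (idx (s x).proj) i (s x).proj = _
    rw [hproj]
  refine ⟨fun i x => (Z.localTriv i (s x)).2, fun i x hx => ?_, fun i j x hx => ?_⟩
  · have h1 : ContinuousAt (fun y => (Z.localTriv i (s y)).2) x := by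
      refine continuous_snd.continuousAt.comp (ContinuousAt.comp (g := Z.localTriv i) ?_
        s.continuous.continuousAt)
      refine (Z.localTriv i).continuousAt ?_
      rw [Z.mem_localTriv_source, hproj]
      exact hx
    exact h1.eventually (p := fun w => w = (Z.localTriv i (s x)).2) (by simp)
  · change (Z.localTriv i (s x)).2 * c i j x = (Z.localTriv j (s x)).2
    rw [hfib i x hx.1, hfib j x hx.2, mul_assoc, hcomp (idx x) i j x ⟨⟨hidx x, hx.1⟩, hx.2⟩]

end Gluing

/-! ### Uniqueness up to constants and the global Killing pair. -/

section LocalConstants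

variable {m : ℕ} {M : Type*} [TopologicalSpace M] [ChartedSpace (E m) M]

lemma poisson_congr (H : E m → E m → ℝ) {F F' : E m → E m → ℝ} {u : E m}
    (h : ∀ᶠ y in 𝓝 u, ∀ b, F y b = F' y b) (a : E m) : poisson H F u a = poisson H F' u a := by
  have h1 : ∀ i, pd i (fun y => F y a) u = pd i (fun y => F' y a) u := fun i => by
    rw [pd, pd, Filter.EventuallyEq.fderiv_eq (h.mono fun y hy => hy a)]
  have h2 : (fun b => F u b) = fun b => F' u b := funext h.self_of_nhds
  simp only [poisson, h1, h2]

lemma poisson_const_mul (H F : E m → E m → ℝ) (c : ℝ) (u a : E m) :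
    poisson H (fun y b => c * F y b) u a = c * poisson H F u a := by
  have h : ∀ f : E m → ℝ, fderiv ℝ (fun y => c * f y) = c • fderiv ℝ f := fun f => by
    funext y
    exact congrFun (fderiv_const_smul_field c) y
  simp only [poisson, pd, h, Pi.smul_apply, smul_apply, smul_eq_mul, Finset.mul_sum]
  exact Finset.sum_congr rfl fun i _ => by ring

/-- Being a Killing tensor is a local property, invariant under multiplication by constants. -/
lemma isKillingTensor_of_locally {g : PseudoMetric m M} {U : Set M} {d : ℕ}
    {K : M → MvPolynomial (Fin m) ℝ}
    (h : ∀ x ∈ U, ∃ (V : Set M) (A : M → MvPolynomial (Fin m) ℝ) (c : ℝ), IsOpen V ∧ x ∈ V ∧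
      IsKillingTensor g V d A ∧ ∀ y ∈ V, K y = MvPolynomial.C c * A y) :
    IsKillingTensor g U d K := by
  have key : ∀ {V : Set M} {A : M → MvPolynomial (Fin m) ℝ} {c : ℝ}
      {φ : OpenPartialHomeomorph M (E m)} {u : E m}, IsOpen V → u ∈ φ.target → φ.symm u ∈ V →
      (∀ y ∈ V, K y = MvPolynomial.C c * A y) →
      ∀ᶠ y in 𝓝 u, ∀ b, inChart K φ y b = c * inChart A φ y b := by
    intro V A c φ u hV hu hx hK
    filter_upwards [(φ.continuousAt_symm hu).eventually (hV.mem_nhds hx)] with y hy b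
    rw [inChart_eq, inChart_eq, hK _ hy]
    simp
  refine ⟨⟨fun x hx => ?_, fun φ hφ z hz => ?_⟩, fun φ hφ u hu hx a => ?_⟩
  · obtain ⟨V, A, c, hV, hxV, hA, hK⟩ := h x hx
    rw [hK x hxV]
    simpa using (MvPolynomial.isHomogeneous_C (Fin m) c).mul (hA.polynomial.homogeneous x hxV)
  · obtain ⟨⟨hz1, hz2⟩, -⟩ := hz
    obtain ⟨V, A, c, hV, hxV, hA, hK⟩ := h _ hz2
    have hmem : z ∈ (φ.target ∩ φ.symm ⁻¹' V) ×ˢ (univ : Set (E m)) := ⟨⟨hz1, hxV⟩, mem_univ _⟩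
    have h1 := (hA.polynomial.smooth φ hφ).contDiffAt
      (((φ.symm.isOpen_inter_preimage hV).prod isOpen_univ).mem_nhds hmem)
    refine ((contDiffAt_const (c := c)).mul h1).congr_of_eventuallyEq ?_ |>.contDiffWithinAt
    filter_upwards [(continuous_fst.tendsto z).eventually (key hV hz1 hxV hK)] with y hy
    exact hy _
  · obtain ⟨V, A, c, hV, hxV, hA, hK⟩ := h _ hx
    rw [poisson_congr _ (key hV hu hxV hK), poisson_const_mul, hA.integral φ hφ u hu hxV, mul_zero]

lemma IsKillingTensor.mono {g : PseudoMetric m M} {U V : Set M} (hVU : V ⊆ U) {d : ℕ}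
    {K : M → MvPolynomial (Fin m) ℝ} (h : IsKillingTensor g U d K) : IsKillingTensor g V d K :=
  ⟨⟨fun x hx => h.polynomial.homogeneous x (hVU hx), fun φ hφ => (h.polynomial.smooth φ hφ).mono
    (prod_mono (fun _ hy => ⟨hy.1, hVU hy.2⟩) Subset.rfl)⟩,
    fun φ hφ u hu hx => h.integral φ hφ u hu (hVU hx)⟩

lemma GenericallyRelPrime.mono {U V : Set M} (hV : IsOpen V) (hVU : V ⊆ U)
    {A B : M → MvPolynomial (Fin m) ℝ} (h : GenericallyRelPrime U A B) :
    GenericallyRelPrime V A B :=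
  (subset_closure_inter_of_isOpen hV hVU h).trans (closure_mono fun _ hx => ⟨hx.1, hx.2.2⟩)

lemma IsKillingPair.mono {g : PseudoMetric m M} {U V : Set M} (hV : IsOpen V) (hVU : V ⊆ U)
    {r s : ℕ} {A B : M → MvPolynomial (Fin m) ℝ} (h : IsKillingPair g U r s A B) :
    IsKillingPair g V r s A B :=
  ⟨h.left.mono hVU, h.right.mono hVU, h.relPrime.mono hV hVU⟩

lemma IsStraightening.flowDeriv_eq_zero {g : PseudoMetric m M} {ψ : OpenPartialHomeomorph M (E m)}
    {S T : E m → E m →L[ℝ] E m} {ρ : E m → ℝ} (hs : IsStraightening g ψ S T ρ) {V : Set M}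
    (hV : IsOpen V) {d : ℕ} {K : M → MvPolynomial (Fin m) ℝ} (hK : IsKillingTensor g V d K)
    {ξ : E m} (hξ : ξ ∈ ψ.target) (hξV : ψ.symm ξ ∈ V) (q : E m) :
    flowDeriv (phaseEval (straighten ψ S K)) (ξ, q) = 0 := by
  have h1 := hs.poisson_eq_flowDeriv hV hK.polynomial hξ hξV q
  rw [hK.integral ψ hs.isChart ξ hξ hξV] at h1
  exact (mul_eq_zero.1 h1.symm).resolve_left (hs.ne_zero ξ hξ)

lemma IsStraightening.dense_straighten {g : PseudoMetric m M} {ψ : OpenPartialHomeomorph M (E m)}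
    {S T : E m → E m →L[ℝ] E m} {ρ : E m → ℝ} (hs : IsStraightening g ψ S T ρ) {U : Set M}
    {A B : M → MvPolynomial (Fin m) ℝ} (h : GenericallyRelPrime U A B) {O : Set (E m)}
    (hO : IsOpen O) (hsub : O ⊆ ψ.target ∩ ψ.symm ⁻¹' U) :
    O ⊆ closure {ξ ∈ O | straighten ψ S B ξ ≠ 0 ∧
      IsRelPrime (straighten ψ S A ξ) (straighten ψ S B ξ)} :=
  (subset_closure_preimage_chart hO (fun _ hξ => (hsub hξ).1) fun _ hξ => h (hsub hξ).2).trans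
    (closure_mono fun _ hξ => ⟨hξ.1,
      fun h0 => hξ.2.2.1 ((hs.straighten_eq_zero_iff (hsub hξ.1).1).1 h0),
      hs.isRelPrime_straighten (hsub hξ.1).1 hξ.2.2.2⟩)

variable [IsManifold (𝓡 m) ∞ M]

/-- Two representations of a fraction by Killing tensors differ locally by a constant. -/
lemma exists_const_of_sameFraction {g : PseudoMetric m M} (hg : g.HasConstantCurvature) {V : Set M}
    (hV : IsOpen V) {r s : ℕ} {P Q A B A' B' : M → MvPolynomial (Fin m) ℝ}
    (hPQ : GenericallyRelPrime V P Q) (h : IsKillingPair g V r s A B)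
    (h' : IsKillingPair g V r s A' B') (hid : SameFraction V P Q A B)
    (hid' : SameFraction V P Q A' B') {x : M} (hx : x ∈ V) :
    ∃ c : ℝ, c ≠ 0 ∧ ∀ᶠ y in 𝓝 x, A y = MvPolynomial.C c * A' y ∧ B y = MvPolynomial.C c * B' y := by
  obtain ⟨ψ, S, T, ρ, hxψ, hs⟩ := exists_isStraightening g hg x
  obtain ⟨δ, hδ, hsub⟩ := exists_ball_chart hxψ hV hx
  set O := Metric.ball (ψ x) δ with hO
  have hOo : IsOpen O := Metric.isOpen_ball
  have hxO : ψ x ∈ O := Metric.mem_ball_self hδ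
  have hOt : O ⊆ ψ.target := fun ξ hξ => (hsub hξ).1
  have hsm : ∀ {d : ℕ} {K : M → MvPolynomial (Fin m) ℝ}, IsKillingTensor g V d K →
      ContDiffOn ℝ ∞ (phaseEval (straighten ψ S K)) (O ×ˢ univ) := fun hK =>
    hs.contDiffOn_straighten hK.polynomial hsub
  have hfrac : ∀ {A B : M → MvPolynomial (Fin m) ℝ}, SameFraction V P Q A B → ∀ ξ ∈ O,
      straighten ψ S P ξ * straighten ψ S B ξ = straighten ψ S A ξ * straighten ψ S Q ξ := by
    intro A B hid ξ hξ
    exact ((map_mul _ _ _).symm.trans (congrArg _ (hid _ (hsub hξ).2))).trans (map_mul _ _ _)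
  have hratio : ∀ ξ ∈ O, straighten ψ S A ξ * straighten ψ S B' ξ
      = straighten ψ S A' ξ * straighten ψ S B ξ := by
    -- Q can be cancelled only where it is nonzero; this is a dense set, and continuity does the
    -- rest.
    refine eq_of_eq_on_dense hOo (hs.dense_straighten hPQ hOo hsub)
      (fun q => continuousOn_phaseEval_mul (continuousOn_phaseEval (hsm h.left) q)
        (continuousOn_phaseEval (hsm h'.right) q))
      (fun q => continuousOn_phaseEval_mul (continuousOn_phaseEval (hsm h'.left) q)
        (continuousOn_phaseEval (hsm h.right) q)) ?_
    rintro ξ ⟨hξ, hne, -⟩ -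
    refine mul_right_cancel₀ hne ?_
    linear_combination (-straighten ψ S B' ξ) * hfrac hid ξ hξ
      + straighten ψ S B ξ * hfrac hid' ξ hξ
  have hhom : ∀ {d : ℕ} {K : M → MvPolynomial (Fin m) ℝ}, IsKillingTensor g V d K →
      ∀ ξ ∈ O, (straighten ψ S K ξ).IsHomogeneous d := fun hK ξ hξ =>
    isHomogeneous_linSubst _ (hK.polynomial.homogeneous _ (hsub hξ).2)
  obtain ⟨c, hc, H⟩ := exists_const_of_same_ratio hOo (convex_ball _ _) ⟨_, hxO⟩ (hsm h.left)
    (hsm h.right) (hsm h'.left) (hsm h'.right) (hhom h.right) (hhom h'.right)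
    (fun ξ hξ => hs.flowDeriv_eq_zero hV h.right (hsub hξ).1 (hsub hξ).2)
    (fun ξ hξ => hs.flowDeriv_eq_zero hV h'.right (hsub hξ).1 (hsub hξ).2) hratio
    ((hs.dense_straighten h.relPrime hOo hsub).trans (closure_mono fun ξ hξ => ⟨hξ.1, hξ.2.1⟩))
    (hs.dense_straighten h'.relPrime hOo hsub)
  refine ⟨c, hc, ?_⟩
  have hC : ∀ (K : M → MvPolynomial (Fin m) ℝ) (ξ : E m),
      straighten ψ S (fun x => MvPolynomial.C c * K x) ξ
        = MvPolynomial.C c * straighten ψ S K ξ := fun K ξ => by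
    refine (map_mul (linSubst _) _ _).trans ?_
    congr 1
    exact AlgHom.commutes (linSubst _) c
  filter_upwards [(isOpen_symm_image hOo hOt).mem_nhds ⟨ψ x, hxO, ψ.left_inv hxψ⟩]
  rintro _ ⟨ξ, hξ, rfl⟩
  exact ⟨hs.straighten_inj (p := A) (p' := fun x => MvPolynomial.C c * A' x) (hOt hξ)
      (by rw [hC, (H ξ hξ).1]),
    hs.straighten_inj (p := B) (p' := fun x => MvPolynomial.C c * B' x) (hOt hξ)
      (by rw [hC, (H ξ hξ).2])⟩

-- The proportionality constant is determined by the germs, as B' is nonzero arbitrarily near x.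
-- This makes the chosen constants locally constant and multiplicative on triple overlaps.
omit [ChartedSpace (E m) M] [IsManifold (𝓡 m) ∞ M] in
lemma eq_of_eventually_eq_C_mul {B B' : M → MvPolynomial (Fin m) ℝ} {x : M}
    (hx : x ∈ closure {y | B' y ≠ 0}) {c c' : ℝ} (h : ∀ᶠ y in 𝓝 x, B y = MvPolynomial.C c * B' y)
    (h' : ∀ᶠ y in 𝓝 x, B y = MvPolynomial.C c' * B' y) : c = c' := by
  obtain ⟨y, ⟨h1, h2⟩, hy⟩ := mem_closure_iff_nhds.1 hx _ (h.and h')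
  exact MvPolynomial.C_injective _ _ (mul_right_cancel₀ hy (h1.symm.trans h2))

/-- On a simply connected set, a rational integral is globally a quotient of Killing tensors. -/
theorem IsRationalIntegral.exists_global_isKillingPair {g : PseudoMetric m M}
    (hg : g.HasConstantCurvature) {U : Set M} (hU : IsOpen U) [SimplyConnectedSpace U] {r s : ℕ}
    {P Q : M → MvPolynomial (Fin m) ℝ} (h : IsRationalIntegral g U r s P Q) :
    ∃ A B : M → MvPolynomial (Fin m) ℝ, IsKillingPair g U r s A B ∧ SameFraction U P Q A B := by
  classical
  choose V A B hVo hxV hVU hAB hfrac using fun x : U => h.exists_isKillingPair hg hU x.2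
  have hcl : ∀ i, ∀ x ∈ V i, x ∈ closure {y | B i y ≠ 0} := fun i x hx =>
    closure_mono (fun y hy => hy.2.1) ((hAB i).relPrime hx)
  have hconst : ∀ i j : U, ∀ x : U, ∃ c : ℝˣ, (x : M) ∈ V i ∩ V j → ∀ᶠ y in 𝓝 (x : M),
      A i y = MvPolynomial.C (c : ℝ) * A j y ∧ B i y = MvPolynomial.C (c : ℝ) * B j y := by
    intro i j x
    by_cases hx : (x : M) ∈ V i ∩ V j
    · have ho := (hVo i).inter (hVo j)
      obtain ⟨c, hc, H⟩ := exists_const_of_sameFraction hg ho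
        (h.relPrime.mono ho (inter_subset_left.trans (hVU i))) ((hAB i).mono ho inter_subset_left)
        ((hAB j).mono ho inter_subset_right) (fun y hy => hfrac i y hy.1)
        (fun y hy => hfrac j y hy.2) hx
      exact ⟨Units.mk0 c hc, fun _ => H⟩
    · exact ⟨1, fun hx' => absurd hx' hx⟩
  choose c hc using hconst
  have : LocallyPathConnectedSpace M := ChartedSpace.locallyPathConnectedSpace (E m) M
  have : LocallyPathConnectedSpace U := hU.locallyPathConnectedSpace
  obtain ⟨k, hk, hkc⟩ := exists_locallyConstant_of_cocycle (fun i : U => ((↑) : U → M) ⁻¹' V i)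
    (fun i => (hVo i).preimage continuous_subtype_val) id (fun x => hxV x) c
    (fun i j x hx => by
      have h1 : ∀ᶠ z in 𝓝 (x : M), z ∈ V i ∩ V j ∧
          ∀ᶠ w in 𝓝 z, A i w = MvPolynomial.C (c i j x : ℝ) * A j w ∧
            B i w = MvPolynomial.C (c i j x : ℝ) * B j w :=
        (((hVo i).inter (hVo j)).eventually_mem hx).and (hc i j x hx).eventually_nhds
      filter_upwards [(continuous_subtype_val.tendsto x).eventually h1] with y hy
      exact Units.ext (eq_of_eventually_eq_C_mul (hcl j y hy.1.2)
        ((hc i j y hy.1).mono fun _ h => h.2) (hy.2.mono fun _ h => h.2)))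
    (fun i j l x hx => by
      have h1 := hc i j x ⟨hx.1.1, hx.1.2⟩
      have h2 := hc j l x ⟨hx.1.2, hx.2⟩
      refine Units.ext (eq_of_eventually_eq_C_mul (hcl l x hx.2) (B := B i) ?_
        ((hc i l x ⟨hx.1.1, hx.2⟩).mono fun _ h => h.2))
      filter_upwards [h1, h2] with y hy1 hy2
      rw [hy1.2, hy2.2, Units.val_mul, map_mul, mul_assoc])
  have hglob : ∀ K : U → M → MvPolynomial (Fin m) ℝ,
      (∀ i j (x : U), (x : M) ∈ V i ∩ V j → K i x = MvPolynomial.C (c i j x : ℝ) * K j x) →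
      ∃ L : M → MvPolynomial (Fin m) ℝ, ∀ i : U, ∀ x : U, (x : M) ∈ V i →
        L x = MvPolynomial.C (k i x : ℝ) * K i x := by
    intro K hK
    -- At x use the pair chosen for x itself. The rescaled pairs agree on overlaps: K i = c i j K j
    -- and k i c i j = k j give k i K i = k j K j. The value 0 off U is immaterial.
    refine ⟨fun x => if hx : x ∈ U then
      MvPolynomial.C (k ⟨x, hx⟩ ⟨x, hx⟩ : ℝ) * K ⟨x, hx⟩ x else 0, fun i x hx => ?_⟩
    simp only [x.2, dite_true]
    rw [← hkc x i x ⟨hxV x, hx⟩, hK x i x ⟨hxV x, hx⟩, Units.val_mul, map_mul, mul_assoc]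
  obtain ⟨A', hA'⟩ := hglob A fun i j x hx => (hc i j x hx).self_of_nhds.1
  obtain ⟨B', hB'⟩ := hglob B fun i j x hx => (hc i j x hx).self_of_nhds.2
  -- Near x the factor k is constant, so the glued tensors are constant multiples of one local pair.
  have hloc : ∀ x : U, ∃ W : Set M, IsOpen W ∧ (x : M) ∈ W ∧ W ⊆ V x ∧
      ∀ y ∈ W, A' y = MvPolynomial.C (k x x : ℝ) * A x y ∧
        B' y = MvPolynomial.C (k x x : ℝ) * B x y := by
    intro x
    have h1 : ∀ᶠ y in 𝓝 (x : M), ∃ hy : y ∈ U, k x ⟨y, hy⟩ = k x x := by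
      rw [← hU.isOpenEmbedding_subtypeVal.map_nhds_eq, Filter.eventually_map]
      filter_upwards [hk x x (hxV x)] with y hy
      exact ⟨y.2, hy⟩
    obtain ⟨W, hW, hWo, hxW⟩ := eventually_nhds_iff.1 (h1.and ((hVo x).eventually_mem (hxV x)))
    refine ⟨W, hWo, hxW, fun y hy => (hW y hy).2, fun y hy => ?_⟩
    obtain ⟨⟨hyU, hky⟩, hyV⟩ := hW y hy
    rw [← hky]
    exact ⟨hA' x ⟨y, hyU⟩ hyV, hB' x ⟨y, hyU⟩ hyV⟩
  refine ⟨A', B', ⟨isKillingTensor_of_locally fun x hx => ?_,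
    isKillingTensor_of_locally fun x hx => ?_, fun x hx => ?_⟩, fun x hx => ?_⟩
  · obtain ⟨W, hWo, hxW, hWV, hW⟩ := hloc ⟨x, hx⟩
    exact ⟨W, A ⟨x, hx⟩, _, hWo, hxW, (hAB ⟨x, hx⟩).left.mono hWV, fun y hy => (hW y hy).1⟩
  · obtain ⟨W, hWo, hxW, hWV, hW⟩ := hloc ⟨x, hx⟩
    exact ⟨W, B ⟨x, hx⟩, _, hWo, hxW, (hAB ⟨x, hx⟩).right.mono hWV, fun y hy => (hW y hy).2⟩
  · obtain ⟨W, hWo, hxW, hWV, hW⟩ := hloc ⟨x, hx⟩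
    refine closure_mono ?_ (((hAB ⟨x, hx⟩).relPrime.mono hWo hWV) hxW)
    rintro y ⟨hy, hne, hrel⟩
    have hk0 := (k ⟨x, hx⟩ ⟨x, hx⟩).ne_zero
    refine ⟨hVU _ (hWV hy), ?_, ?_⟩
    · rw [(hW y hy).2]
      exact mul_ne_zero (by simp) hne
    · rw [(hW y hy).1, (hW y hy).2]
      exact (isRelPrime_C_mul_iff hk0).2 hrel
  · obtain ⟨W, hWo, hxW, hWV, hW⟩ := hloc ⟨x, hx⟩
    rw [(hW x hxW).1, (hW x hxW).2]
    linear_combination MvPolynomial.C (k ⟨x, hx⟩ ⟨x, hx⟩ : ℝ) * hfrac ⟨x, hx⟩ x (hxV ⟨x, hx⟩)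

end LocalConstants

/-! ### Quotients of Killing tensors are rational integrals. -/

section Converse

variable {m : ℕ} {M : Type*} [TopologicalSpace M] [ChartedSpace (E m) M]

lemma poisson_div_eq_zero {H F G : E m → E m → ℝ} {u a : E m}
    (hF : DifferentiableAt ℝ (fun z : E m × E m => F z.1 z.2) (u, a))
    (hG : DifferentiableAt ℝ (fun z : E m × E m => G z.1 z.2) (u, a)) (h0 : G u a ≠ 0)
    (hHF : poisson H F u a = 0) (hHG : poisson H G u a = 0) :
    poisson H (fun y b => F y b / G y b) u a = 0 := by
  have h1 := hasFDerivAt_div hF hG h0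
  rw [poisson_eq_fderiv H hF] at hHF
  rw [poisson_eq_fderiv H hG] at hHG
  rw [poisson_eq_fderiv H h1.differentiableAt, h1.fderiv]
  simp [hHF, hHG]

variable [IsManifold (𝓡 m) ∞ M]

/-- Smoothness is expressed through charts and not for the raw fibre components, so openness of the
nonvanishing set is read in straight coordinates. -/
lemma IsKillingTensor.eventually_ne_zero {g : PseudoMetric m M} (hg : g.HasConstantCurvature)
    {U : Set M} (hU : IsOpen U) {d : ℕ} {K : M → MvPolynomial (Fin m) ℝ}
    (hK : IsKillingTensor g U d K) {x : M} (hx : x ∈ U) (h0 : K x ≠ 0) :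
    ∀ᶠ y in 𝓝 x, K y ≠ 0 := by
  obtain ⟨ψ, S, T, ρ, hxψ, hs⟩ := exists_isStraightening g hg x
  obtain ⟨δ, hδ, hsub⟩ := exists_ball_chart hxψ hU hx
  have hopen := isOpen_setOf_ne_zero Metric.isOpen_ball (hs.contDiffOn_straighten hK.polynomial hsub)
  have hmem : ψ x ∈ {ξ ∈ Metric.ball (ψ x) δ | straighten ψ S K ξ ≠ 0} := by
    refine ⟨Metric.mem_ball_self hδ, fun h => h0 ?_⟩
    rwa [hs.straighten_eq_zero_iff (ψ.map_source hxψ), ψ.left_inv hxψ] at h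
  filter_upwards [(ψ.continuousAt hxψ).eventually (hopen.mem_nhds hmem),
    ψ.open_source.mem_nhds hxψ] with y hy hyψ h
  refine hy.2 ?_
  rwa [hs.straighten_eq_zero_iff (ψ.map_source hyψ), ψ.left_inv hyψ]

/-- The common zeros of two generically relatively prime Killing tensors do not separate. -/
lemma IsKillingPair.commonZerosDoNotSeparate {g : PseudoMetric m M} (hg : g.HasConstantCurvature)
    {U : Set M} (hU : IsOpen U) {r s : ℕ} {A B : M → MvPolynomial (Fin m) ℝ}
    (h : IsKillingPair g U r s A B) : CommonZerosDoNotSeparate U A B := by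
  intro V hVU hV hVc
  set Z : Set M := {x | A x = 0 ∧ B x = 0} with hZ
  have hVZ : IsOpen (V \ Z) := by
    rw [isOpen_iff_mem_nhds]
    rintro x ⟨hxV, hxZ⟩
    have h1 : ∀ᶠ y in 𝓝 x, y ∉ Z := by
      by_cases hA : A x = 0
      · exact (h.right.eventually_ne_zero hg hU (hVU hxV) fun hB => hxZ ⟨hA, hB⟩).mono
          fun y hy hyZ => hy hyZ.2
      · exact (h.left.eventually_ne_zero hg hU (hVU hxV) hA).mono fun y hy hyZ => hy hyZ.1
    exact Filter.inter_mem (hV.mem_nhds hxV) h1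
  have hBd : V ⊆ closure {x ∈ V | B x ≠ 0} :=
    (h.relPrime.mono hV hVU).trans (closure_mono fun x hx => ⟨hx.1, hx.2.1⟩)
  intro W₁ W₂ hW₁ hW₂ hcov hne₁ hne₂
  by_contra hemp
  rw [not_nonempty_iff_eq_empty] at hemp
  -- V \ Z is dense in V because B is generically nonzero. If the two pieces were disjoint,
  -- connectedness of V would still give a point z in both closures.
  have hVcl : V ⊆ closure ((V \ Z) ∩ W₁) ∪ closure ((V \ Z) ∩ W₂) := by
    rw [← closure_union, ← inter_union_distrib_left, inter_eq_left.2 hcov]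
    exact hBd.trans (closure_mono fun x hx => ⟨hx.1, fun hxZ => hx.2 hxZ.2⟩)
  obtain ⟨z, hzV, hz₁, hz₂⟩ := isPreconnected_closed_iff.1 hVc _ _ isClosed_closure isClosed_closure
    hVcl (hne₁.mono fun x hx => ⟨hx.1.1, subset_closure hx⟩)
    (hne₂.mono fun x hx => ⟨hx.1.1, subset_closure hx⟩)
  obtain ⟨ψ, S, T, ρ, hzψ, hs⟩ := exists_isStraightening g hg z
  obtain ⟨δ, hδ, hsub⟩ := exists_ball_chart hzψ hV hzV
  set O := Metric.ball (ψ z) δ with hO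
  have hOo : IsOpen O := Metric.isOpen_ball
  have hconv : Convex ℝ O := convex_ball _ _
  have hOt : O ⊆ ψ.target := fun ξ hξ => (hsub hξ).1
  have hOU : O ⊆ ψ.target ∩ ψ.symm ⁻¹' U := fun ξ hξ => ⟨hOt hξ, hVU (hsub hξ).2⟩
  have hopen : ∀ {W : Set M}, IsOpen W → IsOpen (O ∩ ψ.symm ⁻¹' W) := fun hW =>
    (ψ.symm.continuousOn.mono hOt).isOpen_inter_preimage hOo hW
  have hnonempty : ∀ {W : Set M}, z ∈ closure W → (O ∩ ψ.symm ⁻¹' W).Nonempty := by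
    intro W hzW
    obtain ⟨y, hy, hyW⟩ := mem_closure_iff.1 hzW (ψ.symm '' O) (isOpen_symm_image hOo hOt)
      ⟨ψ z, Metric.mem_ball_self hδ, ψ.left_inv hzψ⟩
    obtain ⟨ξ, hξ, rfl⟩ := hy
    exact ⟨ξ, hξ, hyW⟩
  -- A segment between the two pieces on which B is nowhere zero would be a connected set in V \ Z
  -- meeting both. So B vanishes somewhere on each such segment, and being conserved it vanishes
  -- identically over the first piece.
  have hzero : ∀ ξ ∈ O ∩ ψ.symm ⁻¹' ((V \ Z) ∩ W₁), straighten ψ S B ξ = 0 := by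
    refine eq_zero_of_forall_segment hOo hconv (hs.contDiffOn_straighten h.right.polynomial hOU)
      (fun ξ hξ => hs.flowDeriv_eq_zero hU h.right (hOU hξ).1 (hOU hξ).2) inter_subset_left
      inter_subset_left (hopen (hVZ.inter hW₂)) (hnonempty hz₂) ?_
    rintro ξ ⟨hξ, hξ₁⟩ ζ ⟨hζ, hζ₂⟩
    by_contra! hseg
    have hsegO : ∀ t ∈ Icc (0 : ℝ) 1, ξ + t • (ζ - ξ) ∈ O := fun t ht =>
      hconv.add_smul_sub_mem hξ hζ ht
    have hγ : ContinuousOn (fun t : ℝ => ψ.symm (ξ + t • (ζ - ξ))) (Icc 0 1) :=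
      ψ.symm.continuousOn.comp (by fun_prop) fun t ht => hOt (hsegO t ht)
    have himg : (fun t : ℝ => ψ.symm (ξ + t • (ζ - ξ))) '' Icc 0 1 ⊆ V \ Z := by
      rintro _ ⟨t, ht, rfl⟩
      exact ⟨(hsub (hsegO t ht)).2, fun h0 =>
        hseg t ht ((hs.straighten_eq_zero_iff (hOt (hsegO t ht))).2 h0.2)⟩
    obtain ⟨y, hy, hyW⟩ := isPreconnected_Icc.image _ hγ W₁ W₂ hW₁ hW₂ (himg.trans hcov)
      ⟨ψ.symm ξ, ⟨0, by simp, by simp⟩, hξ₁.2⟩ ⟨ψ.symm ζ, ⟨1, by simp, by simp⟩, hζ₂.2⟩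
    exact (hemp ▸ (⟨himg hy, hyW⟩ : y ∈ (V \ Z) ∩ (W₁ ∩ W₂)) : y ∈ (∅ : Set M))
  obtain ⟨ξ, hξ⟩ := hnonempty hz₁
  have hd := hs.dense_straighten h.relPrime hOo hOU
  -- The first piece is open and nonempty in the ball, so it contains a generic point, where B ≠ 0.
  obtain ⟨ζ, hζ, hζd⟩ := mem_closure_iff.1 (hd hξ.1) _ (hopen (hVZ.inter hW₁)) hξ
  exact hζd.2.1 (hzero ζ hζ)

/-- A quotient of Killing tensors is a rational integral. -/
theorem IsKillingPair.isRationalIntegral {g : PseudoMetric m M} (hg : g.HasConstantCurvature)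
    {U : Set M} (hU : IsOpen U) {r s : ℕ} {A B : M → MvPolynomial (Fin m) ℝ}
    (h : IsKillingPair g U r s A B) : IsRationalIntegral g U r s A B where
  numerator := h.left.polynomial
  denominator := h.right.polynomial
  relPrime := h.relPrime
  commonZeros := h.commonZerosDoNotSeparate hg hU
  integral φ hφ u hu hx a hne := by
    have hmem : (u, a) ∈ (φ.target ∩ φ.symm ⁻¹' U) ×ˢ (univ : Set (E m)) := ⟨⟨hu, hx⟩, mem_univ _⟩
    have hd : ∀ {d : ℕ} {K : M → MvPolynomial (Fin m) ℝ}, IsKillingTensor g U d K →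
        DifferentiableAt ℝ (fun z : E m × E m => inChart K φ z.1 z.2) (u, a) := fun hK =>
      ((hK.polynomial.smooth φ hφ).contDiffAt (((φ.symm.isOpen_inter_preimage hU).prod
        isOpen_univ).mem_nhds hmem)).differentiableAt (by simp)
    exact poisson_div_eq_zero (hd h.left) (hd h.right) hne (h.left.integral φ hφ u hu hx a)
      (h.right.integral φ hφ u hu hx a)

end Converse

end RationalIntegrals

end

theorem theorem4 (m r s : ℕ) {M : Type*} [TopologicalSpace M] [T2Space M]
    [SecondCountableTopology M] [ChartedSpace (EuclideanSpace ℝ (Fin m)) M]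
    [IsManifold (𝓡 m) ∞ M] (g₀ : RationalIntegrals.PseudoMetric m M)
    (hg₀ : g₀.HasConstantCurvature) (U : Set M) (hU : IsOpen U) (hsc : SimplyConnectedSpace U) :
    (∀ P Q : M → MvPolynomial (Fin m) ℝ, RationalIntegrals.IsRationalIntegral g₀ U r s P Q →
      ∃ A B : M → MvPolynomial (Fin m) ℝ,
        RationalIntegrals.IsKillingTensor g₀ U r A ∧ RationalIntegrals.IsKillingTensor g₀ U s B ∧
        RationalIntegrals.GenericallyRelPrime U A B ∧
        RationalIntegrals.SameFraction U P Q A B) ∧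
    (∀ A B : M → MvPolynomial (Fin m) ℝ,
      RationalIntegrals.IsKillingTensor g₀ U r A → RationalIntegrals.IsKillingTensor g₀ U s B →
      RationalIntegrals.GenericallyRelPrime U A B →
      RationalIntegrals.IsRationalIntegral g₀ U r s A B) := by
  refine ⟨fun P Q h => ?_, fun A B hA hB hrel => ?_⟩
  · obtain ⟨A, B, hAB, hfrac⟩ := h.exists_global_isKillingPair hg₀ hU
    exact ⟨A, B, hAB.left, hAB.right, hAB.relPrime, hfrac⟩
  · exact RationalIntegrals.IsKillingPair.isRationalIntegral hg₀ hU ⟨hA, hB, hrel⟩
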